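/- Let $\mathbb{T}=\mathbb{R}/2\pi\mathbb{Z}$, with the normalized measure $dx/2\pi$, let $\langle x\rangle=(1+x^2)^{1/2}$, and for $s\ge 0$ let $H^s(\mathbb{T})$ be the Sobolev space with norm $\|f\|_{H^s}=\big(\sum_{n\in\mathbb{Z}}\langle n\rangle^{2s}|\widehat f(n)|^2\big)^{1/2}$. For $\rho>0$, $0<\gamma<1$ and $T>0$, a function $w\in C([0,T];\mathbb{R})$ is called $(\rho,\gamma)$-irregular on $[0,T]$ if $$\sup_{a\in\mathbb{R}}\ \sup_{0\le r<t\le T}\ \langle a\rangle^{\rho}\,\frac{\big|\int_r^t e^{iaw(t')}\,dt'\big|}{|t-r|^{\gamma}}<\infty ,$$ and it is called $(\rho,\gamma)$-irregular on $\mathbb{R}_+$ if it is $(\rho,\gamma)$-irregular on $[0,T]$ for every finite $T>0$. Consider the modulated cubic NLS on $\mathbb{T}$ $$i\partial_t u+\partial_x^2u\cdot\partial_t w=|u|^2u,\qquad u|_{t=0}=u_0 .$$ A solution $u\in C(J;H^s(\mathbb{T}))$, where $s\ge\frac16$ and $J=[0,\tau]$ or $J=[0,\infty)$, is a function satisfying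 the Duhamel formulation $$u(t)=e^{i(w(t)-w(0))\partial_x^2}u_0-i\int_0^t e^{i(w(t)-w(t'))\partial_x^2}\big(|u|^2u\big)(t')\,dt',\qquad t\in J,$$ understood for each spatial Fourier coefficient (recall that $H^s(\mathbb{T})\subset L^3(\mathbb{T})$ for $s\ge\frac16$). **Theorem A.1.** Let $\rho>\frac23$, $\frac12<\gamma<1$ and $T>0$, let $w$ be $(\rho,\gamma)$-irregular on $[0,T]$, and let $s\ge\frac16$. Then the modulated cubic NLS is unconditionally locally well-posed in $H^s(\mathbb{T})$: for every $u_0\in H^s(\mathbb{T})$ there is $\tau\in(0,T]$ such that there is exactly one solution in the entire class $C([0,\tau];H^s(\mathbb{T}))$ with $u|_{t=0}=u_0$, and likewise exactly one in $C([0,\tau'];H^s(\mathbb{T}))$ for every $0<\tau'\le\tau$. If, in addition, $w$ is $(\rho,\gamma)$-irregular on $\mathbb{R}_+$, then the equation is unconditionally globally well-posed in $H^s(\mathbb{T})$: for every $u_0\in H^s(\mathbb{T})$ there is exactly one solution in $C(\mathbb{R}_+;H^s(\mathbb{T}))$ with $u|_{t=0}=u_0$, and exactly one in $C([0,\tau];H^s(\mathbb{T}))$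 for every $\tau>0$. -/

import Mathlib

open MeasureTheory Set

noncomputable section

namespace ModulatedNLS

/-- The circle `𝕋 = ℝ / 2πℤ`.  Integrals over it (in particular Mathlib's `fourierCoeff`) are taken
with respect to the normalized measure `AddCircle.haarAddCircle`, i.e. `dx / 2π`. -/
abbrev Circ : Type := AddCircle (2 * Real.pi)

instance instFactTwoPiPos : Fact (0 < 2 * Real.pi) := ⟨Real.two_pi_pos⟩

/-- The complex Hilbert space `L²(𝕋)`. -/
abbrev L2 : Type := Lp ℂ 2 (AddCircle.haarAddCircle (T := 2 * Real.pi))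

/-- The Japanese bracket `⟨x⟩ = (1 + x²)^{1/2}`. -/
def bracket (x : ℝ) : ℝ := Real.sqrt (1 + x ^ 2)

theorem bracket_pos (x : ℝ) : 0 < bracket x := Real.sqrt_pos.2 (by positivity)

/-! ### The Sobolev spaces `H^s(𝕋)` -/

/-- The weighted Fourier coefficients `⟨n⟩^s f̂(n)`. -/
def weightedCoeff (s : ℝ) (f : L2) (n : ℤ) : ℂ :=
  ((bracket (n : ℝ) ^ s : ℝ) : ℂ) * fourierCoeff f n

theorem weightedCoeff_add (s : ℝ) (f g : L2) :
    weightedCoeff s (f + g) = weightedCoeff s f + weightedCoeff s g := by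
  funext n
  simp only [weightedCoeff, Pi.add_apply, ← fourierBasis_repr, map_add, lp.coeFn_add]
  ring

theorem weightedCoeff_smul (s : ℝ) (c : ℂ) (f : L2) :
    weightedCoeff s (c • f) = c • weightedCoeff s f := by
  funext n
  simp only [weightedCoeff, Pi.smul_apply, ← fourierBasis_repr, map_smul, lp.coeFn_smul,
    smul_eq_mul]
  ring

/-- The `f ∈ L²(𝕋)` with `∑ₙ ⟨n⟩^{2s} |f̂(n)|² < ∞`. For `s ≥ 0` this is all of `H^s(𝕋)`. -/
def sobolevSubmodule (s : ℝ) : Submodule ℂ L2 where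
  carrier := {f | Memℓp (weightedCoeff s f) 2}
  zero_mem' := by
    have h : weightedCoeff s 0 = 0 := by simpa using weightedCoeff_smul s 0 0
    simpa [h] using (zero_memℓp (E := fun _ : ℤ => ℂ) (p := 2))
  add_mem' := by
    intro f g hf hg
    change Memℓp (weightedCoeff s (f + g)) 2
    rw [weightedCoeff_add]
    exact Memℓp.add hf hg
  smul_mem' := by
    intro c f hf
    change Memℓp (weightedCoeff s (c • f)) 2
    rw [weightedCoeff_smul]
    exact Memℓp.const_smul hf c

/-- The Sobolev space `H^s(𝕋)`, for `s ≥ 0`. It is a type of its own since it does not carry the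
`L²` norm but the `H^s` norm `(∑ₙ ⟨n⟩^{2s} |f̂(n)|²)^{1/2}`. -/
def SobolevSpace (s : ℝ) : Type := sobolevSubmodule s

namespace SobolevSpace

variable {s : ℝ}

instance : AddCommGroup (SobolevSpace s) := inferInstanceAs (AddCommGroup (sobolevSubmodule s))

instance : Module ℂ (SobolevSpace s) := inferInstanceAs (Module ℂ (sobolevSubmodule s))

/-- The inclusion `H^s(𝕋) ⊆ L²(𝕋)`. -/
def toL2 : SobolevSpace s →ₗ[ℂ] L2 := (sobolevSubmodule s).subtype

/-- The isometry `f ↦ (⟨n⟩^s f̂(n))ₙ` of `H^s(𝕋)` into `ℓ²(ℤ)`, which defines the `H^s` norm. -/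
def toLp : SobolevSpace s →ₗ[ℂ] lp (fun _ : ℤ => ℂ) 2 where
  toFun f := ⟨weightedCoeff s (toL2 f), f.2⟩
  map_add' f g := Subtype.ext (weightedCoeff_add s (toL2 f) (toL2 g))
  map_smul' c f := Subtype.ext (weightedCoeff_smul s c (toL2 f))

theorem toLp_injective : Function.Injective (toLp (s := s)) := by
  intro f g h
  have h1 : ∀ n : ℤ, weightedCoeff s (toL2 f) n = weightedCoeff s (toL2 g) n := fun n =>
    congrFun (congrArg Subtype.val h) n
  have h2 : (toL2 f) = toL2 g := by
    apply (fourierBasis (T := 2 * Real.pi)).repr.injective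
    apply Subtype.ext
    funext n
    have hw : ((bracket (n : ℝ) ^ s : ℝ) : ℂ) ≠ 0 :=
      Complex.ofReal_ne_zero.2 (Real.rpow_pos_of_pos (bracket_pos _) s).ne'
    have := mul_left_cancel₀ hw (h1 n)
    rw [← fourierBasis_repr, ← fourierBasis_repr] at this
    exact this
  exact Subtype.ext h2

instance : NormedAddCommGroup (SobolevSpace s) :=
  NormedAddCommGroup.induced (SobolevSpace s) (lp (fun _ : ℤ => ℂ) 2) toLp toLp_injective

instance : NormedSpace ℂ (SobolevSpace s) :=
  NormedSpace.induced ℂ (SobolevSpace s) (lp (fun _ : ℤ => ℂ) 2) toLp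

/-- The Fourier coefficient `f̂(n) = ∫ f(x) e^{-inx} dx / 2π`. -/
def coeff (f : SobolevSpace s) (n : ℤ) : ℂ := fourierCoeff (toL2 f) n

/-- The `n`-th Fourier coefficient of `|f|² f`. It is a genuine integral when `s ≥ 1/6`, since
`H^s(𝕋) ⊆ L³(𝕋)` then. -/
def cubicCoeff (f : SobolevSpace s) (n : ℤ) : ℂ :=
  fourierCoeff (fun x : Circ => ((‖toL2 f x‖ ^ 2 : ℝ) : ℂ) * toL2 f x) n

end SobolevSpace

/-! ### Irregular modulations -/

/-- `Φ^w_{t,r}(a) = ∫_r^t e^{i a w(t')} dt'`. -/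
def Phi (w : ℝ → ℝ) (t r a : ℝ) : ℂ :=
  ∫ t' in r..t, Complex.exp (Complex.I * a * w t')

/-- `w ∈ C([0,T]; ℝ)` is `(ρ, γ)`-irregular on `[0,T]`:
`sup_{a ∈ ℝ} sup_{0 ≤ r < t ≤ T} ⟨a⟩^ρ |Φ^w_{t,r}(a)| / |t - r|^γ < ∞`. -/
def IsIrregularOn (ρ γ : ℝ) (w : ℝ → ℝ) (T : ℝ) : Prop :=
  ContinuousOn w (Icc 0 T) ∧
    ∃ C : ℝ, ∀ a r t : ℝ, 0 ≤ r → r < t → t ≤ T →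
      bracket a ^ ρ * (‖Phi w t r a‖ / |t - r| ^ γ) ≤ C

/-- `w` is `(ρ, γ)`-irregular on `ℝ₊`: it is so on `[0,T]` for every finite `T > 0`. -/
def IsIrregular (ρ γ : ℝ) (w : ℝ → ℝ) : Prop :=
  ∀ T : ℝ, 0 < T → IsIrregularOn ρ γ w T

/-! ### The modulated cubic NLS `i ∂ₜu + ∂ₓ²u · ∂ₜw = |u|² u` -/

/-- The Fourier multiplier `e^{-i (w(t) - w(r)) n²}` of the modulated linear propagator
`e^{i (w(t) - w(r)) ∂ₓ²}` from time `r` to time `t`, which is `U^w(t) U^w(r)⁻¹` for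
`U^w(t) = e^{i w(t) ∂ₓ²}`. -/
def propagator (w : ℝ → ℝ) (t r : ℝ) (n : ℤ) : ℂ :=
  Complex.exp (-Complex.I * ((w t - w r : ℝ) : ℂ) * (n : ℂ) ^ 2)

/-- `u ∈ C(J; H^s(𝕋))` solves the modulated cubic NLS with `u(0) = u₀` on the time interval `J`
(which starts at `0`), i.e. it satisfies the Duhamel formulation
`u(t) = U^w(t) U^w(0)⁻¹ u₀ - i ∫₀ᵗ U^w(t) U^w(r)⁻¹ (|u|² u)(r) dr` for all `t ∈ J`, written on the
Fourier side. Values of `u` outside `J` are irrelevant. -/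
structure IsSolution (w : ℝ → ℝ) {s : ℝ} (u₀ : SobolevSpace s) (J : Set ℝ)
    (u : ℝ → SobolevSpace s) : Prop where
  continuousOn : ContinuousOn u J
  duhamel : ∀ t ∈ J, ∀ n : ℤ,
    (u t).coeff n = propagator w t 0 n * u₀.coeff n
      - Complex.I * ∫ r in (0 : ℝ)..t, propagator w t r n * (u r).cubicCoeff n

/-- There is exactly one solution in the entire class `C(J; H^s(𝕋))` with initial data `u₀`. -/
def ExistsUniqueSolution (w : ℝ → ℝ) {s : ℝ} (u₀ : SobolevSpace s) (J : Set ℝ) : Prop :=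
  ∃ u : ℝ → SobolevSpace s, IsSolution w u₀ J u ∧
    ∀ v : ℝ → SobolevSpace s, IsSolution w u₀ J v → EqOn v u J

/-- Unconditional local well-posedness in `H^s(𝕋)`, for a modulation given on `[0,T]`: every
`u₀ ∈ H^s(𝕋)` has a local existence time `τ ∈ (0,T]` such that there is exactly one solution in
`C([0,τ]; H^s(𝕋))`, and likewise in `C([0,τ']; H^s(𝕋))` for all smaller times `τ'`. -/
def UnconditionallyLocallyWellPosed (w : ℝ → ℝ) (T s : ℝ) : Prop :=
  ∀ u₀ : SobolevSpace s, ∃ τ : ℝ, 0 < τ ∧ τ ≤ T ∧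
    ∀ τ' : ℝ, 0 < τ' → τ' ≤ τ → ExistsUniqueSolution w u₀ (Icc 0 τ')

/-- Unconditional global well-posedness in `H^s(𝕋)`, for a modulation given on `ℝ₊`: for every
`u₀ ∈ H^s(𝕋)` there is exactly one solution in `C(ℝ₊; H^s(𝕋))`, and exactly one in
`C([0,τ]; H^s(𝕋))` for every `τ > 0`. -/
def UnconditionallyGloballyWellPosed (w : ℝ → ℝ) (s : ℝ) : Prop :=
  ∀ u₀ : SobolevSpace s, ExistsUniqueSolution w u₀ (Ici 0) ∧
    ∀ τ : ℝ, 0 < τ → ExistsUniqueSolution w u₀ (Icc 0 τ)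

end ModulatedNLS

end

open MeasureTheory Set
open scoped ENNReal

noncomputable section

namespace ModulatedNLS

/-! ### A quadrilinear form on `ℤ³` -/

/-! Undo the linear flow: with v(t,n) = e^{i w(t) n²} û(t,n), the equation becomes v' = tri(c(t); v,
v, v), where the coefficient of v(n+j) v̄(n+j+k) v(n+k) is c = -i e^{2ijk w(t)}. Irregularity of w
says exactly that the time integral of c over [r,t] is O((t-r)^γ ⟨2jk⟩^{-ρ}). So the averaged
trilinear operator gains decay |jk|^{-ρ} off the axes jk = 0 and costs only (t-r)^γ. Iterated
Cauchy–Schwarz (`form_bound`) shows that this kernel maps ℓ²×ℓ²×ℓ² to ℓ², even if one input is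
merely in ℓ⁴; on the axes the ℓ² bound is immediate. Because γ > 1/2, the equation for v is a Young
equation: sewing (`sewing_bound`, `wnorm_integral_tri_sub_le`) bounds the integral along γ-Hölder
paths with error (t-r)^{2γ}, and a contraction argument gives short-time existence
(`exists_isMild_short`) and uniqueness (`IsMild.eqOn`) among Hölder paths.

Unconditional uniqueness requires that a solution known only to be continuous in H^s be
automatically γ-Hölder in ℓ² (`IsMild.exists_holder`). Since H^{1/6} ⊂ L³, each Fourier coefficient
of the nonlinearity is bounded, so v is Lipschitz in ℓ^∞. Interpolation with the ℓ² bound makes v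
1/2-Hölder in ℓ⁴. The off-axis estimate accepts one ℓ⁴ entry, so the sewing defect is
O((t-r)^{γ+1/2}) with γ + 1/2 > 1. The axes, where the ℓ⁴ estimate is not available, have
time-independent coefficients and contribute only O(t-r). Uniqueness then follows in ℓ².

Existence on the whole interval rests on conservation of the ℓ² norm (`IsMild.tsum_norm_sq_eq`): the
averaged nonlinearity does no work, and all other terms of the energy increment are O((t-r)^{2γ}),
which forces constancy. The step length is made to depend on the conserved norm alone by solving in
the weight 1 + δ⟨n⟩^s, with δ so small that the H^s norm adds at most 1; the trilinear constant does
not depend on δ (`admissibleWeight_sob`). Hence every H^s datum has a solution on all of [0,T].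

The two pictures are matched by `fourierCoeff_cubic_eq_tri`, which identifies the Fourier
coefficients of |f|²f with an absolutely convergent trilinear sum as soon as f ∈ H^{1/6}. -/

/-- The Cauchy–Schwarz inequality for sums in `ℝ≥0∞`. -/
theorem ennreal_tsum_mul_sq_le {ι : Type*} (f g : ι → ℝ≥0∞) :
    (∑' i, f i * g i) ^ 2 ≤ (∑' i, f i ^ 2) * ∑' i, g i ^ 2 := by
  let _ : MeasurableSpace ι := ⊤
  have h := ENNReal.lintegral_mul_le_Lp_mul_Lq (μ := Measure.count) (f := f) (g := g)
    (Real.HolderConjugate.two_two) measurable_from_top.aemeasurable measurable_from_top.aemeasurable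
  simp only [Pi.mul_apply, lintegral_count' measurable_from_top] at h
  have h2 := ENNReal.pow_le_pow_left (n := 2) h
  refine h2.trans_eq ?_
  rw [mul_pow, ← ENNReal.rpow_natCast, ← ENNReal.rpow_natCast, ← ENNReal.rpow_mul,
    ← ENNReal.rpow_mul]
  norm_num

/-- Cauchy–Schwarz and translation invariance; the point is uniformity in the two shifts. -/
theorem tsum_mul_shift_le {m : ℤ → ℝ≥0∞} {Λ : ℝ≥0∞}
    (hΛ : ∑' j, m j ^ 8 ≤ Λ) (x z : ℤ) :
    ∑' y, m (y - x) ^ 4 * m (y - z) ^ 4 ≤ Λ := by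
  have h1 : ∀ x : ℤ, ∑' y, (m (y - x) ^ 4) ^ 2 ≤ Λ := by
    intro x
    refine le_trans (le_of_eq ?_) hΛ
    rw [← (Equiv.subRight x).tsum_eq (fun y => m y ^ 8)]
    simp only [← pow_mul, Equiv.subRight_apply]
  have h := (ennreal_tsum_mul_sq_le (fun y => m (y - x) ^ 4) (fun y => m (y - z) ^ 4)).trans
    (mul_le_mul' (h1 x) (h1 z))
  rw [← sq] at h
  exact (ENNReal.pow_le_pow_left_iff two_ne_zero).1 h

/-- The form `∑ m(j)⁵ m(k)⁵ a(y-j-k) b(y-k) c(y) e(y-j)`. -/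
theorem form_bound {m : ℤ → ℝ≥0∞} {Λ : ℝ≥0∞} (heven : ∀ j, m (-j) = m j)
    (hΛ : ∑' j, m j ^ 8 ≤ Λ) (a b e : ℤ → ℝ≥0∞) :
    (∑' y, (∑' p : ℤ × ℤ, m p.1 ^ 5 * m p.2 ^ 5 *
      (a (y - p.1 - p.2) * b (y - p.2) * e (y - p.1))) ^ 2) ^ 2 ≤
      Λ ^ 5 * (∑' x, a x ^ 4) * (∑' x, b x ^ 2) ^ 2 * (∑' x, e x ^ 2) ^ 2 := by
  -- The kernel is split as m⁵ = m³·m². `U` carries the ℓ⁴ factor and is bounded uniformly in `y`;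
  -- `V` carries the two ℓ² factors and is summed over `y`.
  set U : ℤ → ℝ≥0∞ := fun y => ∑' p : ℤ × ℤ, (a (y - p.1 - p.2) * m p.1 ^ 3 * m p.2 ^ 3) ^ 2
  set V : ℤ → ℝ≥0∞ := fun y => ∑' p : ℤ × ℤ, (b (y - p.2) * e (y - p.1) * m p.1 ^ 2 * m p.2 ^ 2) ^ 2
  have hU : ∀ y, U y ^ 2 ≤ Λ ^ 3 * ∑' x, a x ^ 4 := by
    intro y
    -- A second Cauchy–Schwarz, with m⁶ = m²·m⁴: one factor is the eighth-power sum of m, the other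
    -- holds a⁴ against two translates of m⁴.
    have h1 := ennreal_tsum_mul_sq_le
      (fun p : ℤ × ℤ => a (y - p.1 - p.2) ^ 2 * m p.1 ^ 2 * m p.2 ^ 2)
      (fun p : ℤ × ℤ => m p.1 ^ 4 * m p.2 ^ 4)
    have h2 : ∑' p : ℤ × ℤ, (m p.1 ^ 4 * m p.2 ^ 4) ^ 2 ≤ Λ ^ 2 := by
      rw [ENNReal.tsum_prod']
      calc _ = (∑' j, m j ^ 8) * ∑' j, m j ^ 8 := by
            simp_rw [mul_pow, ← pow_mul, ENNReal.tsum_mul_left, ENNReal.tsum_mul_right]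
        _ ≤ _ := by rw [sq]; exact mul_le_mul' hΛ hΛ
    have h3 : ∑' p : ℤ × ℤ, (a (y - p.1 - p.2) ^ 2 * m p.1 ^ 2 * m p.2 ^ 2) ^ 2
        ≤ (∑' x, a x ^ 4) * Λ := by
      rw [ENNReal.tsum_prod']
      calc _ = ∑' j, ∑' x, a x ^ 4 * (m (j - 0) ^ 4 * m (j - (y - x)) ^ 4) := by
            refine tsum_congr fun j => ?_
            rw [← (Equiv.subLeft (y - j)).tsum_eq]
            refine tsum_congr fun k => ?_
            have : m (j - (y - k)) = m (y - j - k) := by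
              rw [← heven]; congr 1; ring
            simp only [Equiv.subLeft_apply, sub_zero, this, sub_sub_cancel]
            ring
        _ = ∑' x, a x ^ 4 * ∑' j, (m (j - 0) ^ 4 * m (j - (y - x)) ^ 4) := by
            rw [ENNReal.tsum_comm]
            simp_rw [ENNReal.tsum_mul_left]
        _ ≤ ∑' x, a x ^ 4 * Λ :=
            ENNReal.tsum_le_tsum fun x => mul_le_mul' le_rfl (tsum_mul_shift_le hΛ _ _)
        _ = _ := ENNReal.tsum_mul_right
    calc U y ^ 2 = (∑' p : ℤ × ℤ, a (y - p.1 - p.2) ^ 2 * m p.1 ^ 2 * m p.2 ^ 2 *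
            (m p.1 ^ 4 * m p.2 ^ 4)) ^ 2 := by
          congr 1; refine tsum_congr fun p => ?_; ring
      _ ≤ (∑' x, a x ^ 4) * Λ * Λ ^ 2 := h1.trans (mul_le_mul' h3 h2)
      _ = _ := by ring
  have hV : ∑' y, V y ≤ Λ * (∑' x, b x ^ 2) * (∑' x, e x ^ 2) := by
    calc ∑' y, V y = ∑' y, ∑' z, ∑' x, b x ^ 2 * e z ^ 2 * (m (y - z) ^ 4 * m (y - x) ^ 4) := by
          refine tsum_congr fun y => ?_
          simp only [V]
          rw [ENNReal.tsum_prod', ← (Equiv.subLeft y).tsum_eq]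
          refine tsum_congr fun z => ?_
          rw [← (Equiv.subLeft y).tsum_eq]
          refine tsum_congr fun x => ?_
          simp only [Equiv.subLeft_apply, sub_sub_cancel]
          ring
      _ = ∑' z, ∑' x, b x ^ 2 * e z ^ 2 * ∑' y, (m (y - z) ^ 4 * m (y - x) ^ 4) := by
          rw [ENNReal.tsum_comm]
          refine tsum_congr fun z => ?_
          rw [ENNReal.tsum_comm]
          simp_rw [ENNReal.tsum_mul_left]
      _ ≤ ∑' z, ∑' x, b x ^ 2 * e z ^ 2 * Λ :=
          ENNReal.tsum_le_tsum fun z => ENNReal.tsum_le_tsum fun x =>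
            mul_le_mul' le_rfl (tsum_mul_shift_le hΛ _ _)
      _ = _ := by
          simp_rw [ENNReal.tsum_mul_right, ENNReal.tsum_mul_left]
          ring
  have hT : ∀ y, (∑' p : ℤ × ℤ, m p.1 ^ 5 * m p.2 ^ 5 *
      (a (y - p.1 - p.2) * b (y - p.2) * e (y - p.1))) ^ 2 ≤ U y * V y := by
    intro y
    refine le_trans (le_of_eq ?_) (ennreal_tsum_mul_sq_le
      (fun p : ℤ × ℤ => a (y - p.1 - p.2) * m p.1 ^ 3 * m p.2 ^ 3)
      (fun p : ℤ × ℤ => b (y - p.2) * e (y - p.1) * m p.1 ^ 2 * m p.2 ^ 2))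
    congr 1; refine tsum_congr fun p => ?_; ring
  have hsup : (⨆ y, U y) ^ 2 ≤ Λ ^ 3 * ∑' x, a x ^ 4 := by
    have := ENNReal.iSup_pow_of_ne_zero (f := U) two_ne_zero
    rw [this]
    exact iSup_le hU
  calc _ ≤ ((⨆ y, U y) * ∑' y, V y) ^ 2 := by
        gcongr
        rw [← ENNReal.tsum_mul_left]
        exact ENNReal.tsum_le_tsum fun y => (hT y).trans (mul_le_mul' (le_iSup U y) le_rfl)
    _ ≤ (Λ ^ 3 * ∑' x, a x ^ 4) * (Λ * (∑' x, b x ^ 2) * (∑' x, e x ^ 2)) ^ 2 := by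
        rw [mul_pow]
        exact mul_le_mul' hsup (ENNReal.pow_le_pow_left hV)
    _ = _ := by ring

/-- The form `∑ m(j)⁵ m(k)⁵ a(y-j-k) b(y-k) c(y) e(y-j)` is bounded by `ℓ⁴ × ℓ² × ℓ² × ℓ²`. -/
theorem form_bound_four {m : ℤ → ℝ≥0∞} {Λ : ℝ≥0∞} (heven : ∀ j, m (-j) = m j)
    (hΛ : ∑' j, m j ^ 8 ≤ Λ) (a b c e : ℤ → ℝ≥0∞) :
    (∑' y, ∑' p : ℤ × ℤ, m p.1 ^ 5 * m p.2 ^ 5 *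
      (a (y - p.1 - p.2) * b (y - p.2) * c y * e (y - p.1))) ^ 4 ≤
      Λ ^ 5 * (∑' x, a x ^ 4) * (∑' x, b x ^ 2) ^ 2 * (∑' x, c x ^ 2) ^ 2 *
        (∑' x, e x ^ 2) ^ 2 := by
  have h := ennreal_tsum_mul_sq_le c (fun y => ∑' p : ℤ × ℤ, m p.1 ^ 5 * m p.2 ^ 5 *
      (a (y - p.1 - p.2) * b (y - p.2) * e (y - p.1)))
  have h2 := ENNReal.pow_le_pow_left (n := 2) h
  rw [← pow_mul, mul_pow] at h2
  calc _ = (∑' y, c y * ∑' p : ℤ × ℤ, m p.1 ^ 5 * m p.2 ^ 5 *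
      (a (y - p.1 - p.2) * b (y - p.2) * e (y - p.1))) ^ (2 * 2) := by
        congr 1
        refine tsum_congr fun y => ?_
        rw [← ENNReal.tsum_mul_left]
        refine tsum_congr fun p => ?_
        ring
    _ ≤ _ := h2.trans (mul_le_mul' le_rfl (form_bound heven hΛ a b e))
    _ = _ := by ring

/-- The positive trilinear sum with kernel `κ`. -/
def posTri (κ : ℤ × ℤ → ℝ≥0∞) (f g h : ℤ → ℝ≥0∞) (n : ℤ) : ℝ≥0∞ :=
  ∑' p : ℤ × ℤ, κ p * (f (n + p.1) * g (n + p.1 + p.2) * h (n + p.2))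

/-- An `ℓ²` bound by duality. -/
theorem tsum_sq_sq_le_of_form {S : ℤ → ℝ≥0∞} {K : ℝ≥0∞}
    (h : ∀ c : ℤ → ℝ≥0∞, (∑' y, c y * S y) ^ 4 ≤ K * (∑' x, c x ^ 2) ^ 2) :
    (∑' y, S y ^ 2) ^ 2 ≤ K := by
  rcases eq_or_ne K ⊤ with rfl | hK
  · exact le_top
  have hfin : ∀ n, S n ≠ ⊤ := by
    intro n hn
    -- A point mass as test sequence excludes infinite entries, so that the cancellation at the end
    -- is legitimate.
    have h1 := h (Pi.single n 1)
    rw [tsum_eq_single n (by intro y hy; simp [Pi.single_eq_of_ne hy]),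
      tsum_eq_single n (by intro y hy; simp [Pi.single_eq_of_ne hy])] at h1
    simp [hn, hK] at h1
  rw [ENNReal.tsum_eq_iSup_sum, ENNReal.iSup_pow_of_ne_zero two_ne_zero]
  refine iSup_le fun s => ?_
  -- Testing against the truncation of `S` itself gives X⁴ ≤ K X² for its finite square sum X.
  have h1 := h (fun y => if y ∈ s then S y else 0)
  have e1 : ∑' y, (if y ∈ s then S y else 0) * S y = ∑ y ∈ s, S y ^ 2 := by
    rw [tsum_eq_sum (s := s) (by intro y hy; simp [hy])]
    exact Finset.sum_congr rfl fun y hy => by simp [hy, sq]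
  have e2 : ∑' y, (if y ∈ s then S y else 0) ^ 2 = ∑ y ∈ s, S y ^ 2 := by
    rw [tsum_eq_sum (s := s) (by intro y hy; simp [hy])]
    exact Finset.sum_congr rfl fun y hy => by simp [hy]
  rw [e1, e2] at h1
  set X := ∑ y ∈ s, S y ^ 2
  have hX : X ≠ ⊤ := by
    simp only [X, ne_eq, ENNReal.sum_eq_top, not_exists, not_and]
    intro y _
    simp [hfin y]
  rcases eq_or_ne X 0 with h0 | h0
  · simp [h0]
  rw [show X ^ 4 = X ^ 2 * X ^ 2 by ring] at h1
  exact (ENNReal.mul_le_mul_iff_left (pow_ne_zero 2 h0) (ENNReal.pow_ne_top hX)).1 h1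

/-! ### The trilinear sum with any one of its three entries in ℓ⁴ -/

section
variable {m : ℤ → ℝ≥0∞} {Λ : ℝ≥0∞} (heven : ∀ j, m (-j) = m j)
  (hΛ : ∑' j, m j ^ 8 ≤ Λ) (f g h : ℤ → ℝ≥0∞)
include heven hΛ

/-- The second entry sits at the vertex of the parallelogram n, n+j, n+j+k, n+k opposite to n, so
`form_bound` applies directly after the reflection p ↦ -p. -/
theorem posTri_bound_snd :
    (∑' n, posTri (fun p => m p.1 ^ 5 * m p.2 ^ 5) f g h n ^ 2) ^ 2 ≤
      Λ ^ 5 * (∑' x, f x ^ 2) ^ 2 * (∑' x, g x ^ 4) * (∑' x, h x ^ 2) ^ 2 := by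
  have := form_bound heven hΛ g h f
  have e : ∀ n, posTri (fun p => m p.1 ^ 5 * m p.2 ^ 5) f g h n =
      ∑' p : ℤ × ℤ, m p.1 ^ 5 * m p.2 ^ 5 *
      (g (n - p.1 - p.2) * h (n - p.2) * f (n - p.1)) := by
    intro n
    rw [posTri, ← (Equiv.neg (ℤ × ℤ)).tsum_eq]
    refine tsum_congr fun p => ?_
    simp only [Equiv.neg_apply, Prod.fst_neg, Prod.snd_neg, heven, ← sub_eq_add_neg]
    ring
  simp_rw [e]
  exact this.trans_eq (by ring)

/-- Dualizing turns the sum into a form on parallelograms, symmetric enough that the first entry can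
be moved to the ℓ⁴ vertex of `form_bound_four`. -/
theorem posTri_bound_fst :
    (∑' n, posTri (fun p => m p.1 ^ 5 * m p.2 ^ 5) f g h n ^ 2) ^ 2 ≤
      Λ ^ 5 * (∑' x, f x ^ 4) * (∑' x, g x ^ 2) ^ 2 * (∑' x, h x ^ 2) ^ 2 := by
  refine tsum_sq_sq_le_of_form fun c => ?_
  have := form_bound_four heven hΛ f g h c
  refine le_trans (le_of_eq ?_) (this.trans_eq (by ring))
  congr 1
  -- Base the parallelogram at n+k with sides k and -j: its opposite vertex is then n+j, where `f`
  -- lives, and the test sequence sits at an adjacent one.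
  let E : ℤ × ℤ × ℤ ≃ ℤ × ℤ × ℤ :=
    { toFun := fun q => (q.1 + q.2.2, q.2.2, -q.2.1)
      invFun := fun q => (q.1 - q.2.1, -q.2.2, q.2.1)
      left_inv := fun q => by simp
      right_inv := fun q => by simp }
  rw [← ENNReal.tsum_prod (f := fun y (p : ℤ × ℤ) => m p.1 ^ 5 * m p.2 ^ 5 *
      (f (y - p.1 - p.2) * g (y - p.2) * h y * c (y - p.1))), ← E.tsum_eq]
  simp_rw [posTri, ← ENNReal.tsum_mul_left]
  rw [← ENNReal.tsum_prod (f := fun y (p : ℤ × ℤ) => c y * (m p.1 ^ 5 * m p.2 ^ 5 *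
      (f (y + p.1) * g (y + p.1 + p.2) * h (y + p.2))))]
  refine tsum_congr fun q => ?_
  simp only [E, Equiv.coe_fn_mk, heven, sub_neg_eq_add, add_sub_cancel_right]
  rw [show q.1 + q.2.2 + q.2.1 = q.1 + q.2.1 + q.2.2 by ring]
  ring

omit heven hΛ in
theorem posTri_swap (κ : ℤ × ℤ → ℝ≥0∞) (n : ℤ) :
    posTri κ f g h n = posTri (fun p => κ p.swap) h g f n := by
  rw [posTri, posTri, ← (Equiv.prodComm ℤ ℤ).tsum_eq]
  refine tsum_congr fun p => ?_
  simp only [Equiv.prodComm_apply, Prod.fst_swap, Prod.snd_swap]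
  rw [show n + p.2 + p.1 = n + p.1 + p.2 by ring]
  ring

theorem posTri_bound_trd :
    (∑' n, posTri (fun p => m p.1 ^ 5 * m p.2 ^ 5) f g h n ^ 2) ^ 2 ≤
      Λ ^ 5 * (∑' x, f x ^ 2) ^ 2 * (∑' x, g x ^ 2) ^ 2 * (∑' x, h x ^ 4) := by
  have := posTri_bound_fst heven hΛ h g f
  simp_rw [posTri_swap f g h]
  simp only [Prod.fst_swap, Prod.snd_swap, mul_comm (m _ ^ 5) (m _ ^ 5)] at this ⊢
  exact this.trans_eq (by ring)

end

/-! ### Weighted `ℓ²` bounds for sequences -/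

/-- The `ω`-weighted `ℓ²` norm of `x` over the finite set `S` of frequencies. -/
def wnorm (ω : ℤ → ℝ) (S : Finset ℤ) (x : ℤ → ℂ) : ℝ := √(∑ n ∈ S, (ω n * ‖x n‖) ^ 2)

/-- The `ω`-weighted `ℓ²` norm of `x` is at most `M`. -/
def WBound (ω : ℤ → ℝ) (M : ℝ) (x : ℤ → ℂ) : Prop := ∀ S, wnorm ω S x ≤ M

theorem wnorm_nonneg (ω : ℤ → ℝ) (S : Finset ℤ) (x : ℤ → ℂ) : 0 ≤ wnorm ω S x := Real.sqrt_nonneg _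

theorem wnorm_sq (ω : ℤ → ℝ) (S : Finset ℤ) (x : ℤ → ℂ) :
    wnorm ω S x ^ 2 = ∑ n ∈ S, (ω n * ‖x n‖) ^ 2 :=
  Real.sq_sqrt (Finset.sum_nonneg fun _ _ => sq_nonneg _)

theorem wnorm_eq_norm (ω : ℤ → ℝ) (S : Finset ℤ) (x : ℤ → ℂ) :
    wnorm ω S x = ‖(WithLp.toLp 2 (fun n : S => ω n • x n) : EuclideanSpace ℂ S)‖ := by
  rw [EuclideanSpace.norm_eq, wnorm, ← Finset.sum_coe_sort S]
  simp [mul_pow]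

theorem wnorm_add_le (ω : ℤ → ℝ) (S : Finset ℤ) (x y : ℤ → ℂ) :
    wnorm ω S (x + y) ≤ wnorm ω S x + wnorm ω S y := by
  simp only [wnorm_eq_norm]
  refine le_trans (le_of_eq ?_) (norm_add_le _ _)
  congr 1
  ext n
  simp

theorem wnorm_smul (ω : ℤ → ℝ) (S : Finset ℤ) (a : ℝ) (x : ℤ → ℂ) :
    wnorm ω S (fun n => a * x n) = |a| * wnorm ω S x := by
  rw [wnorm, wnorm, ← Real.sqrt_sq_eq_abs, ← Real.sqrt_mul (sq_nonneg a), Finset.mul_sum]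
  congr 1
  refine Finset.sum_congr rfl fun n _ => ?_
  rw [norm_mul, Complex.norm_real, mul_pow, mul_pow, mul_pow, Real.norm_eq_abs, sq_abs]
  ring

theorem wnorm_neg (ω : ℤ → ℝ) (S : Finset ℤ) (x : ℤ → ℂ) : wnorm ω S (-x) = wnorm ω S x := by
  simp [wnorm]

theorem wnorm_sub_le (ω : ℤ → ℝ) (S : Finset ℤ) (x y : ℤ → ℂ) :
    wnorm ω S (x - y) ≤ wnorm ω S x + wnorm ω S y := by
  rw [sub_eq_add_neg, ← wnorm_neg ω S y]
  exact wnorm_add_le _ _ _ _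

theorem wnorm_mono {ω ω' : ℤ → ℝ} {S : Finset ℤ} {x y : ℤ → ℂ} (hω : ∀ n, 0 ≤ ω n)
    (h : ∀ n ∈ S, ω n * ‖x n‖ ≤ ω' n * ‖y n‖) : wnorm ω S x ≤ wnorm ω' S y :=
  Real.sqrt_le_sqrt (Finset.sum_le_sum fun n hn =>
    pow_le_pow_left₀ (mul_nonneg (hω n) (norm_nonneg _)) (h n hn) 2)

theorem continuous_wnorm (ω : ℤ → ℝ) (S : Finset ℤ) : Continuous (wnorm ω S) := by
  unfold wnorm; fun_prop

namespace WBound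

variable {ω ω' : ℤ → ℝ} {M M' : ℝ} {x y : ℤ → ℂ}

theorem nonneg (h : WBound ω M x) : 0 ≤ M := (wnorm_nonneg ω ∅ x).trans (h ∅)

theorem mono (h : WBound ω M x) (hM : M ≤ M') : WBound ω M' x := fun S => (h S).trans hM

theorem add (hx : WBound ω M x) (hy : WBound ω M' y) : WBound ω (M + M') (x + y) := fun S =>
  (wnorm_add_le _ _ _ _).trans (add_le_add (hx S) (hy S))

theorem sub (hx : WBound ω M x) (hy : WBound ω M' y) : WBound ω (M + M') (x - y) := fun S =>
  (wnorm_sub_le _ _ _ _).trans (add_le_add (hx S) (hy S))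

theorem neg (hx : WBound ω M x) : WBound ω M (-x) := fun S => by rw [wnorm_neg]; exact hx S

theorem zero (ω : ℤ → ℝ) : WBound ω 0 0 := fun S => by simp [wnorm]

theorem of_le (hω : ∀ n, 0 ≤ ω n) (h : ∀ n, ω n * ‖x n‖ ≤ ω' n * ‖y n‖) (hy : WBound ω' M y) :
    WBound ω M x := fun S => (wnorm_mono hω fun n _ => h n).trans (hy S)

theorem smul (a : ℝ) (hx : WBound ω M x) : WBound ω (|a| * M) (fun n => a * x n) := fun S => by
  rw [wnorm_smul]; exact mul_le_mul_of_nonneg_left (hx S) (abs_nonneg a)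

theorem coord (h : WBound ω M x) (n : ℤ) : ω n * ‖x n‖ ≤ M := by
  refine le_trans ?_ (h {n})
  rw [wnorm, Finset.sum_singleton, Real.sqrt_sq_eq_abs]
  exact le_abs_self _

theorem norm_le (hω : ∀ n, 1 ≤ ω n) (h : WBound ω M x) (n : ℤ) : ‖x n‖ ≤ M :=
  (le_mul_of_one_le_left (norm_nonneg _) (hω n)).trans (h.coord n)

theorem of_weight_le (hω : ∀ n, 0 ≤ ω n) (h : ∀ n, ω n ≤ ω' n) (hx : WBound ω' M x) :
    WBound ω M x := hx.of_le hω fun n => mul_le_mul_of_nonneg_right (h n) (norm_nonneg _)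

/-- A Fatou property: the bound is tested on finite sets of frequencies, so it passes to
coordinatewise limits. -/
theorem of_tendsto {ι : Type*} {l : Filter ι} [l.NeBot] {X : ι → ℤ → ℂ} {m : ι → ℝ}
    (hX : ∀ n, Filter.Tendsto (fun i => X i n) l (nhds (x n))) (hm : Filter.Tendsto m l (nhds M))
    (h : ∀ᶠ i in l, WBound ω (m i) (X i)) : WBound ω M x := fun S =>
  le_of_tendsto_of_tendsto (((continuous_wnorm ω S).tendsto x).comp (tendsto_pi_nhds.2 hX)) hm
    (h.mono fun _ hi => hi S)

theorem tsum_le (h : WBound ω M x) :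
    ∑' n, ENNReal.ofReal (ω n * ‖x n‖) ^ 2 ≤ ENNReal.ofReal M ^ 2 := by
  rw [ENNReal.tsum_eq_iSup_sum]
  refine iSup_le fun S => ?_
  have h1 : ∀ r : ℝ, ENNReal.ofReal r ^ 2 ≤ ENNReal.ofReal (r ^ 2) := by
    intro r
    rcases le_total 0 r with hr | hr
    · rw [ENNReal.ofReal_pow hr]
    · simp [ENNReal.ofReal_of_nonpos hr]
  calc _ ≤ ∑ n ∈ S, ENNReal.ofReal ((ω n * ‖x n‖) ^ 2) := Finset.sum_le_sum fun n _ => h1 _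
    _ = ENNReal.ofReal (wnorm ω S x ^ 2) := by
      rw [wnorm_sq, ENNReal.ofReal_sum_of_nonneg fun _ _ => sq_nonneg _]
    _ ≤ _ := by
      rw [ENNReal.ofReal_pow (wnorm_nonneg _ _ _)]
      exact ENNReal.pow_le_pow_left (ENNReal.ofReal_le_ofReal (h S))

theorem of_tsum_le {Y : ℤ → ℝ≥0∞} (hω : ∀ n, 0 ≤ ω n) (hM : 0 ≤ M)
    (hY : ∀ n, ENNReal.ofReal (ω n * ‖x n‖) ≤ Y n)
    (h : ∑' n, Y n ^ 2 ≤ ENNReal.ofReal M ^ 2) : WBound ω M x := by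
  intro S
  have h1 : ENNReal.ofReal (wnorm ω S x ^ 2) ≤ ENNReal.ofReal (M ^ 2) := by
    rw [wnorm_sq, ENNReal.ofReal_sum_of_nonneg fun _ _ => sq_nonneg _, ENNReal.ofReal_pow hM]
    refine le_trans ?_ ((ENNReal.sum_le_tsum S).trans h)
    refine Finset.sum_le_sum fun n _ => ?_
    rw [ENNReal.ofReal_pow (mul_nonneg (hω n) (norm_nonneg _))]
    exact ENNReal.pow_le_pow_left (hY n)
  exact (sq_le_sq₀ (wnorm_nonneg _ _ _) hM).1 ((ENNReal.ofReal_le_ofReal_iff (sq_nonneg M)).1 h1)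

theorem summable (h : WBound ω M x) : Summable fun n => (ω n * ‖x n‖) ^ 2 := by
  refine summable_of_sum_le (c := M ^ 2) (fun _ => sq_nonneg _) fun S => ?_
  rw [← wnorm_sq]
  exact pow_le_pow_left₀ (wnorm_nonneg _ _ _) (h S) 2

end WBound

/-! ### Trilinear sums -/

/-- The trilinear sum `∑ c(j,k) f(n+j) ḡ(n+j+k) h(n+k)`. -/
def tri (c : ℤ × ℤ → ℂ) (f g h : ℤ → ℂ) (n : ℤ) : ℂ :=
  ∑' p : ℤ × ℤ, c p * (f (n + p.1) * (starRingEnd ℂ) (g (n + p.1 + p.2)) * h (n + p.2))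

theorem enorm_tri_le (c : ℤ × ℤ → ℂ) (f g h : ℤ → ℂ) (n : ℤ) :
    ‖tri c f g h n‖ₑ ≤
      posTri (fun p => ‖c p‖ₑ) (fun n => ‖f n‖ₑ) (fun n => ‖g n‖ₑ) (fun n => ‖h n‖ₑ) n := by
  refine (enorm_tsum_le_tsum_enorm).trans_eq (tsum_congr fun p => ?_)
  simp [enorm_mul]

/-- On the axis j = 0 the sum factors as f(n) times the pairing of translates of g and h. -/
theorem posTri_fst_eq_zero_sq_le (f g h : ℤ → ℝ≥0∞) (n : ℤ) :
    posTri (fun p => if p.1 = 0 then 1 else 0) f g h n ^ 2 ≤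
      f n ^ 2 * ((∑' x, g x ^ 2) * ∑' x, h x ^ 2) := by
  rw [posTri, ENNReal.tsum_prod', tsum_eq_single 0 (by intro j hj; simp [hj])]
  simp only [if_true, one_mul, add_zero, mul_assoc]
  rw [ENNReal.tsum_mul_left, mul_pow]
  refine mul_le_mul' le_rfl ((ennreal_tsum_mul_sq_le _ _).trans_eq ?_)
  rw [← (Equiv.addLeft n).tsum_eq (fun x => g x ^ 2), ← (Equiv.addLeft n).tsum_eq (fun x => h x ^ 2)]
  rfl

theorem posTri_snd_eq_zero_sq_le (f g h : ℤ → ℝ≥0∞) (n : ℤ) :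
    posTri (fun p => if p.2 = 0 then 1 else 0) f g h n ^ 2 ≤
      h n ^ 2 * ((∑' x, g x ^ 2) * ∑' x, f x ^ 2) := by
  rw [posTri_swap]
  exact posTri_fst_eq_zero_sq_le h g f n

/-- The kernel `|jk|^{-ρ}` off the axes. -/
def axisWeight (ρ : ℝ) (j : ℤ) : ℝ := if j = 0 then 0 else |(j : ℝ)| ^ (-(ρ / 5))

theorem axisWeight_nonneg (ρ : ℝ) (j : ℤ) : 0 ≤ axisWeight ρ j := by
  unfold axisWeight; split_ifs <;> positivity

theorem axisWeight_neg (ρ : ℝ) (j : ℤ) : axisWeight ρ (-j) = axisWeight ρ j := by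
  simp [axisWeight]

/-- The eighth power of the weight is |j|^{-8ρ/5}, and 8ρ/5 > 16/15 > 1. The lower bound 1 for `Λ`
lets its powers be compared later. -/
theorem exists_tsum_axisWeight_le {ρ : ℝ} (hρ : 2 / 3 < ρ) :
    ∃ Λ : ℝ, 1 ≤ Λ ∧ ∑' j, ENNReal.ofReal (axisWeight ρ j) ^ 8 ≤ ENNReal.ofReal Λ := by
  have hs : Summable fun j : ℤ => |(j : ℝ)| ^ (-(8 * ρ / 5)) :=
    Real.summable_abs_int_rpow (by linarith)
  have hs' : Summable fun j : ℤ => axisWeight ρ j ^ 8 := by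
    refine Summable.of_nonneg_of_le (fun j => pow_nonneg (axisWeight_nonneg ρ j) 8) (fun j => ?_) hs
    unfold axisWeight
    split_ifs
    · simp; positivity
    · rw [← Real.rpow_natCast, ← Real.rpow_mul (abs_nonneg _)]
      apply le_of_eq; congr 1; push_cast; ring
  refine ⟨max 1 (∑' j, axisWeight ρ j ^ 8), le_max_left _ _, ?_⟩
  refine le_trans (le_of_eq ?_) (ENNReal.ofReal_le_ofReal (le_max_right _ _))
  rw [ENNReal.ofReal_tsum_of_nonneg (fun j => pow_nonneg (axisWeight_nonneg ρ j) 8) hs']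
  exact tsum_congr fun j => (ENNReal.ofReal_pow (axisWeight_nonneg ρ j) 8).symm

/-- The kernel `min(1, |jk|^{-ρ})`, equal to `1` on the axes. -/
def resKernel (ρ : ℝ) (p : ℤ × ℤ) : ℝ :=
  if p.1 = 0 ∨ p.2 = 0 then 1 else (axisWeight ρ p.1 * axisWeight ρ p.2) ^ 5

theorem resKernel_nonneg (ρ : ℝ) (p : ℤ × ℤ) : 0 ≤ resKernel ρ p := by
  unfold resKernel
  have := axisWeight_nonneg ρ p.1
  have := axisWeight_nonneg ρ p.2
  split_ifs <;> positivity

theorem tsum_posTri_axisWeight_sq_le {ρ : ℝ} (hρ : 2 / 3 < ρ) : ∃ K : ℝ, 1 ≤ K ∧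
    ∀ f g h : ℤ → ℝ≥0∞,
    ((∑' n, posTri (fun p => ENNReal.ofReal (axisWeight ρ p.1 * axisWeight ρ p.2) ^ 5) f g h n ^ 2) ^ 2 ≤
      ENNReal.ofReal K ^ 4 * (∑' x, f x ^ 4) * (∑' x, g x ^ 2) ^ 2 * (∑' x, h x ^ 2) ^ 2) ∧
    ((∑' n, posTri (fun p => ENNReal.ofReal (axisWeight ρ p.1 * axisWeight ρ p.2) ^ 5) f g h n ^ 2) ^ 2 ≤
      ENNReal.ofReal K ^ 4 * (∑' x, f x ^ 2) ^ 2 * (∑' x, g x ^ 4) * (∑' x, h x ^ 2) ^ 2) ∧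
    ((∑' n, posTri (fun p => ENNReal.ofReal (axisWeight ρ p.1 * axisWeight ρ p.2) ^ 5) f g h n ^ 2) ^ 2 ≤
      ENNReal.ofReal K ^ 4 * (∑' x, f x ^ 2) ^ 2 * (∑' x, g x ^ 2) ^ 2 * (∑' x, h x ^ 4)) := by
  obtain ⟨Λ, hΛ1, hΛ⟩ := exists_tsum_axisWeight_le hρ
  have heven : ∀ j, (fun j => ENNReal.ofReal (axisWeight ρ j)) (-j) = ENNReal.ofReal (axisWeight ρ j) :=
    fun j => by simp only [axisWeight_neg]
  have hker : (fun p : ℤ × ℤ => ENNReal.ofReal (axisWeight ρ p.1 * axisWeight ρ p.2) ^ 5) =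
      fun p => ENNReal.ofReal (axisWeight ρ p.1) ^ 5 * ENNReal.ofReal (axisWeight ρ p.2) ^ 5 := by
    funext p
    rw [ENNReal.ofReal_mul (axisWeight_nonneg ρ _), mul_pow]
  have hK : ENNReal.ofReal Λ ^ 5 ≤ ENNReal.ofReal (Λ ^ 2) ^ 4 := by
    rw [← ENNReal.ofReal_pow (by positivity), ← ENNReal.ofReal_pow (by positivity), ← pow_mul]
    exact ENNReal.ofReal_le_ofReal (pow_le_pow_right₀ hΛ1 (by norm_num))
  refine ⟨Λ ^ 2, one_le_pow₀ hΛ1, fun f g h => ⟨?_, ?_, ?_⟩⟩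
  · rw [hker]
    exact (posTri_bound_fst heven hΛ f g h).trans (by gcongr)
  · rw [hker]
    exact (posTri_bound_snd heven hΛ f g h).trans (by gcongr)
  · rw [hker]
    exact (posTri_bound_trd heven hΛ f g h).trans (by gcongr)

theorem tsum_pow_four_le (f : ℤ → ℝ≥0∞) : ∑' x, f x ^ 4 ≤ (∑' x, f x ^ 2) ^ 2 := by
  calc ∑' x, f x ^ 4 = ∑' x, f x ^ 2 * f x ^ 2 := tsum_congr fun x => by ring
    _ ≤ ∑' x, f x ^ 2 * ∑' y, f y ^ 2 :=
      ENNReal.tsum_le_tsum fun x => mul_le_mul' le_rfl (ENNReal.le_tsum (f := fun y => f y ^ 2) x)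
    _ = _ := by rw [ENNReal.tsum_mul_right, sq]

theorem add_add_sq_le (a b c : ℝ≥0∞) : (a + b + c) ^ 2 ≤ 3 * (a ^ 2 + b ^ 2 + c ^ 2) := by
  rcases eq_or_ne a ⊤ with rfl | ha
  · simp
  rcases eq_or_ne b ⊤ with rfl | hb
  · simp
  rcases eq_or_ne c ⊤ with rfl | hc
  · simp
  lift a to NNReal using ha
  lift b to NNReal using hb
  lift c to NNReal using hc
  norm_cast
  rw [← NNReal.coe_le_coe]
  push_cast
  nlinarith [sq_nonneg ((a : ℝ) - b), sq_nonneg ((b : ℝ) - c), sq_nonneg ((a : ℝ) - c)]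

/-- The two axes are handled by their factorization, the rest by the ℓ⁴ estimate together with ℓ² ⊂
ℓ⁴. -/
theorem exists_tsum_posTri_resKernel_le {ρ : ℝ} (hρ : 2 / 3 < ρ) : ∃ K : ℝ, 1 ≤ K ∧
    ∀ f g h : ℤ → ℝ≥0∞, ∑' n, posTri (fun p => ENNReal.ofReal (resKernel ρ p)) f g h n ^ 2 ≤
      ENNReal.ofReal K ^ 2 * ((∑' x, f x ^ 2) * (∑' x, g x ^ 2) * ∑' x, h x ^ 2) := by
  obtain ⟨K, hK1, hK⟩ := tsum_posTri_axisWeight_sq_le hρ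
  refine ⟨3 * K, by linarith, fun f g h => ?_⟩
  have hle : ∀ n, posTri (fun p => ENNReal.ofReal (resKernel ρ p)) f g h n ≤
      posTri (fun p => if p.1 = 0 then 1 else 0) f g h n +
      posTri (fun p => if p.2 = 0 then 1 else 0) f g h n +
      posTri (fun p => ENNReal.ofReal (axisWeight ρ p.1 * axisWeight ρ p.2) ^ 5) f g h n := by
    intro n
    simp only [posTri]
    rw [← ENNReal.tsum_add, ← ENNReal.tsum_add]
    refine ENNReal.tsum_le_tsum fun p => ?_
    rw [← add_mul, ← add_mul]
    refine mul_le_mul' ?_ le_rfl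
    unfold resKernel
    by_cases h1 : p.1 = 0
    · simp [h1, add_assoc]
    · by_cases h2 : p.2 = 0
      · simp only [h2, or_true, if_true, ENNReal.ofReal_one]
        exact le_add_right le_add_self
      · have := axisWeight_nonneg ρ p.1
        have := axisWeight_nonneg ρ p.2
        simp only [h1, h2, or_self, if_false, zero_add]
        rw [ENNReal.ofReal_pow (by positivity)]
  set F := ∑' x, f x ^ 2
  set G := ∑' x, g x ^ 2
  set H := ∑' x, h x ^ 2
  have h3 : ∑' n, posTri (fun p => ENNReal.ofReal (axisWeight ρ p.1 * axisWeight ρ p.2) ^ 5) f g h n ^ 2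
      ≤ ENNReal.ofReal K ^ 2 * (F * G * H) := by
    refine (ENNReal.pow_le_pow_left_iff two_ne_zero).1 ?_
    refine ((hK f g h).1.trans ?_).trans_eq
      (show ENNReal.ofReal K ^ 4 * F ^ 2 * G ^ 2 * H ^ 2 = _ by ring)
    gcongr
    exact tsum_pow_four_le f
  have hK1' : 1 ≤ ENNReal.ofReal K ^ 2 :=
    one_le_pow₀ (by rw [← ENNReal.ofReal_one]; exact ENNReal.ofReal_le_ofReal hK1)
  calc _ ≤ ∑' n, 3 * (posTri (fun p => if p.1 = 0 then 1 else 0) f g h n ^ 2 +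
      posTri (fun p => if p.2 = 0 then 1 else 0) f g h n ^ 2 +
      posTri (fun p => ENNReal.ofReal (axisWeight ρ p.1 * axisWeight ρ p.2) ^ 5) f g h n ^ 2) :=
        ENNReal.tsum_le_tsum fun n => (ENNReal.pow_le_pow_left (hle n)).trans (add_add_sq_le _ _ _)
    _ ≤ 3 * (F * (G * H) + H * (G * F) + ENNReal.ofReal K ^ 2 * (F * G * H)) := by
        rw [ENNReal.tsum_mul_left, ENNReal.tsum_add, ENNReal.tsum_add]
        gcongr
        · exact (ENNReal.tsum_le_tsum fun n => posTri_fst_eq_zero_sq_le f g h n).trans_eq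
            ENNReal.tsum_mul_right
        · exact (ENNReal.tsum_le_tsum fun n => posTri_snd_eq_zero_sq_le f g h n).trans_eq
            ENNReal.tsum_mul_right
    _ = 3 * (1 + 1 + ENNReal.ofReal K ^ 2) * (F * G * H) := by ring
    _ ≤ 3 * (ENNReal.ofReal K ^ 2 + ENNReal.ofReal K ^ 2 + ENNReal.ofReal K ^ 2) * (F * G * H) := by
        gcongr
    _ = _ := by
        rw [ENNReal.ofReal_mul (by norm_num), mul_pow]
        norm_num
        ring

/-- Weights `ω ≥ 1` which are quasi-subadditive along `n = n₁ - n₂ + n₃`. -/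
structure AdmissibleWeight (c : ℝ) (ω : ℤ → ℝ) : Prop where
  one_le : ∀ n, 1 ≤ ω n
  le_add : ∀ n j k, ω n ≤ c * (ω (n + j) + ω (n + j + k) + ω (n + k))

/-- The `ℓ²`-based trilinear estimate. -/
theorem exists_WBound_tri {ρ : ℝ} (hρ : 2 / 3 < ρ) (c₀ : ℝ) (hc₀ : 0 ≤ c₀) : ∃ K : ℝ, 0 < K ∧
    ∀ (ω : ℤ → ℝ), AdmissibleWeight c₀ ω → ∀ (c : ℤ × ℤ → ℂ) (D : ℝ),
    (∀ p, ‖c p‖ ≤ D * resKernel ρ p) → ∀ f g h A B C, WBound ω A f → WBound ω B g → WBound ω C h →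
    WBound ω (K * D * (A * B * C)) (tri c f g h) := by
  obtain ⟨K, hK1, hK⟩ := exists_tsum_posTri_resKernel_le hρ
  refine ⟨3 * c₀ * K + 1, by positivity, fun ω hω c D hc f g h A B C hf hg hh => ?_⟩
  have hA := hf.nonneg
  have hB := hg.nonneg
  have hC := hh.nonneg
  have hD : 0 ≤ D := by
    have := (norm_nonneg _).trans (hc (0, 0))
    simpa [resKernel] using this
  have hω0 : ∀ n, 0 ≤ ω n := fun n => zero_le_one.trans (hω.one_le n)
  set F : ℤ → ℝ≥0∞ := fun n => ENNReal.ofReal (ω n * ‖f n‖)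
  set G : ℤ → ℝ≥0∞ := fun n => ENNReal.ofReal (ω n * ‖g n‖)
  set H : ℤ → ℝ≥0∞ := fun n => ENNReal.ofReal (ω n * ‖h n‖)
  refine WBound.mono (M := 3 * c₀ * K * D * (A * B * C)) ?_ (by
    have : 0 ≤ D * (A * B * C) := by positivity
    nlinarith)
  refine WBound.of_tsum_le (Y := fun n => ENNReal.ofReal (3 * c₀ * D) *
    posTri (fun p => ENNReal.ofReal (resKernel ρ p)) F G H n) hω0 (by positivity) (fun n => ?_) ?_
  · rw [ENNReal.ofReal_mul (hω0 n), ofReal_norm]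
    refine (mul_le_mul' le_rfl (enorm_tri_le c f g h n)).trans ?_
    rw [posTri, posTri, ← ENNReal.tsum_mul_left, ← ENNReal.tsum_mul_left]
    refine ENNReal.tsum_le_tsum fun p => ?_
    simp only [F, G, H, ← ofReal_norm]
    rw [← ENNReal.ofReal_mul (by positivity), ← ENNReal.ofReal_mul (by positivity),
      ← ENNReal.ofReal_mul (by positivity), ← ENNReal.ofReal_mul (hω0 _),
      ← ENNReal.ofReal_mul (mul_nonneg (hω0 _) (norm_nonneg _)),
      ← ENNReal.ofReal_mul (by have := hω0 (n + p.1); have := hω0 (n + p.1 + p.2); positivity),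
      ← ENNReal.ofReal_mul (resKernel_nonneg ρ p), ← ENNReal.ofReal_mul (by positivity)]
    refine ENNReal.ofReal_le_ofReal ?_
    set a := ω (n + p.1)
    set b := ω (n + p.1 + p.2)
    set d := ω (n + p.2)
    have ha : 1 ≤ a := hω.one_le _
    have hb : 1 ≤ b := hω.one_le _
    have hd : 1 ≤ d := hω.one_le _
    -- As all weights are at least 1, each of the three summands is below their product. Every entry
    -- can thus absorb its own weight, and the constant depends on the weight only through `c₀`.
    have h1 : ω n ≤ 3 * c₀ * (a * b * d) := by
      refine (hω.le_add n p.1 p.2).trans ?_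
      have e1 : a ≤ a * b * d := by
        rw [mul_assoc]; exact le_mul_of_one_le_right (by linarith) (one_le_mul_of_one_le_of_one_le hb hd)
      have e2 : b ≤ a * b * d := by
        rw [mul_comm a b, mul_assoc]
        exact le_mul_of_one_le_right (by linarith) (one_le_mul_of_one_le_of_one_le ha hd)
      have e3 : d ≤ a * b * d :=
        le_mul_of_one_le_left (by linarith) (one_le_mul_of_one_le_of_one_le ha hb)
      calc c₀ * (a + b + d) ≤ c₀ * (a * b * d + a * b * d + a * b * d) := by gcongr
        _ = _ := by ring
    calc ω n * (‖c p‖ * (‖f (n + p.1)‖ * ‖g (n + p.1 + p.2)‖ * ‖h (n + p.2)‖))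
        ≤ (3 * c₀ * (a * b * d)) * ((D * resKernel ρ p) *
          (‖f (n + p.1)‖ * ‖g (n + p.1 + p.2)‖ * ‖h (n + p.2)‖)) := by
          gcongr
          exact hc p
      _ = _ := by ring
  · simp_rw [mul_pow]
    rw [ENNReal.tsum_mul_left]
    refine (mul_le_mul' le_rfl ((hK F G H).trans (mul_le_mul' le_rfl
      (mul_le_mul' (mul_le_mul' hf.tsum_le hg.tsum_le) hh.tsum_le)))).trans_eq ?_
    rw [show 3 * c₀ * K * D * (A * B * C) = 3 * c₀ * D * (K * (A * B * C)) by ring,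
      ENNReal.ofReal_mul (by positivity : 0 ≤ 3 * c₀ * D),
      ENNReal.ofReal_mul (by positivity : 0 ≤ K), ENNReal.ofReal_mul (by positivity : 0 ≤ A * B),
      ENNReal.ofReal_mul hA]
    ring

/-! ### Estimates with one entry in ℓ⁴ -/

/-- The `ℓ⁴` norm of `x` is at most `A`. -/
def QBound (A : ℝ) (x : ℤ → ℂ) : Prop := ∀ S : Finset ℤ, ∑ n ∈ S, ‖x n‖ ^ 4 ≤ A ^ 4

theorem QBound.tsum_le {A : ℝ} {x : ℤ → ℂ} (hA : 0 ≤ A) (h : QBound A x) :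
    ∑' n, ‖x n‖ₑ ^ 4 ≤ ENNReal.ofReal A ^ 4 := by
  rw [ENNReal.tsum_eq_iSup_sum]
  refine iSup_le fun S => ?_
  calc _ = ENNReal.ofReal (∑ n ∈ S, ‖x n‖ ^ 4) := by
        rw [ENNReal.ofReal_sum_of_nonneg fun _ _ => by positivity]
        simp_rw [ENNReal.ofReal_pow (norm_nonneg _), ofReal_norm]
    _ ≤ _ := by
        rw [← ENNReal.ofReal_pow hA]
        exact ENNReal.ofReal_le_ofReal (h S)

theorem WBound.tsum_enorm_le {M : ℝ} {x : ℤ → ℂ} (h : WBound (fun _ => 1) M x) :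
    ∑' n, ‖x n‖ₑ ^ 2 ≤ ENNReal.ofReal M ^ 2 := by
  simpa only [one_mul, ofReal_norm] using h.tsum_le

/-- A bounded interpolation of `ℓ^∞` and `ℓ²`. -/
theorem QBound.of_sup {δ M : ℝ} {x : ℤ → ℂ} (hδ : 0 ≤ δ) (h : ∀ n, ‖x n‖ ≤ δ)
    (hM : WBound (fun _ => 1) M x) : QBound (√(δ * M)) x := by
  intro S
  have h1 : √(δ * M) ^ 4 = δ ^ 2 * M ^ 2 := by
    rw [show 4 = 2 * 2 by rfl, pow_mul, Real.sq_sqrt (mul_nonneg hδ hM.nonneg), mul_pow]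
  have h2 : ∑ n ∈ S, ‖x n‖ ^ 2 ≤ M ^ 2 := by
    have := pow_le_pow_left₀ (wnorm_nonneg _ _ _) (hM S) 2
    simpa [wnorm_sq] using this
  rw [h1]
  calc ∑ n ∈ S, ‖x n‖ ^ 4 ≤ ∑ n ∈ S, δ ^ 2 * ‖x n‖ ^ 2 := by
        refine Finset.sum_le_sum fun n _ => ?_
        rw [show ‖x n‖ ^ 4 = ‖x n‖ ^ 2 * ‖x n‖ ^ 2 by ring]
        exact mul_le_mul_of_nonneg_right (pow_le_pow_left₀ (norm_nonneg _) (h n) 2) (sq_nonneg _)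
    _ ≤ _ := by rw [← Finset.mul_sum]; gcongr

/-- Off the axes, one of the three entries of the trilinear sum may be in `ℓ⁴` only. -/
theorem exists_WBound_tri_of_QBound {ρ : ℝ} (hρ : 2 / 3 < ρ) : ∃ K : ℝ, 0 < K ∧
    ∀ (c : ℤ × ℤ → ℂ) (D : ℝ), 0 ≤ D →
    (∀ p, ‖c p‖ ≤ D * (axisWeight ρ p.1 * axisWeight ρ p.2) ^ 5) →
    ∀ d g h A B C, 0 ≤ A → QBound A d → WBound (fun _ => 1) B g → WBound (fun _ => 1) C h →
    WBound (fun _ => 1) (K * D * (A * B * C)) (tri c d g h) ∧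
    WBound (fun _ => 1) (K * D * (A * B * C)) (tri c g d h) ∧
    WBound (fun _ => 1) (K * D * (A * B * C)) (tri c g h d) := by
  obtain ⟨K, hK1, hK⟩ := tsum_posTri_axisWeight_sq_le hρ
  refine ⟨K, by linarith, fun c D hD hc d g h A B C hA hd hg hh => ?_⟩
  have hB := hg.nonneg
  have hC := hh.nonneg
  have key : ∀ u v w : ℤ → ℂ,
      (∑' n, posTri (fun p => ENNReal.ofReal (axisWeight ρ p.1 * axisWeight ρ p.2) ^ 5)
        (fun n => ‖u n‖ₑ) (fun n => ‖v n‖ₑ) (fun n => ‖w n‖ₑ) n ^ 2) ^ 2 ≤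
        (ENNReal.ofReal K * (ENNReal.ofReal A * ENNReal.ofReal B * ENNReal.ofReal C)) ^ 4 →
      WBound (fun _ => 1) (K * D * (A * B * C)) (tri c u v w) := by
    intro u v w huvw
    refine WBound.of_tsum_le (Y := fun n => ENNReal.ofReal D *
      posTri (fun p => ENNReal.ofReal (axisWeight ρ p.1 * axisWeight ρ p.2) ^ 5)
        (fun n => ‖u n‖ₑ) (fun n => ‖v n‖ₑ) (fun n => ‖w n‖ₑ) n) (fun _ => zero_le_one)
      (by positivity) (fun n => ?_) ?_
    · rw [one_mul, ofReal_norm]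
      refine (enorm_tri_le c u v w n).trans ?_
      rw [posTri, posTri, ← ENNReal.tsum_mul_left]
      refine ENNReal.tsum_le_tsum fun p => ?_
      have h1 := axisWeight_nonneg ρ p.1
      have h2 := axisWeight_nonneg ρ p.2
      rw [← mul_assoc (ENNReal.ofReal D), ← ENNReal.ofReal_pow (by positivity),
        ← ENNReal.ofReal_mul hD, ← ofReal_norm (c p)]
      exact mul_le_mul' (ENNReal.ofReal_le_ofReal (hc p)) le_rfl
    · simp_rw [mul_pow]
      rw [ENNReal.tsum_mul_left]
      have e : ENNReal.ofReal (K * D * (A * B * C)) ^ 2 = ENNReal.ofReal D ^ 2 *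
          (ENNReal.ofReal K * (ENNReal.ofReal A * ENNReal.ofReal B * ENNReal.ofReal C)) ^ 2 := by
        rw [show K * D * (A * B * C) = D * (K * (A * B * C)) by ring, ENNReal.ofReal_mul hD,
          ENNReal.ofReal_mul (by positivity : 0 ≤ K), ENNReal.ofReal_mul (by positivity : 0 ≤ A * B),
          ENNReal.ofReal_mul hA, mul_pow]
      rw [e]
      refine mul_le_mul' le_rfl ((ENNReal.pow_le_pow_left_iff two_ne_zero).1 (huvw.trans_eq ?_))
      rw [← pow_mul]
  have hd' := hd.tsum_le hA
  have hg' := hg.tsum_enorm_le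
  have hh' := hh.tsum_enorm_le
  refine ⟨key _ _ _ (((hK _ _ _).1).trans ?_), key _ _ _ (((hK _ _ _).2.1).trans ?_),
    key _ _ _ (((hK _ _ _).2.2).trans ?_)⟩
  · calc _ ≤ ENNReal.ofReal K ^ 4 * ENNReal.ofReal A ^ 4 * (ENNReal.ofReal B ^ 2) ^ 2 *
        (ENNReal.ofReal C ^ 2) ^ 2 := by gcongr
      _ = _ := by ring
  · calc _ ≤ ENNReal.ofReal K ^ 4 * (ENNReal.ofReal B ^ 2) ^ 2 * ENNReal.ofReal A ^ 4 *
        (ENNReal.ofReal C ^ 2) ^ 2 := by gcongr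
      _ = _ := by ring
  · calc _ ≤ ENNReal.ofReal K ^ 4 * (ENNReal.ofReal B ^ 2) ^ 2 * (ENNReal.ofReal C ^ 2) ^ 2 *
        ENNReal.ofReal A ^ 4 := by gcongr
      _ = _ := by ring

/-! ### The embedding `H^{1/6}(𝕋) ⊆ L³(𝕋)` -/

theorem one_le_bracket (x : ℝ) : 1 ≤ bracket x :=
  Real.one_le_sqrt.2 (by nlinarith [sq_nonneg x])

theorem abs_le_bracket (x : ℝ) : |x| ≤ bracket x := by
  rw [← Real.sqrt_sq_eq_abs]
  exact Real.sqrt_le_sqrt (by linarith)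

/-- The weight `⟨n⟩^s`. -/
def sobWeight (s : ℝ) (n : ℤ) : ℝ := bracket (n : ℝ) ^ s

theorem sobWeight_pos (s : ℝ) (n : ℤ) : 0 < sobWeight s n := Real.rpow_pos_of_pos (bracket_pos _) s

theorem one_le_sobWeight {s : ℝ} (hs : 0 ≤ s) (n : ℤ) : 1 ≤ sobWeight s n :=
  Real.one_le_rpow (one_le_bracket _) hs

theorem sobWeight_mono {s s' : ℝ} (h : s ≤ s') (n : ℤ) : sobWeight s n ≤ sobWeight s' n :=
  Real.rpow_le_rpow_of_exponent_le (one_le_bracket _) h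

/-- A discrete substitute for comparing the sum of n^{-1/3} with its integral. -/
theorem succ_rpow_le (N : ℕ) :
    ((N : ℝ) + 1) ^ (-(1 / 3) : ℝ) ≤ 3 * (((N : ℝ) + 1) ^ (2 / 3 : ℝ) - (N : ℝ) ^ (2 / 3 : ℝ)) := by
  set a : ℝ := ((N : ℝ) + 1) ^ (1 / 3 : ℝ) with ha
  set b : ℝ := (N : ℝ) ^ (1 / 3 : ℝ) with hb
  have hN : (0 : ℝ) ≤ N := Nat.cast_nonneg N
  have ha3 : a ^ 3 = N + 1 := by
    rw [ha, ← Real.rpow_natCast, ← Real.rpow_mul (by positivity)]; norm_num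
  have hb3 : b ^ 3 = N := by
    rw [hb, ← Real.rpow_natCast, ← Real.rpow_mul (by positivity)]; norm_num
  have ha2 : ((N : ℝ) + 1) ^ (2 / 3 : ℝ) = a ^ 2 := by
    rw [ha, ← Real.rpow_natCast, ← Real.rpow_mul (by positivity)]; norm_num
  have hb2 : (N : ℝ) ^ (2 / 3 : ℝ) = b ^ 2 := by
    rw [hb, ← Real.rpow_natCast, ← Real.rpow_mul (by positivity)]; norm_num
  have hap : 0 < a := by positivity
  have hbp : 0 ≤ b := by positivity
  have hab : b ≤ a := Real.rpow_le_rpow hN (by linarith) (by norm_num)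
  rw [Real.rpow_neg (by positivity), ← ha, ha2, hb2, inv_le_iff_one_le_mul₀ hap]
  have h1 : a ^ 3 - b ^ 3 = 1 := by rw [ha3, hb3]; ring
  rw [← h1]
  -- After factoring out a - b ≥ 0, this is a² + ab + b² ≤ 3a(a + b).
  nlinarith [mul_nonneg hbp (sub_nonneg.2 hab), mul_nonneg (mul_nonneg hbp hbp) (sub_nonneg.2 hab),
    mul_nonneg (mul_nonneg hap.le hap.le) (sub_nonneg.2 hab),
    mul_nonneg (mul_nonneg hbp hap.le) (sub_nonneg.2 hab)]

theorem sum_Icc_sobWeight_le (N : ℕ) :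
    ∑ n ∈ Finset.Icc (-(N : ℤ)) N, sobWeight (-(1 / 3)) n ≤ 1 + 6 * (N : ℝ) ^ (2 / 3 : ℝ) := by
  have hle : ∀ (M : ℕ) (n : ℤ), |(n : ℝ)| = (M : ℝ) + 1 → sobWeight (-(1 / 3)) n ≤
      ((M : ℝ) + 1) ^ (-(1 / 3) : ℝ) := by
    intro M n hn
    rw [← hn]
    exact Real.rpow_le_rpow_of_nonpos (by rw [hn]; positivity) (abs_le_bracket _) (by norm_num)
  induction N with
  | zero => simp [sobWeight, bracket]
  | succ N ih =>
    have hI : Finset.Icc (-((N + 1 : ℕ) : ℤ)) ((N + 1 : ℕ) : ℤ) =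
        insert ((N : ℤ) + 1) (insert (-((N : ℤ) + 1)) (Finset.Icc (-(N : ℤ)) N)) := by
      ext n; simp only [Finset.mem_insert, Finset.mem_Icc]; push_cast; omega
    rw [hI, Finset.sum_insert (by simp only [Finset.mem_insert, Finset.mem_Icc]; omega),
      Finset.sum_insert (by simp only [Finset.mem_Icc]; omega)]
    have hN : (0 : ℝ) ≤ N := Nat.cast_nonneg N
    have h1 := hle N ((N : ℤ) + 1) (by push_cast; exact abs_of_nonneg (by positivity))
    have h2 := hle N (-((N : ℤ) + 1)) (by push_cast; rw [abs_neg]; exact abs_of_nonneg (by positivity))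
    have h3 := succ_rpow_le N
    push_cast at h1 h2 ⊢
    linarith

theorem sum_sobWeight_le {R : ℝ} (hR : 0 ≤ R) (S : Finset ℤ)
    (hS : ∀ n ∈ S, bracket (n : ℝ) ≤ R) :
    ∑ n ∈ S, sobWeight (-(1 / 3)) n ≤ 7 * R ^ (2 / 3 : ℝ) := by
  rcases S.eq_empty_or_nonempty with rfl | ⟨m, hm⟩
  · simp; positivity
  have hR1 : 1 ≤ R := (one_le_bracket _).trans (hS m hm)
  have hsub : S ⊆ Finset.Icc (-(⌊R⌋₊ : ℤ)) ⌊R⌋₊ := by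
    intro n hn
    have h1 : |(n : ℝ)| ≤ R := (abs_le_bracket _).trans (hS n hn)
    have h2 : n.natAbs ≤ ⌊R⌋₊ := Nat.le_floor (by rwa [Nat.cast_natAbs, Int.cast_abs])
    rw [Finset.mem_Icc]; omega
  have h1 : ((⌊R⌋₊ : ℕ) : ℝ) ^ (2 / 3 : ℝ) ≤ R ^ (2 / 3 : ℝ) :=
    Real.rpow_le_rpow (Nat.cast_nonneg _) (Nat.floor_le hR) (by norm_num)
  have h2 : 1 ≤ R ^ (2 / 3 : ℝ) := Real.one_le_rpow hR1 (by norm_num)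
  calc _ ≤ ∑ n ∈ Finset.Icc (-(⌊R⌋₊ : ℤ)) ⌊R⌋₊, sobWeight (-(1 / 3)) n :=
        Finset.sum_le_sum_of_subset_of_nonneg hsub fun n _ _ => (sobWeight_pos _ n).le
    _ ≤ _ := sum_Icc_sobWeight_le _
    _ ≤ _ := by linarith

/-- The low frequencies of an `H^{1/6}` function are bounded. -/
theorem sum_norm_low_le {H r : ℝ} {x : ℤ → ℂ} (hx : WBound (sobWeight (1 / 6)) H x) (hr : 0 ≤ r)
    (S : Finset ℤ) (hS : ∀ n ∈ S, sobWeight (1 / 3) n ≤ r) : ∑ n ∈ S, ‖x n‖ ≤ 3 * H * r := by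
  have hbr : ∀ n ∈ S, bracket (n : ℝ) ≤ r ^ 3 := by
    intro n hn
    have := pow_le_pow_left₀ (sobWeight_pos _ n).le (hS n hn) 3
    rw [sobWeight, ← Real.rpow_natCast, ← Real.rpow_mul (bracket_pos _).le] at this
    norm_num at this
    exact this
  have h1 := sum_sobWeight_le (pow_nonneg hr 3) S hbr
  have h2 : (r ^ 3) ^ (2 / 3 : ℝ) = r ^ 2 := by
    rw [← Real.rpow_natCast, ← Real.rpow_mul hr, ← Real.rpow_natCast]; norm_num
  rw [h2] at h1
  -- Cauchy–Schwarz against ⟨n⟩^{-1/6}: over ⟨n⟩ ≤ r³ the squares of that weight sum to at most 7r²,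
  -- and 7 ≤ 3² gives the constant.
  have hcs := Finset.sum_mul_sq_le_sq_mul_sq S (fun n => sobWeight (-(1 / 6)) n)
    (fun n => sobWeight (1 / 6) n * ‖x n‖)
  have e1 : ∀ n : ℤ, sobWeight (-(1 / 6)) n * (sobWeight (1 / 6) n * ‖x n‖) = ‖x n‖ := by
    intro n
    rw [← mul_assoc, sobWeight, sobWeight, ← Real.rpow_add (bracket_pos _)]
    norm_num
  have e2 : ∀ n : ℤ, sobWeight (-(1 / 6)) n ^ 2 = sobWeight (-(1 / 3)) n := by
    intro n
    rw [sobWeight, sobWeight, ← Real.rpow_natCast, ← Real.rpow_mul (bracket_pos _).le]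
    norm_num
  simp_rw [e1, e2, ← wnorm_sq] at hcs
  have h3 : (wnorm (sobWeight (1 / 6)) S x) ^ 2 ≤ H ^ 2 := pow_le_pow_left₀ (wnorm_nonneg _ _ _) (hx S) 2
  have hH := hx.nonneg
  refine le_of_sq_le_sq ?_ (by positivity)
  calc _ ≤ (7 * r ^ 2) * H ^ 2 := hcs.trans (by gcongr)
    _ ≤ _ := by nlinarith [sq_nonneg (r * H)]

/-- The trigonometric polynomial `∑_{n ∈ S} a(n) e^{inx}`. -/
def trigPoly (a : ℤ → ℂ) (S : Finset ℤ) : C(Circ, ℂ) := ∑ n ∈ S, a n • fourier n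

theorem trigPoly_apply (a : ℤ → ℂ) (S : Finset ℤ) (x : Circ) :
    trigPoly a S x = ∑ n ∈ S, a n * fourier n x := by
  simp [trigPoly, ContinuousMap.sum_apply]

/-- The class in `L²(𝕋)` of a trigonometric polynomial. -/
def trigPolyL2 (a : ℤ → ℂ) (S : Finset ℤ) : L2 :=
  ContinuousMap.toLp 2 AddCircle.haarAddCircle ℂ (trigPoly a S)

theorem trigPolyL2_ae (a : ℤ → ℂ) (S : Finset ℤ) :
    trigPolyL2 a S =ᵐ[AddCircle.haarAddCircle] trigPoly a S :=
  ContinuousMap.coeFn_toLp _ _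

theorem fourierCoeff_sub_L2 (f g : L2) (n : ℤ) :
    fourierCoeff (f - g : L2) n = fourierCoeff f n - fourierCoeff g n := by
  simp only [← fourierBasis_repr, map_sub, lp.coeFn_sub, Pi.sub_apply]

theorem fourierCoeff_trigPolyL2 (a : ℤ → ℂ) (S : Finset ℤ) (n : ℤ) :
    fourierCoeff (trigPolyL2 a S) n = if n ∈ S then a n else 0 := by
  have h : trigPolyL2 a S = ∑ m ∈ S, a m • fourierBasis (T := 2 * Real.pi) m := by
    simp [trigPolyL2, trigPoly, coe_fourierBasis]
  rw [h, ← fourierBasis_repr, map_sum]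
  simp only [map_smul, HilbertBasis.repr_self, lp.coeFn_sum, Finset.sum_apply, lp.coeFn_smul,
    Pi.smul_apply, lp.single_apply, smul_eq_mul]
  rw [Finset.sum_congr rfl (g := fun m => if m = n then a m else 0)]
  · simp
  · intro m _
    by_cases hmn : m = n
    · subst hmn; simp
    · simp [hmn, Ne.symm hmn]

theorem lintegral_enorm_sq_L2 (f : L2) :
    ∫⁻ x, ‖f x‖ₑ ^ 2 ∂AddCircle.haarAddCircle = ∑' n, ‖fourierCoeff f n‖ₑ ^ 2 := by
  have h1 := tsum_sq_fourierCoeff (T := 2 * Real.pi) f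
  have h2 := (hasSum_sq_fourierCoeff (T := 2 * Real.pi) f).summable
  have hi : Integrable (fun x => ‖f x‖ ^ 2) (AddCircle.haarAddCircle (T := 2 * Real.pi)) :=
    (Lp.memLp f).integrable_norm_pow (by norm_num)
  calc _ = ∫⁻ x, ENNReal.ofReal (‖f x‖ ^ 2) ∂AddCircle.haarAddCircle := by
        refine lintegral_congr fun x => ?_
        rw [ENNReal.ofReal_pow (norm_nonneg _), ofReal_norm]
    _ = ENNReal.ofReal (∑' n, ‖fourierCoeff f n‖ ^ 2) := by
        rw [h1, ofReal_integral_eq_lintegral_ofReal hi (ae_of_all _ fun x => sq_nonneg _)]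
    _ = _ := by
        rw [ENNReal.ofReal_tsum_of_nonneg (fun _ => sq_nonneg _) h2]
        refine tsum_congr fun n => ?_
        rw [ENNReal.ofReal_pow (norm_nonneg _), ofReal_norm]

/-- The distribution function of an `H^{1/6}` function. -/
theorem meas_lt_norm_le {H : ℝ} (hH : 0 < H) (f : L2)
    (hf : WBound (sobWeight (1 / 6)) H (fourierCoeff f)) {r : ℝ} (hr : 0 < r) :
    AddCircle.haarAddCircle {x | r < ‖f x‖} * ENNReal.ofReal (r ^ 2) ≤
      4 * ∑' n, ‖fourierCoeff f n‖ₑ ^ 2 *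
        (Ioo 0 (6 * H * sobWeight (1 / 3) n)).indicator 1 r := by
  -- The frequency cutoff grows with the level `r`. The factor 6 makes the low part at most
  -- 3H·r/(6H) = r/2 pointwise, so on {|f| > r} the high part exceeds r/2 and Chebyshev's inequality
  -- applies.
  have hfin : {n : ℤ | 6 * H * sobWeight (1 / 3) n ≤ r}.Finite := by
    refine (Set.finite_Icc (-⌈(r / (6 * H)) ^ 3⌉) ⌈(r / (6 * H)) ^ 3⌉).subset fun n hn => ?_
    have h1 : sobWeight (1 / 3) n ≤ r / (6 * H) := by
      rw [le_div_iff₀ (by positivity)]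
      linarith [hn.out]
    have := pow_le_pow_left₀ (sobWeight_pos _ n).le h1 3
    rw [sobWeight, ← Real.rpow_natCast, ← Real.rpow_mul (bracket_pos _).le] at this
    norm_num at this
    have h2 : |(n : ℝ)| ≤ ⌈(r / (6 * H)) ^ 3⌉ := by
      refine ((abs_le_bracket _).trans ?_).trans (Int.le_ceil _)
      exact this
    rw [abs_le] at h2
    constructor
    · exact_mod_cast h2.1
    · exact_mod_cast h2.2
  set S := hfin.toFinset
  set g := trigPolyL2 (fourierCoeff f) S
  have hg : ∀ x, ‖trigPoly (fourierCoeff f) S x‖ ≤ r / 2 := by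
    intro x
    rw [trigPoly_apply]
    refine (norm_sum_le _ _).trans ?_
    have h1 := sum_norm_low_le hf (r := r / (6 * H)) (by positivity) S (by
      intro n hn
      have : 6 * H * sobWeight (1 / 3) n ≤ r := by simpa [S] using hn
      rw [le_div_iff₀ (by positivity)]
      linarith)
    calc ∑ n ∈ S, ‖fourierCoeff f n * fourier n x‖ = ∑ n ∈ S, ‖fourierCoeff f n‖ := by
          refine Finset.sum_congr rfl fun n _ => ?_
          rw [norm_mul, fourier_apply, Circle.norm_coe, mul_one]
      _ ≤ _ := h1
      _ = r / 2 := by field_simp; norm_num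
  have hsub : AddCircle.haarAddCircle {x | r < ‖f x‖} ≤
      AddCircle.haarAddCircle {x | ENNReal.ofReal ((r / 2) ^ 2) ≤ ‖(f - g : L2) x‖ₑ ^ 2} := by
    refine measure_mono_ae ?_
    filter_upwards [Lp.coeFn_sub f g, trigPolyL2_ae (fourierCoeff f) S] with x h1 h2 h3
    have h3 : r < ‖f x‖ := h3
    change ENNReal.ofReal ((r / 2) ^ 2) ≤ ‖(f - g : L2) x‖ₑ ^ 2
    rw [h1, Pi.sub_apply, h2, ← ofReal_norm, ← ENNReal.ofReal_pow (norm_nonneg _)]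
    refine ENNReal.ofReal_le_ofReal (pow_le_pow_left₀ (by positivity) ?_ 2)
    have := norm_sub_norm_le (f x) (trigPoly (fourierCoeff f) S x)
    linarith [hg x]
  have hmk := mul_meas_ge_le_lintegral₀ (μ := AddCircle.haarAddCircle (T := 2 * Real.pi))
    (f := fun x => ‖(f - g : L2) x‖ₑ ^ 2)
    ((Lp.aestronglyMeasurable (f - g)).enorm.pow_const 2) (ENNReal.ofReal ((r / 2) ^ 2))
  rw [lintegral_enorm_sq_L2] at hmk
  have e4 : ENNReal.ofReal (r ^ 2) = 4 * ENNReal.ofReal ((r / 2) ^ 2) := by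
    rw [show (4 : ℝ≥0∞) = ENNReal.ofReal 4 by norm_num, ← ENNReal.ofReal_mul (by norm_num)]
    congr 1; ring
  rw [e4, mul_left_comm, mul_comm (AddCircle.haarAddCircle _)]
  refine mul_le_mul' le_rfl (((mul_le_mul' le_rfl hsub).trans hmk).trans
    (ENNReal.tsum_le_tsum fun n => ?_))
  rw [fourierCoeff_sub_L2, fourierCoeff_trigPolyL2]
  by_cases hn : n ∈ S
  · simp [hn]
  · have : r ∈ Ioo 0 (6 * H * sobWeight (1 / 3) n) := ⟨hr, by simpa [S] using hn⟩
    rw [if_neg hn, sub_zero, Set.indicator_of_mem this, Pi.one_apply, mul_one]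

/-- Integrate the level-set bound in the layer-cake formula: frequency n contributes for levels
below 6H⟨n⟩^{1/3}, which produces exactly the H^{1/6} weight. The constant is 3·4·6 = 72. -/
theorem lintegral_enorm_cube_le {H : ℝ} (hH : 0 < H) (f : L2)
    (hf : WBound (sobWeight (1 / 6)) H (fourierCoeff f)) :
    ∫⁻ x, ‖f x‖ₑ ^ 3 ∂AddCircle.haarAddCircle ≤ ENNReal.ofReal (72 * H ^ 3) := by
  have h1 := lintegral_rpow_eq_lintegral_meas_lt_mul (AddCircle.haarAddCircle (T := 2 * Real.pi))
    (f := fun x => ‖f x‖) (ae_of_all _ fun x => norm_nonneg _)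
    (Lp.aestronglyMeasurable f).norm.aemeasurable (p := 3) (by norm_num)
  have e1 : ∫⁻ x, ‖f x‖ₑ ^ 3 ∂AddCircle.haarAddCircle =
      ∫⁻ x, ENNReal.ofReal (‖f x‖ ^ (3 : ℝ)) ∂AddCircle.haarAddCircle := by
    refine lintegral_congr fun x => ?_
    rw [← ofReal_norm, ← ENNReal.ofReal_pow (norm_nonneg _)]
    norm_cast
  rw [e1, h1]
  have h2 : ∫⁻ t in Ioi 0, AddCircle.haarAddCircle {x : Circ | t < ‖f x‖} *
      ENNReal.ofReal (t ^ ((3 : ℝ) - 1)) ≤ ∫⁻ t, 4 * ∑' n, ‖fourierCoeff f n‖ₑ ^ 2 *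
        (Ioo 0 (6 * H * sobWeight (1 / 3) n)).indicator 1 t := by
    refine (setLIntegral_mono_ae' measurableSet_Ioi (ae_of_all _ fun t ht => ?_)).trans
      (setLIntegral_le_lintegral _ _)
    have := meas_lt_norm_le hH f hf (r := t) ht
    rw [show (3 : ℝ) - 1 = (2 : ℕ) by norm_num, Real.rpow_natCast]
    exact this
  have hmeas : ∀ n : ℤ, Measurable fun t : ℝ => ‖fourierCoeff f n‖ₑ ^ 2 *
        (Ioo 0 (6 * H * sobWeight (1 / 3) n)).indicator (1 : ℝ → ℝ≥0∞) t := fun n =>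
    (measurable_one.indicator measurableSet_Ioo).const_mul _
  have h3 : ∫⁻ t, 4 * ∑' n, ‖fourierCoeff f n‖ₑ ^ 2 *
        (Ioo 0 (6 * H * sobWeight (1 / 3) n)).indicator 1 t =
      4 * ∑' n, ENNReal.ofReal (6 * H) * ENNReal.ofReal (sobWeight (1 / 6) n * ‖fourierCoeff f n‖) ^ 2 := by
    rw [lintegral_const_mul _ (Measurable.tsum hmeas),
      lintegral_tsum fun n => (hmeas n).aemeasurable]
    congr 1
    refine tsum_congr fun n => ?_
    rw [lintegral_const_mul _ (measurable_one.indicator measurableSet_Ioo),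
      lintegral_indicator_one measurableSet_Ioo, Real.volume_Ioo, sub_zero,
      ENNReal.ofReal_mul (by positivity), ENNReal.ofReal_mul (sobWeight_pos _ n).le, ofReal_norm,
      mul_pow, ← ENNReal.ofReal_pow (sobWeight_pos _ n).le]
    have : sobWeight (1 / 6) n ^ 2 = sobWeight (1 / 3) n := by
      rw [sobWeight, sobWeight, ← Real.rpow_natCast, ← Real.rpow_mul (bracket_pos _).le]
      norm_num
    rw [this]; ring
  calc _ ≤ ENNReal.ofReal 3 * (4 * (ENNReal.ofReal (6 * H) * ENNReal.ofReal H ^ 2)) := by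
        refine mul_le_mul' le_rfl (h2.trans (h3.trans_le ?_))
        rw [ENNReal.tsum_mul_left]
        exact mul_le_mul' le_rfl (mul_le_mul' le_rfl hf.tsum_le)
    _ = _ := by
        rw [show (4 : ℝ≥0∞) = ENNReal.ofReal 4 by norm_num, ← ENNReal.ofReal_pow hH.le,
          ← ENNReal.ofReal_mul (by positivity), ← ENNReal.ofReal_mul (by positivity),
          ← ENNReal.ofReal_mul (by positivity)]
        congr 1; ring

/-! ### The cubic nonlinearity on the Fourier side -/

theorem ofReal_norm_sq_mul (z : ℂ) : ((‖z‖ ^ 2 : ℝ) : ℂ) * z = z * (starRingEnd ℂ) z * z := by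
  rw [Complex.mul_conj']; push_cast; ring

theorem fourierCoeff_cubic_trigPoly {a : ℤ → ℂ} {S : Finset ℤ} (ha : ∀ n ∉ S, a n = 0) (n : ℤ) :
    fourierCoeff (fun x : Circ => ((‖trigPoly a S x‖ ^ 2 : ℝ) : ℂ) * trigPoly a S x) n =
      tri (fun _ => 1) a a a n := by
  have h1 : (fun x : Circ => ((‖trigPoly a S x‖ ^ 2 : ℝ) : ℂ) * trigPoly a S x) =
      ∑ q ∈ (S ×ˢ S) ×ˢ S, (a q.1.1 * (starRingEnd ℂ) (a q.2) * a q.1.2) •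
        (fourier (q.1.1 - q.2 + q.1.2) : Circ → ℂ) := by
    funext x
    rw [ofReal_norm_sq_mul, trigPoly_apply, map_sum, Finset.sum_mul_sum, Finset.sum_apply]
    simp_rw [Finset.sum_mul, Finset.mul_sum]
    rw [Finset.sum_product, Finset.sum_product]
    refine Finset.sum_congr rfl fun i _ => ?_
    rw [Finset.sum_comm]
    refine Finset.sum_congr rfl fun k _ => Finset.sum_congr rfl fun j _ => ?_
    simp only [Pi.smul_apply, smul_eq_mul, sub_eq_add_neg, fourier_add, fourier_neg, map_mul]
    ring
  rw [h1, fourierCoeff.sum _ _ (fun q _ => by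
    refine Continuous.integrable_of_hasCompactSupport ?_ (HasCompactSupport.of_compactSpace _)
    exact (map_continuous (fourier _)).const_smul _), Finset.sum_apply]
  simp_rw [fourierCoeff.const_smul, fourierCoeff_fourier]
  rw [Finset.sum_product]
  have h2 : ∀ q : ℤ × ℤ, ∑ j ∈ S, (a q.1 * (starRingEnd ℂ) (a j) * a q.2) •
      (Pi.single (q.1 - j + q.2) 1 : ℤ → ℂ) n = a q.1 * (starRingEnd ℂ) (a (q.1 + q.2 - n)) * a q.2 := by
    intro q
    rw [Finset.sum_eq_single (q.1 + q.2 - n)]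
    · rw [show q.1 - (q.1 + q.2 - n) + q.2 = n by ring]; simp
    · intro j _ hj
      rw [Pi.single_eq_of_ne (by omega)]; simp
    · intro hj
      simp [ha _ hj]
  simp_rw [h2]
  rw [tri, ← ((Equiv.subRight n).prodCongr (Equiv.subRight n)).tsum_eq, tsum_eq_sum (s := S ×ˢ S)]
  · refine Finset.sum_congr rfl fun q _ => ?_
    simp only [Equiv.prodCongr_apply, Prod.map_fst, Prod.map_snd, Equiv.subRight_apply, one_mul,
      add_sub_cancel]
    rw [show q.1 + (q.2 - n) = q.1 + q.2 - n by ring]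
  · intro q hq
    simp only [Equiv.prodCongr_apply, Prod.map_fst, Prod.map_snd, Equiv.subRight_apply,
      add_sub_cancel]
    rw [Finset.mem_product, not_and_or] at hq
    rcases hq with hq | hq <;> simp [ha _ hq]

theorem WBound.indicator {ω : ℤ → ℝ} {M : ℝ} {x : ℤ → ℂ} (hω : ∀ n, 0 ≤ ω n) (h : WBound ω M x)
    (S : Set ℤ) : WBound ω M (S.indicator x) :=
  h.of_le hω fun n => mul_le_mul_of_nonneg_left (norm_indicator_le_norm_self _ _) (hω n)

/-- For finitely many frequencies the trilinear sum is a Fourier coefficient of |f|²f, hence at most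
the cube of the L³ norm. -/
theorem norm_tri_finite_le {H : ℝ} (hH : 0 < H) {a : ℤ → ℂ} {S : Finset ℤ} (ha : ∀ n ∉ S, a n = 0)
    (hb : WBound (sobWeight (1 / 6)) H a) (n : ℤ) : ‖tri (fun _ => 1) a a a n‖ ≤ 72 * H ^ 3 := by
  have hc : fourierCoeff (trigPolyL2 a S) = a := by
    funext n
    rw [fourierCoeff_trigPolyL2]
    split_ifs with hn
    · rfl
    · exact (ha n hn).symm
  have h3 := lintegral_enorm_cube_le hH (trigPolyL2 a S) (by rw [hc]; exact hb)
  rw [← fourierCoeff_cubic_trigPoly ha]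
  have h4 : ‖fourierCoeff (fun x : Circ => ((‖trigPoly a S x‖ ^ 2 : ℝ) : ℂ) * trigPoly a S x) n‖ₑ ≤
      ENNReal.ofReal (72 * H ^ 3) := by
    refine (enorm_integral_le_lintegral_enorm _).trans (le_trans (lintegral_mono_ae ?_) h3)
    filter_upwards [trigPolyL2_ae a S] with x hx
    rw [hx, enorm_smul, fourier_apply, enorm_mul, ← ofReal_norm, Circle.norm_coe]
    simp only [ENNReal.ofReal_one, one_mul]
    rw [← ofReal_norm, ← ofReal_norm, ← ENNReal.ofReal_mul (norm_nonneg _),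
      ← ENNReal.ofReal_pow (norm_nonneg _)]
    refine ENNReal.ofReal_le_ofReal (le_of_eq ?_)
    rw [Complex.norm_real, Real.norm_of_nonneg (by positivity)]
    ring
  rw [← ofReal_norm] at h4
  exact (ENNReal.ofReal_le_ofReal_iff (by positivity)).1 h4

/-- The constant in the trilinear `H^{1/6}` estimate. -/
def triConst : ℝ := 72 * 3 ^ 3

/-- The L³ bound controls only a signed sum of one function. For nonnegative coefficients signed and
absolute sums agree, so it suffices to dominate all three sequences, after normalization, by a
single nonnegative one. -/
theorem posTri_le_of_pos {A B C : ℝ} (hA : 0 < A) (hB : 0 < B) (hC : 0 < C) {f g h : ℤ → ℂ}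
    (hf : WBound (sobWeight (1 / 6)) A f) (hg : WBound (sobWeight (1 / 6)) B g)
    (hh : WBound (sobWeight (1 / 6)) C h) (n : ℤ) :
    posTri (fun _ => 1) (fun n => ‖f n‖ₑ) (fun n => ‖g n‖ₑ) (fun n => ‖h n‖ₑ) n ≤
      ENNReal.ofReal (triConst * (A * B * C)) := by
  rw [posTri, ENNReal.tsum_eq_iSup_sum]
  refine iSup_le fun P => ?_
  classical
  set S : Finset ℤ := P.image (fun p => n + p.1) ∪ P.image (fun p => n + p.1 + p.2) ∪
    P.image (fun p => n + p.2)
  -- The common majorant; as a sum of three normalized sequences it has norm at most 3, whence the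
  -- factor 3³ in `triConst`.
  set σ : ℤ → ℝ := fun n => ‖f n‖ / A + ‖g n‖ / B + ‖h n‖ / C with hσdef
  have hσ0 : ∀ n, 0 ≤ σ n := fun n => by simp only [σ]; positivity
  have hω : ∀ n, 0 ≤ sobWeight (1 / 6) n := fun n => (sobWeight_pos _ n).le
  have hnorm : ∀ {M : ℝ} {x : ℤ → ℂ}, 0 < M → WBound (sobWeight (1 / 6)) M x →
      WBound (sobWeight (1 / 6)) 1 (fun n => ((‖x n‖ / M : ℝ) : ℂ)) := by
    intro M x hM hx
    have := hx.smul M⁻¹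
    rw [abs_of_pos (inv_pos.2 hM), inv_mul_cancel₀ hM.ne'] at this
    refine this.of_le hω fun n => le_of_eq ?_
    congr 1
    rw [Complex.norm_real, norm_mul, Complex.norm_real, norm_div, norm_norm, norm_inv]
    ring
  set a : ℤ → ℂ := (S : Set ℤ).indicator fun n => (σ n : ℂ) with hadef
  have ha : ∀ n ∉ S, a n = 0 := fun n hn => Set.indicator_of_notMem (by simpa using hn) _
  have haS : ∀ n ∈ S, a n = σ n := fun n hn => Set.indicator_of_mem (by simpa using hn) _
  have hab : WBound (sobWeight (1 / 6)) 3 a := by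
    refine WBound.indicator hω ?_ _
    have := ((hnorm hA hf).add (hnorm hB hg)).add (hnorm hC hh)
    norm_num at this
    refine this.of_le hω fun n => le_of_eq ?_
    congr 2
    simp [σ]
  have hfin := norm_tri_finite_le (by norm_num) ha hab n
  set b : ℤ → ℝ := fun n => if n ∈ S then σ n else 0
  have hb0 : ∀ n, 0 ≤ b n := fun n => by simp only [b]; split_ifs <;> simp [hσ0]
  have hba : ∀ n, a n = b n := by
    intro n
    by_cases hn : n ∈ S
    · rw [haS n hn]; simp [b, hn]
    · rw [ha n hn]; simp [b, hn]
  set t : ℤ × ℤ → ℝ := fun p => b (n + p.1) * b (n + p.1 + p.2) * b (n + p.2)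
  have ht0 : ∀ p, 0 ≤ t p := fun p => mul_nonneg (mul_nonneg (hb0 _) (hb0 _)) (hb0 _)
  have htri : tri (fun _ => 1) a a a n = ((∑' p, t p : ℝ) : ℂ) := by
    rw [tri, Complex.ofReal_tsum]
    refine tsum_congr fun p => ?_
    simp [t, hba]
  have hts : Summable t := by
    refine summable_of_ne_finset_zero (s := (S.image fun m => m - n) ×ˢ (S.image fun m => m - n)) ?_
    intro p hp
    rw [Finset.mem_product, not_and_or] at hp
    rcases hp with hp | hp
    · have : n + p.1 ∉ S := fun h => hp (Finset.mem_image.2 ⟨_, h, by ring⟩)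
      simp [t, b, this]
    · have : n + p.2 ∉ S := fun h => hp (Finset.mem_image.2 ⟨_, h, by ring⟩)
      simp [t, b, this]
  rw [htri, Complex.norm_real, Real.norm_of_nonneg (tsum_nonneg ht0)] at hfin
  have hle : ∀ p ∈ P, ‖f (n + p.1)‖ * ‖g (n + p.1 + p.2)‖ * ‖h (n + p.2)‖ ≤ A * B * C * t p := by
    intro p hp
    have m1 : n + p.1 ∈ S := by
      simp only [S, Finset.mem_union, Finset.mem_image]; exact Or.inl (Or.inl ⟨p, hp, rfl⟩)
    have m2 : n + p.1 + p.2 ∈ S := by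
      simp only [S, Finset.mem_union, Finset.mem_image]; exact Or.inl (Or.inr ⟨p, hp, rfl⟩)
    have m3 : n + p.2 ∈ S := by
      simp only [S, Finset.mem_union, Finset.mem_image]; exact Or.inr ⟨p, hp, rfl⟩
    simp only [t, b, m1, m2, m3, if_true]
    have hf' : ∀ n, ‖f n‖ ≤ A * σ n := fun n => by
      rw [← div_le_iff₀' hA]; simp only [σ]
      have : 0 ≤ ‖g n‖ / B := by positivity
      have : 0 ≤ ‖h n‖ / C := by positivity
      linarith
    have hg' : ∀ n, ‖g n‖ ≤ B * σ n := fun n => by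
      rw [← div_le_iff₀' hB]; simp only [σ]
      have : 0 ≤ ‖f n‖ / A := by positivity
      have : 0 ≤ ‖h n‖ / C := by positivity
      linarith
    have hh' : ∀ n, ‖h n‖ ≤ C * σ n := fun n => by
      rw [← div_le_iff₀' hC]; simp only [σ]
      have : 0 ≤ ‖f n‖ / A := by positivity
      have : 0 ≤ ‖g n‖ / B := by positivity
      linarith
    have s1 := hσ0 (n + p.1)
    have s2 := hσ0 (n + p.1 + p.2)
    calc _ ≤ A * σ (n + p.1) * (B * σ (n + p.1 + p.2)) * (C * σ (n + p.2)) := by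
          gcongr
          · exact hf' _
          · exact hg' _
          · exact hh' _
      _ = _ := by ring
  calc _ = ENNReal.ofReal (∑ p ∈ P, ‖f (n + p.1)‖ * ‖g (n + p.1 + p.2)‖ * ‖h (n + p.2)‖) := by
        rw [ENNReal.ofReal_sum_of_nonneg fun _ _ => by positivity]
        refine Finset.sum_congr rfl fun p _ => ?_
        rw [ENNReal.ofReal_mul (by positivity), ENNReal.ofReal_mul (by positivity), ofReal_norm,
          ofReal_norm, ofReal_norm, one_mul]
    _ ≤ _ := by
        refine ENNReal.ofReal_le_ofReal ?_
        calc _ ≤ ∑ p ∈ P, A * B * C * t p := Finset.sum_le_sum hle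
          _ = A * B * C * ∑ p ∈ P, t p := by rw [Finset.mul_sum]
          _ ≤ A * B * C * ∑' p, t p := by gcongr; exact hts.sum_le_tsum _ fun p _ => ht0 p
          _ ≤ A * B * C * (72 * 3 ^ 3) := by gcongr
          _ = _ := by rw [triConst]; ring

/-- Zero bounds cannot be normalized by division; they are reached by letting A+ε, B+ε, C+ε
decrease. -/
theorem posTri_le {A B C : ℝ} {f g h : ℤ → ℂ}
    (hf : WBound (sobWeight (1 / 6)) A f) (hg : WBound (sobWeight (1 / 6)) B g)
    (hh : WBound (sobWeight (1 / 6)) C h) (n : ℤ) :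
    posTri (fun _ => 1) (fun n => ‖f n‖ₑ) (fun n => ‖g n‖ₑ) (fun n => ‖h n‖ₑ) n ≤
      ENNReal.ofReal (triConst * (A * B * C)) := by
  have hlim : Filter.Tendsto (fun ε : ℝ => ENNReal.ofReal (triConst * ((A + ε) * (B + ε) * (C + ε))))
      (nhdsWithin 0 (Ioi 0)) (nhds (ENNReal.ofReal (triConst * (A * B * C)))) := by
    have : Continuous fun ε : ℝ => ENNReal.ofReal (triConst * ((A + ε) * (B + ε) * (C + ε))) :=
      ENNReal.continuous_ofReal.comp (by fun_prop)
    have := this.tendsto 0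
    simp only [add_zero] at this
    exact this.mono_left nhdsWithin_le_nhds
  refine ge_of_tendsto hlim (eventually_mem_nhdsWithin.mono fun ε hε => ?_)
  have hε : 0 < ε := hε
  exact posTri_le_of_pos (by linarith [hf.nonneg]) (by linarith [hg.nonneg])
    (by linarith [hh.nonneg]) (hf.mono (by linarith)) (hg.mono (by linarith))
    (hh.mono (by linarith)) n

/-! ### Absolute convergence and multilinearity of trilinear sums in H^{1/6} -/

section
variable {A B C : ℝ} {f g h : ℤ → ℂ} (hf : WBound (sobWeight (1 / 6)) A f)
  (hg : WBound (sobWeight (1 / 6)) B g) (hh : WBound (sobWeight (1 / 6)) C h)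
include hf hg hh

theorem summable_norm_tri (n : ℤ) :
    Summable fun p : ℤ × ℤ => ‖f (n + p.1) * (starRingEnd ℂ) (g (n + p.1 + p.2)) * h (n + p.2)‖ := by
  have h1 := (posTri_le hf hg hh n).trans_lt ENNReal.ofReal_lt_top
  refine (ENNReal.summable_toReal h1.ne).congr fun p => ?_
  simp

theorem tsum_norm_tri_le (n : ℤ) :
    ∑' p : ℤ × ℤ, ‖f (n + p.1) * (starRingEnd ℂ) (g (n + p.1 + p.2)) * h (n + p.2)‖ ≤
      triConst * (A * B * C) := by
  have h1 := posTri_le hf hg hh n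
  have h0 : 0 ≤ triConst * (A * B * C) := by
    have := hf.nonneg; have := hg.nonneg; have := hh.nonneg
    unfold triConst; positivity
  refine (ENNReal.ofReal_le_ofReal_iff h0).1 (le_trans (le_of_eq ?_) h1)
  rw [ENNReal.ofReal_tsum_of_nonneg (fun _ => norm_nonneg _) (summable_norm_tri hf hg hh n)]
  refine tsum_congr fun p => ?_
  rw [ofReal_norm]
  simp [enorm_mul]

theorem summable_tri {c : ℤ × ℤ → ℂ} {D : ℝ} (hc : ∀ p, ‖c p‖ ≤ D) (n : ℤ) :
    Summable fun p : ℤ × ℤ =>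
      c p * (f (n + p.1) * (starRingEnd ℂ) (g (n + p.1 + p.2)) * h (n + p.2)) :=
  Summable.of_norm_bounded ((summable_norm_tri hf hg hh n).mul_left D) fun p => by
    rw [norm_mul]
    exact mul_le_mul_of_nonneg_right (hc p) (norm_nonneg _)

theorem norm_tri_le {c : ℤ × ℤ → ℂ} {D : ℝ} (hc : ∀ p, ‖c p‖ ≤ D) (n : ℤ) :
    ‖tri c f g h n‖ ≤ D * (triConst * (A * B * C)) := by
  have hD : 0 ≤ D := (norm_nonneg _).trans (hc 0)
  refine le_trans ?_ (mul_le_mul_of_nonneg_left (tsum_norm_tri_le hf hg hh n) hD)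
  rw [← tsum_mul_left]
  refine tsum_of_norm_bounded ((summable_norm_tri hf hg hh n).mul_left D).hasSum fun p => ?_
  rw [norm_mul]
  exact mul_le_mul_of_nonneg_right (hc p) (norm_nonneg _)

theorem tri_add_coeff {c c' : ℤ × ℤ → ℂ} {D D' : ℝ} (hc : ∀ p, ‖c p‖ ≤ D) (hc' : ∀ p, ‖c' p‖ ≤ D') :
    tri (c + c') f g h = tri c f g h + tri c' f g h := by
  funext n
  rw [Pi.add_apply, tri, tri, tri, ← (summable_tri hf hg hh hc n).tsum_add
    (summable_tri hf hg hh hc' n)]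
  exact tsum_congr fun p => by rw [Pi.add_apply]; ring

/-- The telescoping identity for trilinear sums. -/
theorem tri_sub {c : ℤ × ℤ → ℂ} {D : ℝ} (hc : ∀ p, ‖c p‖ ≤ D) {A' B' C' : ℝ} {f' g' h' : ℤ → ℂ}
    (hf' : WBound (sobWeight (1 / 6)) A' f') (hg' : WBound (sobWeight (1 / 6)) B' g')
    (hh' : WBound (sobWeight (1 / 6)) C' h') :
    tri c f g h - tri c f' g' h' =
      tri c (f - f') g h + tri c f' (g - g') h + tri c f' g' (h - h') := by
  funext n
  refine ((summable_tri hf hg hh hc n).hasSum.sub (summable_tri hf' hg' hh' hc n).hasSum).unique ?_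
  refine HasSum.congr_fun (((summable_tri (hf.sub hf') hg hh hc n).hasSum.add
    (summable_tri hf' (hg.sub hg') hh hc n).hasSum).add
      (summable_tri hf' hg' (hh.sub hh') hc n).hasSum) fun p => ?_
  simp only [Pi.sub_apply, map_sub]
  ring

end

/-! ### Identification of the cubic Fourier coefficients with the trilinear sum -/

theorem WBound.exists_tail {ω : ℤ → ℝ} {M : ℝ} {x : ℤ → ℂ} (h : WBound ω M x) {η : ℝ} (hη : 0 < η) :
    ∃ S : Finset ℤ, ∀ S', S ⊆ S' → WBound ω η (x - (S' : Set ℤ).indicator x) := by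
  classical
  obtain ⟨S, hS⟩ := summable_iff_vanishing_norm.1 h.summable (η ^ 2) (by positivity)
  refine ⟨S, fun S' hS' T => ?_⟩
  refine le_of_sq_le_sq ?_ hη.le
  have h1 := hS (T \ S') (Finset.disjoint_of_subset_right hS' Finset.sdiff_disjoint)
  refine le_trans (le_of_eq ?_) ((Real.le_norm_self _).trans h1.le)
  rw [wnorm_sq, ← Finset.sum_sdiff (Finset.sdiff_subset (s := T) (t := S'))]
  rw [Finset.sum_eq_zero, zero_add]
  · refine Finset.sum_congr rfl fun n hn => ?_
    rw [Finset.mem_sdiff] at hn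
    simp [hn.2]
  · intro n hn
    have : n ∈ S' := by
      by_contra hn'
      simp only [Finset.mem_sdiff, not_and, not_not] at hn
      exact hn' (hn.2 hn.1)
    simp [this]

/-- A pointwise form of the L¹ continuity of the cubic map on L³. Splitting according to whether
|z-w| ≤ ε|z| replaces Hölder's inequality and leaves only cubes to integrate. -/
theorem norm_cubic_sub_le {ε : ℝ} (hε : 0 < ε) (z w : ℂ) :
    ‖((‖z‖ ^ 2 : ℝ) : ℂ) * z - ((‖w‖ ^ 2 : ℝ) : ℂ) * w‖ ≤
      5 * (ε * ‖z‖ ^ 3 + ((ε ^ 2)⁻¹ + 1) * ‖z - w‖ ^ 3) := by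
  set d := ‖z - w‖
  have hd : 0 ≤ d := norm_nonneg _
  have hz : 0 ≤ ‖z‖ := norm_nonneg _
  have hw0 : 0 ≤ ‖w‖ := norm_nonneg _
  have hw : ‖w‖ ≤ ‖z‖ + d := by
    have := norm_sub_norm_le w z
    rw [norm_sub_rev] at this
    linarith
  have hdiff : |‖z‖ - ‖w‖| ≤ d := abs_norm_sub_norm_le z w
  have h1 : ((‖z‖ ^ 2 : ℝ) : ℂ) * z - ((‖w‖ ^ 2 : ℝ) : ℂ) * w =
      ((‖z‖ ^ 2 : ℝ) : ℂ) * (z - w) + (((‖z‖ - ‖w‖) * (‖z‖ + ‖w‖) : ℝ) : ℂ) * w := by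
    push_cast; ring
  have h2 : d * ‖z‖ ^ 2 ≤ ε * ‖z‖ ^ 3 + (ε ^ 2)⁻¹ * d ^ 3 := by
    rcases le_total d (ε * ‖z‖) with h | h
    · have : d * ‖z‖ ^ 2 ≤ ε * ‖z‖ * ‖z‖ ^ 2 := by gcongr
      have : 0 ≤ (ε ^ 2)⁻¹ * d ^ 3 := by positivity
      nlinarith
    · have h3 : ‖z‖ ≤ d / ε := by rw [le_div_iff₀ hε]; linarith
      have : d * ‖z‖ ^ 2 ≤ d * (d / ε) ^ 2 := by gcongr
      have e : d * (d / ε) ^ 2 = (ε ^ 2)⁻¹ * d ^ 3 := by field_simp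
      have : 0 ≤ ε * ‖z‖ ^ 3 := by positivity
      linarith
  rw [h1]
  refine (norm_add_le _ _).trans ?_
  rw [norm_mul, norm_mul, Complex.norm_real, Complex.norm_real, Real.norm_of_nonneg (by positivity),
    Real.norm_eq_abs, abs_mul, abs_of_nonneg (by positivity : 0 ≤ ‖z‖ + ‖w‖)]
  calc ‖z‖ ^ 2 * d + |‖z‖ - ‖w‖| * (‖z‖ + ‖w‖) * ‖w‖
      ≤ ‖z‖ ^ 2 * d + d * (‖z‖ + (‖z‖ + d)) * (‖z‖ + d) := by gcongr
    _ ≤ 5 * (d * ‖z‖ ^ 2 + d ^ 3) := by nlinarith [mul_nonneg hd (sq_nonneg (‖z‖ - d)), pow_nonneg hd 3, mul_nonneg hd (sq_nonneg ‖z‖)]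
    _ ≤ _ := by nlinarith

theorem tendsto_tri_indicator {M : ℝ} {x : ℤ → ℂ} (hx : WBound (sobWeight (1 / 6)) M x) (n : ℤ) :
    Filter.Tendsto (fun S : Finset ℤ => tri (fun _ => 1) ((S : Set ℤ).indicator x)
      ((S : Set ℤ).indicator x) ((S : Set ℤ).indicator x) n) Filter.atTop
      (nhds (tri (fun _ => 1) x x x n)) := by
  have hS : ∀ m : ℤ, ∀ᶠ S : Finset ℤ in Filter.atTop, (S : Set ℤ).indicator x m = x m := fun m =>
    (Filter.eventually_ge_atTop {m}).mono fun S hS =>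
      Set.indicator_of_mem (by exact_mod_cast hS (Finset.mem_singleton_self m)) _
  refine tendsto_tsum_of_dominated_convergence (summable_norm_tri hx hx hx n) (fun p => ?_)
    (Filter.Eventually.of_forall fun S p => ?_)
  · refine tendsto_const_nhds.congr' ?_
    filter_upwards [hS (n + p.1), hS (n + p.1 + p.2), hS (n + p.2)] with S h1 h2 h3
    rw [h1, h2, h3]
  · simp only [one_mul, norm_mul, RCLike.norm_conj]
    gcongr <;> exact norm_indicator_le_norm_self _ _

/-- The identity is known for trigonometric polynomials. Along frequency truncations the trilinear
side converges by dominated convergence and the integral side by convergence in L³. -/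
theorem fourierCoeff_cubic_eq_tri (f : L2) {H : ℝ} (hH : 0 < H)
    (hf : WBound (sobWeight (1 / 6)) H (fourierCoeff f)) (n : ℤ) :
    fourierCoeff (fun x : Circ => ((‖f x‖ ^ 2 : ℝ) : ℂ) * f x) n =
      tri (fun _ => 1) (fourierCoeff f) (fourierCoeff f) (fourierCoeff f) n := by
  set μ := AddCircle.haarAddCircle (T := 2 * Real.pi)
  have hω : ∀ n, 0 ≤ sobWeight (1 / 6) n := fun n => (sobWeight_pos _ n).le
  have hfm : AEStronglyMeasurable f μ := Lp.aestronglyMeasurable f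
  have hcube := lintegral_enorm_cube_le hH f hf
  have hmeas : ∀ g : L2, AEStronglyMeasurable (fun x : Circ => ((‖g x‖ ^ 2 : ℝ) : ℂ) * g x) μ := by
    intro g
    have hg : AEStronglyMeasurable g μ := Lp.aestronglyMeasurable g
    exact (Complex.continuous_ofReal.comp_aestronglyMeasurable (hg.norm.pow 2)).mul hg
  have hint : ∀ (g : L2) (H : ℝ), 0 < H → WBound (sobWeight (1 / 6)) H (fourierCoeff g) →
      Integrable (fun x : Circ => ((‖g x‖ ^ 2 : ℝ) : ℂ) * g x) μ := by
    intro g H hH hg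
    refine ⟨hmeas g, ?_⟩
    refine lt_of_le_of_lt (lintegral_mono fun x => ?_)
      ((lintegral_enorm_cube_le hH g hg).trans_lt ENNReal.ofReal_lt_top)
    rw [← ofReal_norm, ← ofReal_norm, ← ENNReal.ofReal_pow (norm_nonneg _), norm_mul,
      Complex.norm_real, Real.norm_of_nonneg (by positivity)]
    exact ENNReal.ofReal_le_ofReal (le_of_eq (by ring))
  refine tendsto_nhds_unique (f := fun S : Finset ℤ => tri (fun _ => 1)
    ((S : Set ℤ).indicator (fourierCoeff f)) ((S : Set ℤ).indicator (fourierCoeff f))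
    ((S : Set ℤ).indicator (fourierCoeff f)) n) (l := Filter.atTop) ?_ (tendsto_tri_indicator hf n)
  -- Truncation error and splitting parameter are both taken to be ε, so the bound is of order εH³ +
  -- ε + ε³; 360 = 5·72 combines the pointwise and the L³ constants.
  have key : ∀ ε : ℝ, 0 < ε → ∃ S : Finset ℤ, ∀ S', S ⊆ S' →
      ‖tri (fun _ => 1) ((S' : Set ℤ).indicator (fourierCoeff f))
        ((S' : Set ℤ).indicator (fourierCoeff f)) ((S' : Set ℤ).indicator (fourierCoeff f)) n -
        fourierCoeff (fun x : Circ => ((‖f x‖ ^ 2 : ℝ) : ℂ) * f x) n‖ ≤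
        360 * (ε * H ^ 3 + ((ε ^ 2)⁻¹ + 1) * ε ^ 3) := by
    intro ε hε
    obtain ⟨S, hS⟩ := hf.exists_tail hε
    refine ⟨S, fun S' hS' => ?_⟩
    set a := (S' : Set ℤ).indicator (fourierCoeff f) with ha
    have ha0 : ∀ n ∉ S', a n = 0 := fun n hn => Set.indicator_of_notMem (by simpa using hn) _
    set g := trigPolyL2 a S'
    have hga : fourierCoeff g = a := by
      funext m
      rw [fourierCoeff_trigPolyL2]
      split_ifs with hm
      · rfl
      · exact (ha0 m hm).symm
    have hg : WBound (sobWeight (1 / 6)) H (fourierCoeff g) := by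
      rw [hga]; exact hf.indicator hω _
    have hcg : fourierCoeff (fun x : Circ => ((‖g x‖ ^ 2 : ℝ) : ℂ) * g x) n =
        tri (fun _ => 1) a a a n := by
      rw [← fourierCoeff_cubic_trigPoly ha0]
      refine congrFun (fourierCoeff_congr_ae ?_) n
      filter_upwards [trigPolyL2_ae a S'] with x hx
      rw [hx]
    have hd : WBound (sobWeight (1 / 6)) ε (fourierCoeff (f - g : L2)) := by
      have : fourierCoeff (f - g : L2) = fourierCoeff f - a := by
        funext m; rw [fourierCoeff_sub_L2, hga]; rfl
      rw [this]; exact hS S' hS'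
    have hdc := lintegral_enorm_cube_le hε (f - g) hd
    rw [← hcg, norm_sub_rev]
    have hsub : fourierCoeff (fun x : Circ => ((‖f x‖ ^ 2 : ℝ) : ℂ) * f x) n -
        fourierCoeff (fun x : Circ => ((‖g x‖ ^ 2 : ℝ) : ℂ) * g x) n =
        ∫ x, fourier (-n) x • (((‖f x‖ ^ 2 : ℝ) : ℂ) * f x - ((‖g x‖ ^ 2 : ℝ) : ℂ) * g x) ∂μ := by
      rw [fourierCoeff, fourierCoeff,
        ← integral_sub ((hint f H hH hf).fourier_smul _) ((hint g H hH hg).fourier_smul _)]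
      simp_rw [smul_sub]
      rfl
    rw [hsub]
    have hle : ‖∫ x, fourier (-n) x • (((‖f x‖ ^ 2 : ℝ) : ℂ) * f x - ((‖g x‖ ^ 2 : ℝ) : ℂ) * g x) ∂μ‖ₑ ≤
        ENNReal.ofReal (360 * (ε * H ^ 3 + ((ε ^ 2)⁻¹ + 1) * ε ^ 3)) := by
      refine (enorm_integral_le_lintegral_enorm _).trans ?_
      calc _ ≤ ∫⁻ x, (ENNReal.ofReal (5 * ε) * ‖f x‖ₑ ^ 3 +
            ENNReal.ofReal (5 * ((ε ^ 2)⁻¹ + 1)) * ‖(f - g : L2) x‖ₑ ^ 3) ∂μ := by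
            refine lintegral_mono_ae ?_
            filter_upwards [Lp.coeFn_sub f g] with x hx
            rw [hx, Pi.sub_apply, ← ofReal_norm, ← ofReal_norm, ← ofReal_norm,
              ← ENNReal.ofReal_pow (norm_nonneg _), ← ENNReal.ofReal_pow (norm_nonneg _),
              ← ENNReal.ofReal_mul (by positivity), ← ENNReal.ofReal_mul (by positivity),
              ← ENNReal.ofReal_add (by positivity) (by positivity)]
            refine ENNReal.ofReal_le_ofReal ?_
            rw [norm_smul, fourier_apply, Circle.norm_coe, one_mul]
            exact (norm_cubic_sub_le hε _ _).trans_eq (by ring)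
        _ = ENNReal.ofReal (5 * ε) * ∫⁻ x, ‖f x‖ₑ ^ 3 ∂μ +
            ENNReal.ofReal (5 * ((ε ^ 2)⁻¹ + 1)) * ∫⁻ x, ‖(f - g : L2) x‖ₑ ^ 3 ∂μ := by
            rw [lintegral_add_left' ((hfm.enorm.pow_const 3).const_mul _),
              lintegral_const_mul' _ _ ENNReal.ofReal_ne_top,
              lintegral_const_mul' _ _ ENNReal.ofReal_ne_top]
        _ ≤ ENNReal.ofReal (5 * ε) * ENNReal.ofReal (72 * H ^ 3) +
            ENNReal.ofReal (5 * ((ε ^ 2)⁻¹ + 1)) * ENNReal.ofReal (72 * ε ^ 3) := by gcongr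
        _ = _ := by
            rw [← ENNReal.ofReal_mul (by positivity), ← ENNReal.ofReal_mul (by positivity),
              ← ENNReal.ofReal_add (by positivity) (by positivity)]
            congr 1; ring
    rw [← ofReal_norm] at hle
    exact (ENNReal.ofReal_le_ofReal_iff (by positivity)).1 hle
  have hlim : Filter.Tendsto (fun ε : ℝ => 360 * (ε * H ^ 3 + (ε + ε ^ 3)))
      (nhdsWithin 0 (Ioi 0)) (nhds 0) := by
    have h1 : Continuous fun ε : ℝ => 360 * (ε * H ^ 3 + (ε + ε ^ 3)) := by fun_prop
    have h2 := h1.tendsto 0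
    norm_num at h2
    exact h2.mono_left nhdsWithin_le_nhds
  rw [Metric.tendsto_nhds]
  intro r hr
  obtain ⟨ε, hεr, hε⟩ := ((hlim.eventually (gt_mem_nhds hr)).and eventually_mem_nhdsWithin).exists
  have hε : 0 < ε := hε
  obtain ⟨S, hS⟩ := key ε hε
  filter_upwards [Filter.eventually_ge_atTop S] with S' hS'
  rw [dist_eq_norm]
  refine lt_of_le_of_lt (hS S' hS') (lt_of_eq_of_lt ?_ hεr)
  field_simp

/-! ### Sewing -/

/-- The a posteriori sewing bound: a two-parameter quantity which is almost additive on dyadic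
subdivisions and at most `ε (t - r)` on short intervals. -/
theorem sewing_bound {a b D θ ε δ : ℝ} (hD : 0 ≤ D) (hθ : 1 < θ) (hδ : 0 < δ) {P : ℝ → ℝ → ℝ}
    (hP : ∀ r ∈ Icc a b, ∀ t ∈ Icc a b, r ≤ t →
      P r t ≤ P r ((r + t) / 2) + P ((r + t) / 2) t + D * (t - r) ^ θ)
    (hshort : ∀ r ∈ Icc a b, ∀ t ∈ Icc a b, r ≤ t → t - r ≤ δ → P r t ≤ ε * (t - r))
    {r t : ℝ} (hr : r ∈ Icc a b) (ht : t ∈ Icc a b) (hrt : r ≤ t) :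
    P r t ≤ D / (1 - 2 ^ (1 - θ)) * (t - r) ^ θ + ε * (t - r) := by
  have h2 : (2 : ℝ) ^ (1 - θ) < 1 := Real.rpow_lt_one_of_one_lt_of_neg one_lt_two (by linarith)
  -- The fixed point of c = D + 2^{1-θ}c: halving the interval turns the constant c into 2^{1-θ}c
  -- plus the defect, so one constant serves at every dyadic level.
  set c := D / (1 - 2 ^ (1 - θ)) with hc
  have hc0 : 0 ≤ c := div_nonneg hD (by linarith)
  have hcD : D + c * 2 ^ (1 - θ) = c := by
    have : c * (1 - 2 ^ (1 - θ)) = D := div_mul_cancel₀ _ (by linarith)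
    linarith
  have key : ∀ k : ℕ, ∀ r ∈ Icc a b, ∀ t ∈ Icc a b, r ≤ t → t - r ≤ 2 ^ k * δ →
      P r t ≤ c * (t - r) ^ θ + ε * (t - r) := by
    intro k
    induction k with
    | zero =>
      intro r hr t ht hrt h
      have h1 := hshort r hr t ht hrt (by simpa using h)
      have h2 : 0 ≤ c * (t - r) ^ θ := mul_nonneg hc0 (Real.rpow_nonneg (by linarith) _)
      linarith
    | succ k ih =>
      intro r hr t ht hrt h
      have hq : (r + t) / 2 ∈ Icc a b := ⟨by linarith [hr.1, ht.1], by linarith [hr.2, ht.2]⟩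
      rw [pow_succ] at h
      have i1 := ih r hr _ hq (by linarith) (by linarith)
      have i2 := ih _ hq t ht (by linarith) (by linarith)
      have e1 : (r + t) / 2 - r = (t - r) / 2 := by ring
      have e2 : t - (r + t) / 2 = (t - r) / 2 := by ring
      have e3 : ((t - r) / 2) ^ θ * 2 = 2 ^ (1 - θ) * (t - r) ^ θ := by
        rw [Real.div_rpow (by linarith) (by norm_num), Real.rpow_sub (by norm_num), Real.rpow_one]
        ring
      rw [e1] at i1
      rw [e2] at i2
      calc P r t ≤ _ := hP r hr t ht hrt
        _ ≤ (c * ((t - r) / 2) ^ θ + ε * ((t - r) / 2)) + (c * ((t - r) / 2) ^ θ + ε * ((t - r) / 2)) +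
            D * (t - r) ^ θ := by gcongr
        _ = (D + c * 2 ^ (1 - θ)) * (t - r) ^ θ + ε * (t - r) := by
            linear_combination c * e3
        _ = _ := by rw [hcD]
  obtain ⟨k, hk⟩ := pow_unbounded_of_one_lt ((t - r) / δ) one_lt_two
  exact key k r hr t ht hrt ((div_le_iff₀ hδ).1 hk.le)

/-! ### Paths in H^{1/6} and time-integrated coefficients -/

/-- A uniformly continuous path into the sequence space of `H^{1/6}`. -/
structure HPath (a b : ℝ) (v : ℝ → ℤ → ℂ) : Prop where
  bdd : ∃ M, 0 < M ∧ ∀ t ∈ Icc a b, WBound (sobWeight (1 / 6)) M (v t)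
  unif : ∀ ε > 0, ∃ δ > 0, ∀ r ∈ Icc a b, ∀ t ∈ Icc a b, |t - r| ≤ δ →
    WBound (sobWeight (1 / 6)) ε (v t - v r)

namespace HPath

variable {a b : ℝ} {u v v₁ v₂ v₃ : ℝ → ℤ → ℂ}

theorem mono (h : HPath a b v) {a' b' : ℝ} (hab : Icc a' b' ⊆ Icc a b) : HPath a' b' v := by
  refine ⟨?_, fun ε hε => ?_⟩
  · obtain ⟨M, hM, h1⟩ := h.bdd
    exact ⟨M, hM, fun t ht => h1 t (hab ht)⟩
  · obtain ⟨δ, hδ, h1⟩ := h.unif ε hε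
    exact ⟨δ, hδ, fun r hr t ht => h1 r (hab hr) t (hab ht)⟩

theorem sub (hu : HPath a b u) (hv : HPath a b v) : HPath a b (u - v) := by
  refine ⟨?_, fun ε hε => ?_⟩
  · obtain ⟨M, hM, h1⟩ := hu.bdd
    obtain ⟨M', hM', h2⟩ := hv.bdd
    exact ⟨M + M', by positivity, fun t ht => (h1 t ht).sub (h2 t ht)⟩
  · obtain ⟨δ, hδ, h1⟩ := hu.unif (ε / 2) (by positivity)
    obtain ⟨δ', hδ', h2⟩ := hv.unif (ε / 2) (by positivity)
    refine ⟨min δ δ', lt_min hδ hδ', fun r hr t ht h => ?_⟩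
    have := (h1 r hr t ht (h.trans (min_le_left _ _))).sub (h2 r hr t ht (h.trans (min_le_right _ _)))
    rw [add_halves] at this
    convert this using 1
    simp only [Pi.sub_apply]; abel

/-- Uniform continuity of the trilinear sums along paths. -/
theorem tri_unif (h₁ : HPath a b v₁) (h₂ : HPath a b v₂) (h₃ : HPath a b v₃) {ε : ℝ} (hε : 0 < ε) :
    ∃ δ > 0, ∀ r ∈ Icc a b, ∀ t ∈ Icc a b, |t - r| ≤ δ → ∀ c : ℤ × ℤ → ℂ, (∀ p, ‖c p‖ ≤ 1) →
      ∀ n, ‖tri c (v₁ t) (v₂ t) (v₃ t) n - tri c (v₁ r) (v₂ r) (v₃ r) n‖ ≤ ε := by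
  obtain ⟨M₁, hM₁, b₁⟩ := h₁.bdd
  obtain ⟨M₂, hM₂, b₂⟩ := h₂.bdd
  obtain ⟨M₃, hM₃, b₃⟩ := h₃.bdd
  have hC : 0 < triConst := by unfold triConst; norm_num
  set η := ε / (triConst * (M₂ * M₃ + M₁ * M₃ + M₁ * M₂)) with hη
  have hη0 : 0 < η := by positivity
  obtain ⟨δ₁, hδ₁, u₁⟩ := h₁.unif η hη0
  obtain ⟨δ₂, hδ₂, u₂⟩ := h₂.unif η hη0
  obtain ⟨δ₃, hδ₃, u₃⟩ := h₃.unif η hη0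
  refine ⟨min δ₁ (min δ₂ δ₃), lt_min hδ₁ (lt_min hδ₂ hδ₃), fun r hr t ht h c hc n => ?_⟩
  have d₁ := u₁ r hr t ht (h.trans (min_le_left _ _))
  have d₂ := u₂ r hr t ht (h.trans ((min_le_right _ _).trans (min_le_left _ _)))
  have d₃ := u₃ r hr t ht (h.trans ((min_le_right _ _).trans (min_le_right _ _)))
  have e := congrFun (tri_sub (b₁ t ht) (b₂ t ht) (b₃ t ht) hc (b₁ r hr) (b₂ r hr) (b₃ r hr)) n
  rw [Pi.sub_apply] at e
  rw [e]
  refine (norm_add₃_le).trans ?_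
  calc _ ≤ 1 * (triConst * (η * M₂ * M₃)) + 1 * (triConst * (M₁ * η * M₃)) +
        1 * (triConst * (M₁ * M₂ * η)) := by
        gcongr
        · exact norm_tri_le d₁ (b₂ t ht) (b₃ t ht) hc n
        · exact norm_tri_le (b₁ r hr) d₂ (b₃ t ht) hc n
        · exact norm_tri_le (b₁ r hr) (b₂ r hr) d₃ hc n
    _ = η * (triConst * (M₂ * M₃ + M₁ * M₃ + M₁ * M₂)) := by ring
    _ = ε := by rw [hη]; field_simp

end HPath

/-- A continuous family of coefficients bounded by one. -/
structure IsCoeff (a b : ℝ) (c : ℝ → ℤ × ℤ → ℂ) : Prop where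
  norm_le : ∀ t p, ‖c t p‖ ≤ 1
  cont : ∀ p, ContinuousOn (fun t => c t p) (Icc a b)

/-- The time integrals of a family of coefficients. -/
def coeffInt (c : ℝ → ℤ × ℤ → ℂ) (r t : ℝ) (p : ℤ × ℤ) : ℂ := ∫ t' in r..t, c t' p

namespace IsCoeff

variable {a b : ℝ} {c c₁ : ℝ → ℤ × ℤ → ℂ} {v₁ v₂ v₃ : ℝ → ℤ → ℂ}

theorem mono (h : IsCoeff a b c) {a' b' : ℝ} (hab : Icc a' b' ⊆ Icc a b) : IsCoeff a' b' c :=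
  ⟨h.norm_le, fun p => (h.cont p).mono hab⟩

theorem norm_coeffInt_le (h : IsCoeff a b c) (r t : ℝ) (p : ℤ × ℤ) :
    ‖coeffInt c r t p‖ ≤ |t - r| := by
  have := intervalIntegral.norm_integral_le_of_norm_le_const (a := r) (b := t) (f := fun t' => c t' p)
    (C := 1) fun x _ => h.norm_le x p
  simpa [coeffInt] using this

theorem intervalIntegrable (h : IsCoeff a b c) {r t : ℝ} (hr : r ∈ Icc a b) (ht : t ∈ Icc a b)
    (p : ℤ × ℤ) : IntervalIntegrable (fun t' => c t' p) volume r t :=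
  ((h.cont p).mono (uIcc_subset_Icc hr ht)).intervalIntegrable

theorem coeffInt_add (h : IsCoeff a b c) {r q t : ℝ} (hr : r ∈ Icc a b) (hq : q ∈ Icc a b)
    (ht : t ∈ Icc a b) : coeffInt c r t = coeffInt c r q + coeffInt c q t := by
  funext p
  exact (intervalIntegral.integral_add_adjacent_intervals (h.intervalIntegrable hr hq p)
    (h.intervalIntegrable hq ht p)).symm

theorem continuousOn_tri_const (h : IsCoeff a b c) {f g k : ℤ → ℂ} {A B C : ℝ}
    (hf : WBound (sobWeight (1 / 6)) A f) (hg : WBound (sobWeight (1 / 6)) B g)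
    (hk : WBound (sobWeight (1 / 6)) C k) (n : ℤ) :
    ContinuousOn (fun t => tri (c t) f g k n) (Icc a b) := by
  refine continuousOn_tsum (fun p => (h.cont p).mul continuousOn_const)
    (summable_norm_tri hf hg hk n) fun p t _ => ?_
  rw [norm_mul]
  exact mul_le_of_le_one_left (norm_nonneg _) (h.norm_le t p)

theorem continuousOn_tri (h : IsCoeff a b c) (h₁ : HPath a b v₁) (h₂ : HPath a b v₂)
    (h₃ : HPath a b v₃) (n : ℤ) :
    ContinuousOn (fun t => tri (c t) (v₁ t) (v₂ t) (v₃ t) n) (Icc a b) := by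
  obtain ⟨M₁, hM₁, b₁⟩ := h₁.bdd
  obtain ⟨M₂, hM₂, b₂⟩ := h₂.bdd
  obtain ⟨M₃, hM₃, b₃⟩ := h₃.bdd
  intro t₀ ht₀
  rw [Metric.continuousWithinAt_iff]
  intro ε hε
  obtain ⟨δ, hδ, hu⟩ := h₁.tri_unif h₂ h₃ (half_pos hε)
  obtain ⟨δ', hδ', hc⟩ := Metric.continuousWithinAt_iff.1
    (h.continuousOn_tri_const (b₁ t₀ ht₀) (b₂ t₀ ht₀) (b₃ t₀ ht₀) n t₀ ht₀) (ε / 2) (half_pos hε)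
  refine ⟨min δ δ', lt_min hδ hδ', fun t ht hd => ?_⟩
  have i1 := hu t₀ ht₀ t ht (by
    rw [← Real.dist_eq]; exact hd.le.trans (min_le_left _ _)) (c t) (h.norm_le t) n
  have i2 := hc ht (hd.trans_le (min_le_right _ _))
  rw [← dist_eq_norm] at i1
  exact (dist_triangle _ _ _).trans_lt (by linarith)

theorem intervalIntegrable_tri (h : IsCoeff a b c) (h₁ : HPath a b v₁) (h₂ : HPath a b v₂)
    (h₃ : HPath a b v₃) {r t : ℝ} (hr : r ∈ Icc a b) (ht : t ∈ Icc a b) (n : ℤ) :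
    IntervalIntegrable (fun t => tri (c t) (v₁ t) (v₂ t) (v₃ t) n) volume r t :=
  ((h.continuousOn_tri h₁ h₂ h₃ n).mono (uIcc_subset_Icc hr ht)).intervalIntegrable

theorem integral_tri_const (h : IsCoeff a b c) {f g k : ℤ → ℂ} {A B C : ℝ}
    (hf : WBound (sobWeight (1 / 6)) A f) (hg : WBound (sobWeight (1 / 6)) B g)
    (hk : WBound (sobWeight (1 / 6)) C k) {r t : ℝ} (hr : r ∈ Icc a b) (ht : t ∈ Icc a b) (n : ℤ) :
    ∫ t' in r..t, tri (c t') f g k n = tri (coeffInt c r t) f g k n := by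
  have hsub : Set.uIoc r t ⊆ Icc a b := uIoc_subset_uIcc.trans (uIcc_subset_Icc hr ht)
  have := intervalIntegral.hasSum_integral_of_dominated_convergence (μ := volume) (a := r) (b := t)
    (F := fun (p : ℤ × ℤ) t' => c t' p * (f (n + p.1) * (starRingEnd ℂ) (g (n + p.1 + p.2)) * k (n + p.2)))
    (f := fun t' => tri (c t') f g k n)
    (fun p _ => ‖f (n + p.1) * (starRingEnd ℂ) (g (n + p.1 + p.2)) * k (n + p.2)‖)
    (fun p => (((h.cont p).mono hsub).mul continuousOn_const).aestronglyMeasurable measurableSet_uIoc)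
    (fun p => ae_of_all _ fun t' _ => by
      rw [norm_mul]; exact mul_le_of_le_one_left (norm_nonneg _) (h.norm_le t' p))
    (ae_of_all _ fun t' _ => summable_norm_tri hf hg hk n)
    (by simp)
    (ae_of_all _ fun t' _ => (summable_tri hf hg hk (h.norm_le t') n).hasSum)
  rw [← this.tsum_eq, tri]
  refine tsum_congr fun p => ?_
  rw [intervalIntegral.integral_mul_const]
  rfl

end IsCoeff

theorem wnorm_le_of_norm_le (ω : ℤ → ℝ) (hω : ∀ n, 0 ≤ ω n) (S : Finset ℤ) {x : ℤ → ℂ} {η : ℝ}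
    (hη : 0 ≤ η) (h : ∀ n, ‖x n‖ ≤ η) : wnorm ω S x ≤ η * wnorm ω S 1 := by
  rw [← abs_of_nonneg hη, ← wnorm_smul]
  refine wnorm_mono hω fun n _ => mul_le_mul_of_nonneg_left ?_ (hω n)
  simpa [abs_of_nonneg hη] using h n

/-- The sewing estimate for time integrals of trilinear sums along paths; `c₂` is a part of the
coefficients for which no cancellation is used. -/
theorem wnorm_integral_tri_sub_le {a b : ℝ} {c c₁ : ℝ → ℤ × ℤ → ℂ} {c₂ : ℤ × ℤ → ℂ}
    (hc : IsCoeff a b c) (hc₁ : IsCoeff a b c₁) (hc₂ : ∀ p, ‖c₂ p‖ ≤ 1) (hcc : ∀ t, c t = c₁ t + c₂)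
    {v₁ v₂ v₃ : ℝ → ℤ → ℂ} (h₁ : HPath a b v₁) (h₂ : HPath a b v₂) (h₃ : HPath a b v₃)
    {ω : ℤ → ℝ} (hω : ∀ n, 0 ≤ ω n) (S : Finset ℤ) {K D θ : ℝ} (hD : 0 ≤ D) (hθ : 1 < θ)
    (hK : ∀ r ∈ Icc a b, wnorm ω S (tri c₂ (v₁ r) (v₂ r) (v₃ r)) ≤ K)
    (hinc : ∀ r ∈ Icc a b, ∀ q ∈ Icc a b, ∀ t ∈ Icc a b, r ≤ q → q ≤ t →
      wnorm ω S (tri (coeffInt c₁ q t) (v₁ q) (v₂ q) (v₃ q) -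
        tri (coeffInt c₁ q t) (v₁ r) (v₂ r) (v₃ r)) ≤ D * (t - r) ^ θ)
    {r t : ℝ} (hr : r ∈ Icc a b) (ht : t ∈ Icc a b) (hrt : r ≤ t) :
    wnorm ω S ((fun n => ∫ t' in r..t, tri (c t') (v₁ t') (v₂ t') (v₃ t') n) -
      tri (coeffInt c₁ r t) (v₁ r) (v₂ r) (v₃ r)) ≤
      D / (1 - 2 ^ (1 - θ)) * (t - r) ^ θ + K * (t - r) := by
  obtain ⟨M₁, -, b₁⟩ := h₁.bdd
  obtain ⟨M₂, -, b₂⟩ := h₂.bdd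
  obtain ⟨M₃, -, b₃⟩ := h₃.bdd
  set R : ℝ → ℝ → ℤ → ℂ := fun r t => (fun n => ∫ t' in r..t, tri (c t') (v₁ t') (v₂ t') (v₃ t') n) -
      tri (coeffInt c₁ r t) (v₁ r) (v₂ r) (v₃ r) with hR
  have hmid : ∀ r ∈ Icc a b, ∀ t ∈ Icc a b, r ≤ t → wnorm ω S (R r t) ≤
      wnorm ω S (R r ((r + t) / 2)) + wnorm ω S (R ((r + t) / 2) t) + D * (t - r) ^ θ := by
    intro r hr t ht hrt
    set q := (r + t) / 2 with hq
    have hqm : q ∈ Icc a b := ⟨by linarith [hr.1, ht.1], by linarith [hr.2, ht.2]⟩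
    -- The integral is additive in the interval, so only the germ fails additivity; its defect is
    -- the change of the frozen arguments from `r` to `q` on [q,t].
    have e : R r t = R r q + R q t + (tri (coeffInt c₁ q t) (v₁ q) (v₂ q) (v₃ q) -
        tri (coeffInt c₁ q t) (v₁ r) (v₂ r) (v₃ r)) := by
      have e1 : tri (coeffInt c₁ r t) (v₁ r) (v₂ r) (v₃ r) =
          tri (coeffInt c₁ r q) (v₁ r) (v₂ r) (v₃ r) + tri (coeffInt c₁ q t) (v₁ r) (v₂ r) (v₃ r) := by
        rw [hc₁.coeffInt_add hr hqm ht, tri_add_coeff (b₁ r hr) (b₂ r hr) (b₃ r hr)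
          (hc₁.norm_coeffInt_le r q) (hc₁.norm_coeffInt_le q t)]
      simp only [hR, e1]
      funext n
      simp only [Pi.sub_apply, Pi.add_apply]
      rw [← intervalIntegral.integral_add_adjacent_intervals
        (hc.intervalIntegrable_tri h₁ h₂ h₃ hr hqm n) (hc.intervalIntegrable_tri h₁ h₂ h₃ hqm ht n)]
      ring
    rw [e]
    refine (wnorm_add_le _ _ _ _).trans (add_le_add (wnorm_add_le _ _ _ _) ?_)
    exact hinc r hr q hqm t ht (by linarith) (by linarith)
  refine le_of_forall_pos_le_add fun ε hε => ?_
  have hts : 0 ≤ t - r := by linarith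
  -- On short intervals plain uniform continuity suffices, with an error η in each coordinate. The
  -- cost `W` of passing to the norm over `S` is harmless: η is chosen after `S`, and the final
  -- bound does not retain it.
  set W := wnorm ω S 1
  have hW : 0 ≤ W := wnorm_nonneg _ _ _
  set η := ε / ((t - r + 1) * (W + 1)) with hη
  have hη0 : 0 < η := by positivity
  obtain ⟨δ, hδ, hu⟩ := h₁.tri_unif h₂ h₃ hη0
  have hshort : ∀ r ∈ Icc a b, ∀ t ∈ Icc a b, r ≤ t → t - r ≤ δ →
      wnorm ω S (R r t) ≤ (K + η * W) * (t - r) := by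
    intro r hr t ht hrt hd
    -- Compare with the integrand frozen at `r`: its `c₁` part integrates exactly to the germ,
    -- leaving only (t-r) times the `c₂` part.
    have e : R r t = (fun n => ∫ t' in r..t, (tri (c t') (v₁ t') (v₂ t') (v₃ t') n -
        tri (c t') (v₁ r) (v₂ r) (v₃ r) n)) +
        fun n => ((t - r : ℝ) : ℂ) * tri c₂ (v₁ r) (v₂ r) (v₃ r) n := by
      funext n
      have e2 : ∫ t' in r..t, tri (c t') (v₁ r) (v₂ r) (v₃ r) n =
          tri (coeffInt c₁ r t) (v₁ r) (v₂ r) (v₃ r) n +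
            ((t - r : ℝ) : ℂ) * tri c₂ (v₁ r) (v₂ r) (v₃ r) n := by
        have e3 : ∀ t', tri (c t') (v₁ r) (v₂ r) (v₃ r) n =
            tri (c₁ t') (v₁ r) (v₂ r) (v₃ r) n + tri c₂ (v₁ r) (v₂ r) (v₃ r) n := fun t' => by
          rw [hcc, tri_add_coeff (b₁ r hr) (b₂ r hr) (b₃ r hr) (hc₁.norm_le t') hc₂]; rfl
        simp_rw [e3]
        rw [intervalIntegral.integral_add
          (((hc₁.continuousOn_tri_const (b₁ r hr) (b₂ r hr) (b₃ r hr) n).mono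
            (uIcc_subset_Icc hr ht)).intervalIntegrable) (by simp),
          hc₁.integral_tri_const (b₁ r hr) (b₂ r hr) (b₃ r hr) hr ht]
        simp
      simp only [hR, Pi.sub_apply, Pi.add_apply]
      rw [intervalIntegral.integral_sub (hc.intervalIntegrable_tri h₁ h₂ h₃ hr ht n)
        (((hc.continuousOn_tri_const (b₁ r hr) (b₂ r hr) (b₃ r hr) n).mono
            (uIcc_subset_Icc hr ht)).intervalIntegrable), e2]
      ring
    rw [e]
    refine (wnorm_add_le _ _ _ _).trans ?_
    rw [wnorm_smul, abs_of_nonneg (sub_nonneg.2 hrt)]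
    have i1 : wnorm ω S (fun n => ∫ t' in r..t, (tri (c t') (v₁ t') (v₂ t') (v₃ t') n -
        tri (c t') (v₁ r) (v₂ r) (v₃ r) n)) ≤ (η * (t - r)) * W := by
      refine wnorm_le_of_norm_le ω hω S (mul_nonneg hη0.le (sub_nonneg.2 hrt)) fun n => ?_
      have := intervalIntegral.norm_integral_le_of_norm_le_const (a := r) (b := t) (C := η)
        (f := fun t' => tri (c t') (v₁ t') (v₂ t') (v₃ t') n - tri (c t') (v₁ r) (v₂ r) (v₃ r) n) ?_
      · rwa [abs_of_nonneg (sub_nonneg.2 hrt)] at this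
      · intro t' ht'
        rw [uIoc_of_le hrt] at ht'
        refine hu r hr t' ⟨hr.1.trans ht'.1.le, ht'.2.trans ht.2⟩ ?_ (c t') (hc.norm_le t') n
        rw [abs_of_nonneg (by linarith [ht'.1])]
        linarith [ht'.2]
    have i2 := mul_le_mul_of_nonneg_left (hK r hr) (sub_nonneg.2 hrt)
    linarith
  have := sewing_bound hD hθ hδ hmid hshort hr ht hrt
  refine this.trans ?_
  have h3 : η * W * (t - r) ≤ ε := by
    calc η * W * (t - r) ≤ η * (W + 1) * (t - r + 1) := by
          have : 0 ≤ η := hη0.le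
          gcongr <;> linarith
      _ = ε := by rw [hη]; field_simp
  linarith

/-! ### Young integrals of Hölder paths -/

/-- The path `v` has weighted `ℓ²` norm at most `M`, and Hölder norm at most `M (b-a)^{-γ}`. -/
structure HBound (γ a b : ℝ) (ω : ℤ → ℝ) (M : ℝ) (v : ℝ → ℤ → ℂ) : Prop where
  bdd : ∀ t ∈ Icc a b, WBound ω M (v t)
  holder : ∀ r ∈ Icc a b, ∀ t ∈ Icc a b, r ≤ t → WBound ω (M * ((t - r) / (b - a)) ^ γ) (v t - v r)

/-- The trilinear operators `∫ᵣᵗ` gain `(t-r)^γ` in the `ω`-weighted norm. -/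
def YoungBound (γ K a b : ℝ) (ω : ℤ → ℝ) (c : ℝ → ℤ × ℤ → ℂ) : Prop :=
  ∀ r ∈ Icc a b, ∀ t ∈ Icc a b, r ≤ t → ∀ f g h A B C, WBound ω A f → WBound ω B g → WBound ω C h →
    WBound ω (K * (t - r) ^ γ * (A * B * C)) (tri (coeffInt c r t) f g h)

theorem YoungBound.mono {γ K a b a' b' : ℝ} {ω : ℤ → ℝ} {c : ℝ → ℤ × ℤ → ℂ}
    (h : YoungBound γ K a b ω c) (hab : Icc a' b' ⊆ Icc a b) : YoungBound γ K a' b' ω c :=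
  fun r hr t ht => h r (hab hr) t (hab ht)

/-- The constant in the Young integral estimate. -/
def youngConst (γ : ℝ) : ℝ := 1 + 3 / (1 - 2 ^ (1 - 2 * γ))

theorem youngConst_pos {γ : ℝ} (hγ : 1 / 2 < γ) : 0 < youngConst γ := by
  have h2 : (2 : ℝ) ^ (1 - 2 * γ) < 1 := Real.rpow_lt_one_of_one_lt_of_neg one_lt_two (by linarith)
  have : 0 < 1 - (2 : ℝ) ^ (1 - 2 * γ) := by linarith
  unfold youngConst; positivity

section
variable {γ K a b : ℝ} {ω : ℤ → ℝ} {c : ℝ → ℤ × ℤ → ℂ} {v₁ v₂ v₃ : ℝ → ℤ → ℂ} {M₁ M₂ M₃ : ℝ}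
  (hγ : 1 / 2 < γ) (hK : 0 ≤ K) (hab : a < b) (hω : ∀ n, 0 ≤ ω n)
  (hc : IsCoeff a b c) (hY : YoungBound γ K a b ω c)
  (h₁ : HPath a b v₁) (h₂ : HPath a b v₂) (h₃ : HPath a b v₃)
  (b₁ : HBound γ a b ω M₁ v₁) (b₂ : HBound γ a b ω M₂ v₂) (b₃ : HBound γ a b ω M₃ v₃)
include hγ hK hab hω hc hY h₁ h₂ h₃ b₁ b₂ b₃

/-- The Young integral of a Hölder path is close to its germ. -/
theorem WBound_integral_tri_sub_germ {r t : ℝ} (hr : r ∈ Icc a b) (ht : t ∈ Icc a b) (hrt : r ≤ t) :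
    WBound ω (3 * K * (M₁ * M₂ * M₃) / (b - a) ^ γ / (1 - 2 ^ (1 - 2 * γ)) * (t - r) ^ (2 * γ))
      ((fun n => ∫ t' in r..t, tri (c t') (v₁ t') (v₂ t') (v₃ t') n) -
        tri (coeffInt c r t) (v₁ r) (v₂ r) (v₃ r)) := by
  intro S
  have hab' : 0 < b - a := by linarith
  have m₁ := (b₁.bdd r hr).nonneg
  have m₂ := (b₂.bdd r hr).nonneg
  have m₃ := (b₃.bdd r hr).nonneg
  have := wnorm_integral_tri_sub_le (c₂ := 0) (K := 0) (D := 3 * K * (M₁ * M₂ * M₃) / (b - a) ^ γ)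
    (θ := 2 * γ) hc hc (by simp) (by simp) h₁ h₂ h₃ hω S (by positivity) (by linarith)
    (fun r _ => by
      have : tri 0 (v₁ r) (v₂ r) (v₃ r) = 0 := by funext n; simp [tri]
      rw [this]; simp [wnorm]) ?_ hr ht hrt
  · simpa using this
  · intro r hr q hq t ht hrq hqt
    obtain ⟨N₁, -, p₁⟩ := h₁.bdd
    obtain ⟨N₂, -, p₂⟩ := h₂.bdd
    obtain ⟨N₃, -, p₃⟩ := h₃.bdd
    -- Each telescoped term has one Hölder increment and one averaged operator, hence size (q-r)^γ
    -- (t-q)^γ and total exponent 2γ > 1; the three terms account for the factor 3.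
    rw [tri_sub (p₁ q hq) (p₂ q hq) (p₃ q hq) (hc.norm_coeffInt_le q t) (p₁ r hr) (p₂ r hr) (p₃ r hr)]
    have i1 := hY q hq t ht hqt _ _ _ _ _ _ (b₁.holder r hr q hq hrq) (b₂.bdd q hq) (b₃.bdd q hq)
    have i2 := hY q hq t ht hqt _ _ _ _ _ _ (b₁.bdd r hr) (b₂.holder r hr q hq hrq) (b₃.bdd q hq)
    have i3 := hY q hq t ht hqt _ _ _ _ _ _ (b₁.bdd r hr) (b₂.bdd r hr) (b₃.holder r hr q hq hrq)
    refine (((i1.add i2).add i3) S).trans ?_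
    set x := ((q - r) / (b - a)) ^ γ
    calc _ = 3 * K * (M₁ * M₂ * M₃) * ((t - q) ^ γ * x) := by ring
      _ ≤ 3 * K * (M₁ * M₂ * M₃) * ((t - r) ^ γ * ((t - r) ^ γ / (b - a) ^ γ)) := by
          have e : x = (q - r) ^ γ / (b - a) ^ γ := Real.div_rpow (by linarith) hab'.le _
          rw [e]
          have : 0 ≤ q - r := by linarith
          have : 0 ≤ t - q := by linarith
          have : 0 ≤ t - r := by linarith
          gcongr
      _ = _ := by
          rw [two_mul γ, Real.rpow_add_of_nonneg (by linarith) (by linarith) (by linarith)]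
          ring

theorem WBound_integral_tri {r t : ℝ} (hr : r ∈ Icc a b) (ht : t ∈ Icc a b) (hrt : r ≤ t) :
    WBound ω (youngConst γ * K * (b - a) ^ γ * (M₁ * M₂ * M₃) * ((t - r) / (b - a)) ^ γ)
      (fun n => ∫ t' in r..t, tri (c t') (v₁ t') (v₂ t') (v₃ t') n) := by
  have hab' : 0 < b - a := by linarith
  have m₁ := (b₁.bdd r hr).nonneg
  have m₂ := (b₂.bdd r hr).nonneg
  have m₃ := (b₃.bdd r hr).nonneg
  have h2 : (2 : ℝ) ^ (1 - 2 * γ) < 1 := Real.rpow_lt_one_of_one_lt_of_neg one_lt_two (by linarith)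
  have h2' : 0 < 1 - (2 : ℝ) ^ (1 - 2 * γ) := by linarith
  have h := (WBound_integral_tri_sub_germ hγ hK hab hω hc hY h₁ h₂ h₃ b₁ b₂ b₃ hr ht hrt).add
    (hY r hr t ht hrt _ _ _ _ _ _ (b₁.bdd r hr) (b₂.bdd r hr) (b₃.bdd r hr))
  rw [sub_add_cancel] at h
  refine h.mono ?_
  have htr : 0 ≤ t - r := by linarith
  have hle : (t - r) ^ γ ≤ (b - a) ^ γ :=
    Real.rpow_le_rpow htr (by linarith [hr.1, ht.2]) (by linarith)
  have hbaγ : 0 < (b - a) ^ γ := by positivity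
  rw [Real.div_rpow htr hab'.le, two_mul γ, Real.rpow_add_of_nonneg htr (by linarith) (by linarith),
    ← two_mul γ, youngConst]
  set X := (t - r) ^ γ
  set Y := (b - a) ^ γ
  have hX : 0 ≤ X := Real.rpow_nonneg htr _
  have hXY : X / Y ≤ 1 := (div_le_one hbaγ).2 hle
  calc _ = 3 * K * (M₁ * M₂ * M₃) / (1 - 2 ^ (1 - 2 * γ)) * X * (X / Y) + K * X * (M₁ * M₂ * M₃) := by
        ring
    _ ≤ 3 * K * (M₁ * M₂ * M₃) / (1 - 2 ^ (1 - 2 * γ)) * X * 1 + K * X * (M₁ * M₂ * M₃) := by gcongr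
    _ = _ := by field_simp; ring

theorem HBound_integral_tri : HBound γ a b ω (youngConst γ * K * (b - a) ^ γ * (M₁ * M₂ * M₃))
      (fun t n => ∫ t' in a..t, tri (c t') (v₁ t') (v₂ t') (v₃ t') n) := by
  have hab' : 0 < b - a := by linarith
  have ha : a ∈ Icc a b := ⟨le_rfl, hab.le⟩
  have m₁ := (b₁.bdd a ha).nonneg
  have m₂ := (b₂.bdd a ha).nonneg
  have m₃ := (b₃.bdd a ha).nonneg
  have hY0 := youngConst_pos hγ
  constructor
  · intro t ht
    refine (WBound_integral_tri hγ hK hab hω hc hY h₁ h₂ h₃ b₁ b₂ b₃ ha ht ht.1).mono ?_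
    refine mul_le_of_le_one_right (by positivity) ?_
    refine Real.rpow_le_one (div_nonneg (by linarith [ht.1]) hab'.le) ?_ (by linarith)
    rw [div_le_one hab']; linarith [ht.2]
  · intro r hr t ht hrt
    have h := WBound_integral_tri hγ hK hab hω hc hY h₁ h₂ h₃ b₁ b₂ b₃ hr ht hrt
    convert h using 1
    funext n
    rw [Pi.sub_apply, sub_eq_iff_eq_add, add_comm, intervalIntegral.integral_add_adjacent_intervals
      (hc.intervalIntegrable_tri h₁ h₂ h₃ ha hr n) (hc.intervalIntegrable_tri h₁ h₂ h₃ hr ht n)]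

end

/-! ### The Young equation on sequences -/

theorem WBound.of_weight_le_mul {ω ω' : ℤ → ℝ} {M C : ℝ} {x : ℤ → ℂ} (hω : ∀ n, 0 ≤ ω n) (hC : 0 ≤ C)
    (h : ∀ n, ω n ≤ C * ω' n) (hx : WBound ω' M x) : WBound ω (C * M) x := by
  have h1 := hx.smul C
  rw [abs_of_nonneg hC] at h1
  refine h1.of_le hω fun n => ?_
  rw [norm_mul, Complex.norm_real, Real.norm_of_nonneg hC, ← mul_assoc, mul_comm _ C]
  exact mul_le_mul_of_nonneg_right (h n) (norm_nonneg _)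

namespace HBound

variable {γ a b M M' C : ℝ} {ω : ℤ → ℝ} {u v : ℝ → ℤ → ℂ}

theorem add (hu : HBound γ a b ω M u) (hv : HBound γ a b ω M' v) : HBound γ a b ω (M + M') (u + v) := by
  refine ⟨fun t ht => (hu.bdd t ht).add (hv.bdd t ht), fun r hr t ht hrt => ?_⟩
  have := (hu.holder r hr t ht hrt).add (hv.holder r hr t ht hrt)
  rw [← add_mul] at this
  convert this using 1
  simp only [Pi.add_apply]; abel

theorem sub (hu : HBound γ a b ω M u) (hv : HBound γ a b ω M' v) : HBound γ a b ω (M + M') (u - v) := by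
  refine ⟨fun t ht => (hu.bdd t ht).sub (hv.bdd t ht), fun r hr t ht hrt => ?_⟩
  have := (hu.holder r hr t ht hrt).sub (hv.holder r hr t ht hrt)
  rw [← add_mul] at this
  convert this using 1
  simp only [Pi.sub_apply]; abel

theorem mono (hu : HBound γ a b ω M u) (h : M ≤ M') : HBound γ a b ω M' u := by
  refine ⟨fun t ht => (hu.bdd t ht).mono h, fun r hr t ht hrt => (hu.holder r hr t ht hrt).mono ?_⟩
  refine mul_le_mul_of_nonneg_right h (Real.rpow_nonneg (div_nonneg (by linarith) ?_) _)
  linarith [hr.1, ht.2]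

theorem congr (hu : HBound γ a b ω M u) (h : ∀ t ∈ Icc a b, v t = u t) : HBound γ a b ω M v :=
  ⟨fun t ht => by rw [h t ht]; exact hu.bdd t ht,
    fun r hr t ht hrt => by rw [h t ht, h r hr]; exact hu.holder r hr t ht hrt⟩

theorem const {f : ℤ → ℂ} (hf : WBound ω M f) : HBound γ a b ω M (fun _ => f) := by
  refine ⟨fun t _ => hf, fun r hr t ht hrt => ?_⟩
  rw [sub_self]
  exact (WBound.zero ω).mono (mul_nonneg hf.nonneg (Real.rpow_nonneg
    (div_nonneg (by linarith) (by linarith [hr.1, ht.2])) _))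

theorem of_tendsto {V : ℕ → ℝ → ℤ → ℂ} {m : ℕ → ℝ} (hV : ∀ k, HBound γ a b ω (m k) (V k))
    (hv : ∀ t ∈ Icc a b, ∀ n, Filter.Tendsto (fun k => V k t n) Filter.atTop (nhds (v t n)))
    (hm : Filter.Tendsto m Filter.atTop (nhds M)) : HBound γ a b ω M v := by
  refine ⟨fun t ht => WBound.of_tendsto (hv t ht) hm (Filter.Eventually.of_forall fun k => (hV k).bdd t ht),
    fun r hr t ht hrt => WBound.of_tendsto (fun n => (hv t ht n).sub (hv r hr n))
      (hm.mul_const _) (Filter.Eventually.of_forall fun k => (hV k).holder r hr t ht hrt)⟩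

theorem of_holder {L : ℝ} (hab : a < b) (h1 : ∀ t ∈ Icc a b, WBound ω M (v t))
    (h2 : ∀ r ∈ Icc a b, ∀ t ∈ Icc a b, r ≤ t → WBound ω (L * (t - r) ^ γ) (v t - v r)) :
    HBound γ a b ω (max M (L * (b - a) ^ γ)) v := by
  refine ⟨fun t ht => (h1 t ht).mono (le_max_left _ _), fun r hr t ht hrt => (h2 r hr t ht hrt).mono ?_⟩
  have hab' : 0 < b - a := by linarith
  have : 0 ≤ t - r := by linarith
  calc L * (t - r) ^ γ = L * (b - a) ^ γ * ((t - r) / (b - a)) ^ γ := by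
        rw [Real.div_rpow this hab'.le]; field_simp
    _ ≤ _ := by gcongr; exact le_max_right _ _

theorem hpath (hγ : 0 < γ) (hab : a < b) (hC : 0 ≤ C) (hω : ∀ n, sobWeight (1 / 6) n ≤ C * ω n)
    (h : HBound γ a b ω M v) : HPath a b v := by
  have hab' : 0 < b - a := by linarith
  have hM : 0 ≤ M := (h.bdd a ⟨le_rfl, hab.le⟩).nonneg
  have hcv : ∀ {A : ℝ} {x : ℤ → ℂ}, WBound ω A x → WBound (sobWeight (1 / 6)) (C * A) x :=
    fun hx => hx.of_weight_le_mul (fun n => (sobWeight_pos _ n).le) hC hω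
  refine ⟨⟨C * M + 1, by positivity, fun t ht => (hcv (h.bdd t ht)).mono (by linarith)⟩,
    fun ε hε => ?_⟩
  have key : ∀ r ∈ Icc a b, ∀ t ∈ Icc a b, r ≤ t → t - r ≤ (b - a) * (ε / (C * M + 1)) ^ γ⁻¹ →
      WBound (sobWeight (1 / 6)) ε (v t - v r) := by
    intro r hr t ht hrt hd
    refine (hcv (h.holder r hr t ht hrt)).mono ?_
    have h1 : ((t - r) / (b - a)) ^ γ ≤ ε / (C * M + 1) := by
      rw [← Real.le_rpow_inv_iff_of_pos (div_nonneg (by linarith) hab'.le) (by positivity) hγ,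
        div_le_iff₀' hab']
      exact hd
    calc C * (M * ((t - r) / (b - a)) ^ γ) ≤ C * (M * (ε / (C * M + 1))) := by gcongr
      _ = ε * (C * M / (C * M + 1)) := by ring
      _ ≤ ε := mul_le_of_le_one_right hε.le ((div_le_one (by positivity)).2 (by linarith))
  refine ⟨(b - a) * (ε / (C * M + 1)) ^ γ⁻¹, by positivity, fun r hr t ht hd => ?_⟩
  rcases le_total r t with hrt | hrt
  · exact key r hr t ht hrt (by rwa [abs_of_nonneg (by linarith)] at hd)
  · have := (key t ht r hr hrt (by rwa [abs_of_nonpos (by linarith), neg_sub] at hd)).neg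
    rwa [neg_sub] at this

end HBound

section Contraction
variable {γ K a b : ℝ} {ω : ℤ → ℝ} {c : ℝ → ℤ × ℤ → ℂ} {u v : ℝ → ℤ → ℂ} {M m : ℝ}
  (hγ : 1 / 2 < γ) (hK : 0 ≤ K) (hab : a < b) (hω : ∀ n, 0 ≤ ω n)
  (hc : IsCoeff a b c) (hY : YoungBound γ K a b ω c)
include hγ hK hab hω hc hY

theorem HBound_integral_sub (hu : HPath a b u) (hv : HPath a b v) (bu : HBound γ a b ω M u)
    (bv : HBound γ a b ω M v) (bz : HBound γ a b ω m (u - v)) :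
    HBound γ a b ω (3 * (youngConst γ * K * (b - a) ^ γ) * M ^ 2 * m)
      (fun t n => (∫ t' in a..t, tri (c t') (u t') (u t') (u t') n) -
        ∫ t' in a..t, tri (c t') (v t') (v t') (v t') n) := by
  have hz := hu.sub hv
  have j1 := HBound_integral_tri hγ hK hab hω hc hY hz hu hu bz bu bu
  have j2 := HBound_integral_tri hγ hK hab hω hc hY hv hz hu bv bz bu
  have j3 := HBound_integral_tri hγ hK hab hω hc hY hv hv hz bv bv bz
  refine (((j1.add j2).add j3).mono (le_of_eq (by ring))).congr fun t ht => ?_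
  have ha : a ∈ Icc a b := ⟨le_rfl, hab.le⟩
  obtain ⟨A, -, pu⟩ := hu.bdd
  obtain ⟨B, -, pv⟩ := hv.bdd
  funext n
  simp only [Pi.add_apply]
  rw [← intervalIntegral.integral_sub (hc.intervalIntegrable_tri hu hu hu ha ht n)
    (hc.intervalIntegrable_tri hv hv hv ha ht n),
    ← intervalIntegral.integral_add (hc.intervalIntegrable_tri hz hu hu ha ht n)
    (hc.intervalIntegrable_tri hv hz hu ha ht n),
    ← intervalIntegral.integral_add ((hc.intervalIntegrable_tri hz hu hu ha ht n).add
      (hc.intervalIntegrable_tri hv hz hu ha ht n)) (hc.intervalIntegrable_tri hv hv hz ha ht n)]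
  refine intervalIntegral.integral_congr fun t' ht' => ?_
  have ht' := uIcc_subset_Icc ha ht ht'
  exact congrFun (tri_sub (pu t' ht') (pu t' ht') (pu t' ht') (hc.norm_le t') (pv t' ht')
    (pv t' ht') (pv t' ht')) n

end Contraction

/-- A mild solution on the Fourier side, in the interaction picture. -/
structure IsMild (a b : ℝ) (c : ℝ → ℤ × ℤ → ℂ) (v : ℝ → ℤ → ℂ) : Prop where
  path : HPath a b v
  eq : ∀ t ∈ Icc a b, ∀ n, v t n = v a n + ∫ t' in a..t, tri (c t') (v t') (v t') (v t') n

theorem IsMild.sub_eq {a b : ℝ} {c : ℝ → ℤ × ℤ → ℂ} {v : ℝ → ℤ → ℂ} (hc : IsCoeff a b c)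
    (h : IsMild a b c v) {r t : ℝ} (hr : r ∈ Icc a b) (ht : t ∈ Icc a b) :
    v t - v r = fun n => ∫ t' in r..t, tri (c t') (v t') (v t') (v t') n := by
  have ha : a ∈ Icc a b := ⟨le_rfl, hr.1.trans hr.2⟩
  funext n
  rw [Pi.sub_apply, h.eq t ht n, h.eq r hr n, ← intervalIntegral.integral_add_adjacent_intervals
    (hc.intervalIntegrable_tri h.path h.path h.path ha hr n)
    (hc.intervalIntegrable_tri h.path h.path h.path hr ht n)]
  ring

theorem IsMild.mono {a b : ℝ} {c : ℝ → ℤ × ℤ → ℂ} {v : ℝ → ℤ → ℂ} (hc : IsCoeff a b c)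
    (h : IsMild a b c v) {a' b' : ℝ} (ha : a ≤ a') (hab : a' ≤ b') (hb : b' ≤ b) :
    IsMild a' b' c v := by
  have hsub : Icc a' b' ⊆ Icc a b := Icc_subset_Icc ha hb
  refine ⟨h.path.mono hsub, fun t ht n => ?_⟩
  have := congrFun (h.sub_eq hc (hsub ⟨le_rfl, hab⟩) (hsub ht)) n
  rw [Pi.sub_apply] at this
  rw [← this]; ring

/-- Uniqueness on a short interval for Hölder continuous mild solutions. -/
theorem IsMild.eqOn_of_short {γ K a b : ℝ} {ω : ℤ → ℝ} {c : ℝ → ℤ × ℤ → ℂ} {u v : ℝ → ℤ → ℂ} {M : ℝ}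
    (hγ : 1 / 2 < γ) (hK : 0 ≤ K) (hab : a < b) (hω : ∀ n, 1 ≤ ω n)
    (hc : IsCoeff a b c) (hY : YoungBound γ K a b ω c)
    (hu : IsMild a b c u) (hv : IsMild a b c v) (bu : HBound γ a b ω M u) (bv : HBound γ a b ω M v)
    (hshort : 3 * (youngConst γ * K * (b - a) ^ γ) * M ^ 2 ≤ 1 / 2) (h0 : u a = v a) :
    EqOn u v (Icc a b) := by
  have hM : 0 ≤ M := (bu.bdd a ⟨le_rfl, hab.le⟩).nonneg
  -- Start from the crude bound 2M; each substitution into the equation halves the norm of the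
  -- difference.
  have key : ∀ k : ℕ, HBound γ a b ω (2 * M / 2 ^ k) (u - v) := by
    intro k
    induction k with
    | zero => simpa [two_mul] using bu.sub bv
    | succ k ih =>
      have h := HBound_integral_sub hγ hK hab (fun n => zero_le_one.trans (hω n)) hc hY hu.path hv.path
        bu bv ih
      refine (h.congr fun t ht => ?_).mono ?_
      · funext n
        rw [Pi.sub_apply, Pi.sub_apply, hu.eq t ht n, hv.eq t ht n, h0]
        ring
      · calc _ ≤ 1 / 2 * (2 * M / 2 ^ k) := by gcongr
          _ = _ := by rw [pow_succ]; field_simp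
  intro t ht
  funext n
  have h1 : ∀ k : ℕ, ‖u t n - v t n‖ ≤ 2 * M * (1 / 2) ^ k := fun k => by
    have := ((key k).bdd t ht).norm_le hω n
    rw [one_div, inv_pow, ← div_eq_mul_inv]
    exact this
  have h2 : Filter.Tendsto (fun k : ℕ => 2 * M * (1 / 2 : ℝ) ^ k) Filter.atTop (nhds 0) := by
    simpa using (tendsto_pow_atTop_nhds_zero_of_lt_one (by norm_num : (0:ℝ) ≤ 1 / 2)
      (by norm_num)).const_mul (2 * M)
  have h3 := ge_of_tendsto' h2 h1
  exact sub_eq_zero.1 (norm_le_zero_iff.1 h3)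

/-- Local existence by Picard iteration. -/
theorem exists_isMild_short {γ K a b : ℝ} {ω : ℤ → ℝ} {c : ℝ → ℤ × ℤ → ℂ} {M C : ℝ}
    (hγ : 1 / 2 < γ) (hK : 0 ≤ K) (hab : a < b) (hω : ∀ n, 1 ≤ ω n) (hC : 0 ≤ C)
    (hωC : ∀ n, sobWeight (1 / 6) n ≤ C * ω n)
    (hc : IsCoeff a b c) (hY : YoungBound γ K a b ω c) {f : ℤ → ℂ} (hf : WBound ω M f)
    (hshort : 24 * (youngConst γ * K * (b - a) ^ γ) * M ^ 2 ≤ 1) :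
    ∃ v, v a = f ∧ IsMild a b c v ∧ HBound γ a b ω (2 * M) v := by
  have hM : 0 ≤ M := hf.nonneg
  have hω0 : ∀ n, 0 ≤ ω n := fun n => zero_le_one.trans (hω n)
  have hγ0 : 0 < γ := by linarith
  have ha : a ∈ Icc a b := ⟨le_rfl, hab.le⟩
  have hab' : 0 < b - a := by linarith
  set κ := youngConst γ * K * (b - a) ^ γ with hκ
  have hκ0 : 0 ≤ κ := by have := youngConst_pos hγ; positivity
  set G : (ℝ → ℤ → ℂ) → ℝ → ℤ → ℂ := fun v t n =>
    f n + ∫ t' in a..t, tri (c t') (v t') (v t') (v t') n with hG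
  set V : ℕ → ℝ → ℤ → ℂ := fun k => G^[k] (fun _ => f) with hVdef
  have hVs : ∀ k, V (k + 1) = G (V k) := fun k => Function.iterate_succ_apply' G k _
  have hpath : ∀ {m : ℝ} {v : ℝ → ℤ → ℂ}, HBound γ a b ω m v → HPath a b v := fun h =>
    h.hpath hγ0 hab hC hωC
  have hconst : HBound γ a b ω M (fun _ => f) := HBound.const hf
  have hGb : ∀ v, HBound γ a b ω (2 * M) v → HBound γ a b ω (2 * M) (G v) := by
    intro v hv
    have h := HBound_integral_tri hγ hK hab hω0 hc hY (hpath hv) (hpath hv) (hpath hv) hv hv hv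
    refine (hconst.add h).mono ?_
    -- Invariance of the ball of radius 2M needs 8κM² ≤ 1, and the factor 1/2 in `hGd` needs 3κ(2M)²
    -- = 12κM² ≤ 1/2; the constant 24 covers both.
    have : 8 * κ * M ^ 2 * M ≤ 1 * M := by gcongr; nlinarith [mul_nonneg hκ0 (sq_nonneg M)]
    calc M + κ * (2 * M * (2 * M) * (2 * M)) = M + 8 * κ * M ^ 2 * M := by ring
      _ ≤ _ := by linarith
  have hGd : ∀ u v m, HBound γ a b ω (2 * M) u → HBound γ a b ω (2 * M) v → 0 ≤ m →
      HBound γ a b ω m (u - v) → HBound γ a b ω (m / 2) (G u - G v) := by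
    intro u v m hu hv hm hz
    have h := HBound_integral_sub hγ hK hab hω0 hc hY (hpath hu) (hpath hv) hu hv hz
    refine (h.congr fun t _ => ?_).mono ?_
    · funext n
      simp only [hG, Pi.sub_apply]; ring
    · calc 3 * κ * (2 * M) ^ 2 * m = (24 * κ * M ^ 2) * (m / 2) := by ring
        _ ≤ 1 * (m / 2) := by gcongr
        _ = _ := one_mul _
  have hVb : ∀ k, HBound γ a b ω (2 * M) (V k) := by
    intro k
    induction k with
    | zero => exact hconst.mono (by linarith)
    | succ k ih => rw [hVs]; exact hGb _ ih
  have hVd : ∀ k, HBound γ a b ω (4 * M / 2 ^ k) (V (k + 1) - V k) := by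
    intro k
    induction k with
    | zero => exact ((hVb 1).sub (hVb 0)).mono (by simp; linarith)
    | succ k ih =>
      rw [hVs (k + 1)]
      nth_rewrite 2 [hVs k]
      exact (hGd _ _ _ (hVb _) (hVb _) (by positivity) ih).mono
        (le_of_eq (by rw [pow_succ]; field_simp))
  -- The geometric tail is kept in closed form so that j → ∞ gives the distance 8M/2^k from the
  -- limit to the k-th iterate.
  have hVm : ∀ k j, HBound γ a b ω (8 * M / 2 ^ k * (1 - (1 / 2) ^ j)) (V (k + j) - V k) := by
    intro k j
    induction j with
    | zero =>
      have h := HBound.const (γ := γ) (a := a) (b := b) (WBound.zero ω)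
      refine (h.congr fun t _ => by simp).mono (by simp)
    | succ j ih =>
      refine (((hVd (k + j)).add ih).congr fun t _ => ?_).mono (le_of_eq ?_)
      · simp only [Pi.add_apply, Pi.sub_apply, add_assoc]; abel
      · rw [pow_add, pow_succ, one_div, inv_pow]; field_simp; ring
  have hlim : ∀ t ∈ Icc a b, ∀ n, ∃ l, Filter.Tendsto (fun k => V k t n) Filter.atTop (nhds l) := by
    intro t ht n
    refine cauchySeq_tendsto_of_complete (cauchySeq_of_le_geometric (1 / 2) (4 * M) (by norm_num) ?_)
    intro k
    rw [dist_comm, dist_eq_norm, one_div, inv_pow, ← div_eq_mul_inv]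
    exact ((hVd k).bdd t ht).norm_le hω n
  classical
  set v : ℝ → ℤ → ℂ := fun t n => if ht : t ∈ Icc a b then (hlim t ht n).choose else 0 with hv
  have hvlim : ∀ t ∈ Icc a b, ∀ n, Filter.Tendsto (fun k => V k t n) Filter.atTop (nhds (v t n)) := by
    intro t ht n
    simp only [hv, dif_pos ht]
    exact (hlim t ht n).choose_spec
  have bv : HBound γ a b ω (2 * M) v := HBound.of_tendsto hVb hvlim tendsto_const_nhds
  have bd : ∀ k, HBound γ a b ω (8 * M / 2 ^ k) (v - V k) := by
    intro k
    refine HBound.of_tendsto (hVm k) (fun t ht n => ?_) ?_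
    · refine Filter.Tendsto.sub ?_ tendsto_const_nhds
      have := (Filter.tendsto_add_atTop_iff_nat k).2 (hvlim t ht n)
      simpa only [add_comm] using this
    · have := (tendsto_pow_atTop_nhds_zero_of_lt_one (by norm_num : (0:ℝ) ≤ 1 / 2) (by norm_num))
      simpa using (this.const_sub 1).const_mul (8 * M / 2 ^ k)
  have hfix : ∀ t ∈ Icc a b, ∀ n, v t n = G v t n := by
    intro t ht n
    refine tendsto_nhds_unique ((Filter.tendsto_add_atTop_iff_nat 1).2 (hvlim t ht n)) ?_
    rw [tendsto_iff_norm_sub_tendsto_zero]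
    have h2 : Filter.Tendsto (fun k : ℕ => 4 * M * (1 / 2 : ℝ) ^ k) Filter.atTop (nhds 0) := by
      simpa using (tendsto_pow_atTop_nhds_zero_of_lt_one (by norm_num : (0:ℝ) ≤ 1 / 2)
        (by norm_num)).const_mul (4 * M)
    refine squeeze_zero (fun _ => norm_nonneg _) (fun k => ?_) h2
    rw [hVs, norm_sub_rev]
    refine (((hGd _ _ _ bv (hVb k) (by positivity) (bd k)).bdd t ht).norm_le hω n).trans (le_of_eq ?_)
    rw [one_div, inv_pow]; field_simp; ring
  have hva : v a = f := by
    funext n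
    rw [hfix a ha n]
    simp [hG]
  refine ⟨v, hva, ⟨hpath bv, fun t ht n => ?_⟩, bv⟩
  rw [hva]
  exact hfix t ht n

/-! ### Conservation of the `ℓ²` norm -/

/-- The cancellation behind the conservation of the `ℓ²` norm. -/
theorem hasSum_conj_mul_tri {ρ : ℝ} (hρ : 2 / 3 < ρ) {c : ℤ × ℤ → ℂ} {D : ℝ}
    (hc : ∀ p, ‖c p‖ ≤ D * resKernel ρ p) (hsym : ∀ j k, c (-j, k) = -(starRingEnd ℂ) (c (j, k)))
    {x : ℤ → ℂ} {M : ℝ} (hx : WBound (fun _ => 1) M x) :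
    ∃ Q : ℂ, Q.re = 0 ∧ HasSum (fun n => (starRingEnd ℂ) (x n) * tri c x x x n) Q := by
  obtain ⟨K, -, hK⟩ := exists_tsum_posTri_resKernel_le hρ
  set F : ℤ × (ℤ × ℤ) → ℂ := fun q => (starRingEnd ℂ) (x q.1) *
    (c q.2 * (x (q.1 + q.2.1) * (starRingEnd ℂ) (x (q.1 + q.2.1 + q.2.2)) * x (q.1 + q.2.2))) with hF
  -- Absolute convergence over all quadruples, from Cauchy–Schwarz and the ℓ² trilinear bound; it
  -- justifies the relabelling below.
  have hsum : ∑' q, ‖F q‖ₑ ≠ ⊤ := by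
    have h1 : ∑' q, ‖F q‖ₑ ≤ ENNReal.ofReal D * ∑' n, ‖x n‖ₑ *
        posTri (fun p => ENNReal.ofReal (resKernel ρ p)) (fun n => ‖x n‖ₑ) (fun n => ‖x n‖ₑ)
          (fun n => ‖x n‖ₑ) n := by
      rw [ENNReal.tsum_prod', ← ENNReal.tsum_mul_left]
      refine ENNReal.tsum_le_tsum fun n => ?_
      rw [posTri, ← ENNReal.tsum_mul_left, ← ENNReal.tsum_mul_left]
      refine ENNReal.tsum_le_tsum fun p => ?_
      have h2 : ‖c p‖ₑ ≤ ENNReal.ofReal D * ENNReal.ofReal (resKernel ρ p) := by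
        rw [← ENNReal.ofReal_mul' (resKernel_nonneg ρ p), ← ofReal_norm]
        exact ENNReal.ofReal_le_ofReal (hc p)
      simp only [hF, enorm_mul, RCLike.enorm_conj]
      calc _ ≤ ‖x n‖ₑ * ((ENNReal.ofReal D * ENNReal.ofReal (resKernel ρ p)) *
          (‖x (n + p.1)‖ₑ * ‖x (n + p.1 + p.2)‖ₑ * ‖x (n + p.2)‖ₑ)) := by gcongr
        _ = _ := by ring
    refine ne_top_of_le_ne_top (ENNReal.mul_ne_top ENNReal.ofReal_ne_top ?_) h1
    have h3 := ennreal_tsum_mul_sq_le (fun n => ‖x n‖ₑ)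
      (posTri (fun p => ENNReal.ofReal (resKernel ρ p)) (fun n => ‖x n‖ₑ) (fun n => ‖x n‖ₑ)
          (fun n => ‖x n‖ₑ))
    have h4 := hx.tsum_enorm_le
    have h5 : (∑' n, ‖x n‖ₑ ^ 2) ≠ ⊤ := ne_top_of_le_ne_top (by simp) h4
    have h6 := (hK (fun n => ‖x n‖ₑ) (fun n => ‖x n‖ₑ) (fun n => ‖x n‖ₑ))
    have h7 := ne_top_of_le_ne_top (ENNReal.mul_ne_top (by simp) (ENNReal.mul_ne_top
      (ENNReal.mul_ne_top h5 h5) h5)) h6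
    have h8 := ne_top_of_le_ne_top (ENNReal.mul_ne_top h5 h7) h3
    intro h9
    rw [h9] at h8
    simp at h8
  have hFs : Summable F := by
    have : Summable fun q => ‖F q‖ := (ENNReal.summable_toReal hsum).congr fun q => by simp
    exact this.of_norm
  refine ⟨∑' q, F q, ?_, ?_⟩
  · let E : ℤ × ℤ × ℤ ≃ ℤ × ℤ × ℤ :=
      { toFun := fun q => (q.1 + q.2.1, -q.2.1, q.2.2)
        invFun := fun q => (q.1 + q.2.1, -q.2.1, q.2.2)
        left_inv := fun q => by simp
        right_inv := fun q => by simp }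
    have h1 : ∑' q, F q = -(starRingEnd ℂ) (∑' q, F q) := by
      nth_rewrite 1 [← E.tsum_eq]
      rw [Complex.conj_tsum, ← tsum_neg]
      refine tsum_congr fun q => ?_
      simp only [hF, E, Equiv.coe_fn_mk, hsym, add_neg_cancel_right, map_mul, Complex.conj_conj]
      rw [show q.1 + q.2.1 + q.2.2 = q.1 + q.2.1 + q.2.2 by rfl]
      ring
    have h2 := congrArg Complex.re h1
    rw [Complex.neg_re, Complex.conj_re] at h2
    linarith
  · have h1 := hFs.hasSum.prod_fiberwise (fun n => (hFs.prod_factor n).hasSum)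
    refine h1.congr_fun fun n => ?_
    rw [tri, ← tsum_mul_left]

/-- The time integrals of the nonlinearity do no work on the `ℓ²` norm. -/
def EnergyNeutral (a b : ℝ) (c : ℝ → ℤ × ℤ → ℂ) : Prop :=
  ∀ r ∈ Icc a b, ∀ t ∈ Icc a b, r ≤ t → ∀ x M, WBound (fun _ => 1) M x →
    ∃ Q : ℂ, Q.re = 0 ∧ HasSum (fun n => (starRingEnd ℂ) (x n) * tri (coeffInt c r t) x x x n) Q

/-- A function with increments of order larger than 1 is constant; this is the sewing bound with
zero defect and arbitrarily small ε. -/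
theorem eq_of_abs_sub_le_rpow {a b C θ : ℝ} (hC : 0 ≤ C) (hθ : 1 < θ) {E : ℝ → ℝ}
    (h : ∀ r ∈ Icc a b, ∀ t ∈ Icc a b, r ≤ t → |E t - E r| ≤ C * (t - r) ^ θ) {t : ℝ}
    (ht : t ∈ Icc a b) : E t = E a := by
  have ha : a ∈ Icc a b := ⟨le_rfl, ht.1.trans ht.2⟩
  have key : ∀ ε > 0, |E t - E a| ≤ ε * (t - a) := by
    intro ε hε
    -- For t - r ≤ δ one has C(t-r)^{θ-1} ≤ ε; the summand 1 avoids division by zero.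
    set δ := (ε / (C + 1)) ^ (θ - 1)⁻¹ with hδ
    have h1 := sewing_bound (a := a) (b := b) (D := 0) (θ := θ) (ε := ε) (δ := δ)
      (P := fun r t => |E t - E r|) le_rfl hθ (by positivity) (fun r _ t _ _ => ?_)
      (fun r hr t ht hrt hd => ?_) ha ht ht.1
    · simpa using h1
    · rw [zero_mul, add_zero, add_comm]
      exact abs_sub_le _ _ _
    · rcases hrt.eq_or_lt with rfl | hlt
      · simp
      refine (h r hr t ht hrt).trans ?_
      have h2 : 0 < t - r := by linarith
      have h3 : (t - r) ^ (θ - 1) ≤ ε / (C + 1) := by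
        rw [← Real.le_rpow_inv_iff_of_pos h2.le (by positivity) (by linarith)]
        exact hd
      have h4 : (t - r) ^ θ = (t - r) ^ (θ - 1) * (t - r) := by
        rw [← Real.rpow_add_one h2.ne']; norm_num
      rw [h4]
      calc C * ((t - r) ^ (θ - 1) * (t - r)) ≤ (C + 1) * (ε / (C + 1) * (t - r)) := by
            gcongr; linarith
        _ = _ := by field_simp
  have h0 : |E t - E a| ≤ 0 := by
    refine le_of_forall_pos_le_add fun ε hε => ?_
    have := key (ε / (t - a + 1)) (div_pos hε (by linarith [ht.1]))
    refine this.trans ?_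
    rw [zero_add, div_mul_eq_mul_div, div_le_iff₀ (by linarith [ht.1])]
    nlinarith [ht.1]
  linarith [abs_nonpos_iff.1 h0]

theorem sum_conj_mul_le (S : Finset ℤ) (x y : ℤ → ℂ) :
    ‖∑ n ∈ S, (starRingEnd ℂ) (x n) * y n‖ ≤ wnorm (fun _ => 1) S x * wnorm (fun _ => 1) S y := by
  refine (norm_sum_le _ _).trans ?_
  simp only [norm_mul, RCLike.norm_conj]
  have h := Finset.sum_mul_sq_le_sq_mul_sq S (fun n => ‖x n‖) (fun n => ‖y n‖)
  refine le_of_sq_le_sq ?_ (mul_nonneg (wnorm_nonneg _ _ _) (wnorm_nonneg _ _ _))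
  rw [mul_pow, wnorm_sq, wnorm_sq]
  simpa using h

/-- Over [r,t] the squared norm changes by twice the real part of the pairing of v(r) with the germ,
which vanishes by neutrality, plus O((t-r)^{2γ}). As 2γ > 1, the norm is constant. -/
theorem IsMild.tsum_norm_sq_eq {γ K a b M : ℝ} {c : ℝ → ℤ × ℤ → ℂ} {v : ℝ → ℤ → ℂ}
    (hγ : 1 / 2 < γ) (hK : 0 ≤ K) (hab : a < b) (hc : IsCoeff a b c)
    (hY : YoungBound γ K a b (fun _ => 1) c) (hE : EnergyNeutral a b c) (hv : IsMild a b c v)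
    (bv : HBound γ a b (fun _ => 1) M v) {t : ℝ} (ht : t ∈ Icc a b) :
    ∑' n, ‖v t n‖ ^ 2 = ∑' n, ‖v a n‖ ^ 2 := by
  have hab' : 0 < b - a := by linarith
  have hM : 0 ≤ M := (bv.bdd t ht).nonneg
  have h2 : (2 : ℝ) ^ (1 - 2 * γ) < 1 := Real.rpow_lt_one_of_one_lt_of_neg one_lt_two (by linarith)
  have h2' : 0 < 1 - (2 : ℝ) ^ (1 - 2 * γ) := by linarith
  set C₁ := 3 * K * (M * M * M) / (b - a) ^ γ / (1 - 2 ^ (1 - 2 * γ))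
  have hC₁ : 0 ≤ C₁ := by positivity
  set C₂ := (M / (b - a) ^ γ) ^ 2
  have hC₂ : 0 ≤ C₂ := by positivity
  refine eq_of_abs_sub_le_rpow (E := fun t => ∑' n, ‖v t n‖ ^ 2) (C := 2 * (M * C₁) + C₂)
    (θ := 2 * γ) (by positivity) (by linarith) (fun r hr t ht hrt => ?_) ht
  have htr : 0 ≤ t - r := by linarith
  set X := tri (coeffInt c r t) (v r) (v r) (v r)
  set R := v t - v r - X with hR
  have hRb : WBound (fun _ => 1) (C₁ * (t - r) ^ (2 * γ)) R := by
    rw [hR, hv.sub_eq hc hr ht]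
    exact WBound_integral_tri_sub_germ hγ hK hab (fun _ => zero_le_one) hc hY hv.path hv.path hv.path
      bv bv bv hr ht hrt
  obtain ⟨Q, hQ, hQs⟩ := hE r hr t ht hrt _ _ (bv.bdd r hr)
  have hs : ∀ t ∈ Icc a b, HasSum (fun n => ‖v t n‖ ^ 2) (∑' n, ‖v t n‖ ^ 2) := fun t ht => by
    have := (bv.bdd t ht).summable
    simp only [one_mul] at this
    exact this.hasSum
  have hlim : Filter.Tendsto (fun S : Finset ℤ => |∑ n ∈ S, ‖v t n‖ ^ 2 - ∑ n ∈ S, ‖v r n‖ ^ 2 -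
      2 * (∑ n ∈ S, (starRingEnd ℂ) (v r n) * X n).re|) Filter.atTop
      (nhds |∑' n, ‖v t n‖ ^ 2 - ∑' n, ‖v r n‖ ^ 2 - 2 * Q.re|) :=
    (((hs t ht).sub (hs r hr)).congr (fun S => by simp) |>.sub
      ((Complex.continuous_re.tendsto Q).comp hQs |>.const_mul 2)).abs
  rw [hQ, mul_zero, sub_zero] at hlim
  refine le_of_tendsto' hlim fun S => ?_
  -- Expand the square of v(t) = v(r) + X + R, keeping the full increment in the quadratic term. The
  -- pairing with X cancels only after summing over all frequencies, hence the limit over `S`.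
  have hid : ∑ n ∈ S, ‖v t n‖ ^ 2 - ∑ n ∈ S, ‖v r n‖ ^ 2 -
      2 * (∑ n ∈ S, (starRingEnd ℂ) (v r n) * X n).re =
      2 * (∑ n ∈ S, (starRingEnd ℂ) (v r n) * R n).re + wnorm (fun _ => 1) S (v t - v r) ^ 2 := by
    rw [wnorm_sq, Complex.re_sum, Complex.re_sum, Finset.mul_sum, Finset.mul_sum,
      ← Finset.sum_sub_distrib, ← Finset.sum_sub_distrib, ← Finset.sum_add_distrib]
    refine Finset.sum_congr rfl fun n _ => ?_
    simp only [hR, Pi.sub_apply, one_mul, Complex.sq_norm, Complex.normSq_apply, Complex.mul_re,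
      Complex.conj_re, Complex.conj_im, Complex.sub_re, Complex.sub_im]
    ring
  rw [hid]
  have e1 : |(∑ n ∈ S, (starRingEnd ℂ) (v r n) * R n).re| ≤ M * (C₁ * (t - r) ^ (2 * γ)) := by
    refine ((Complex.abs_re_le_norm _).trans (sum_conj_mul_le S _ _)).trans ?_
    exact mul_le_mul (bv.bdd r hr S) (hRb S) (wnorm_nonneg _ _ _) hM
  have e2 : wnorm (fun _ => 1) S (v t - v r) ^ 2 ≤ C₂ * (t - r) ^ (2 * γ) := by
    refine (pow_le_pow_left₀ (wnorm_nonneg _ _ _) (bv.holder r hr t ht hrt S) 2).trans (le_of_eq ?_)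
    rw [Real.div_rpow htr hab'.le, mul_comm 2 γ, Real.rpow_mul htr, Real.rpow_two]
    simp only [C₂]; field_simp
  calc _ ≤ |2 * (∑ n ∈ S, (starRingEnd ℂ) (v r n) * R n).re| + |wnorm (fun _ => 1) S (v t - v r) ^ 2| :=
        abs_add_le _ _
    _ ≤ 2 * (M * (C₁ * (t - r) ^ (2 * γ))) + C₂ * (t - r) ^ (2 * γ) := by
        rw [abs_mul, abs_two, abs_of_nonneg (sq_nonneg (wnorm _ _ _))]
        gcongr
    _ = _ := by ring

theorem WBound_one_iff {m : ℝ} (hm : 0 ≤ m) {x : ℤ → ℂ} (hx : Summable fun n => ‖x n‖ ^ 2) :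
    WBound (fun _ => 1) m x ↔ ∑' n, ‖x n‖ ^ 2 ≤ m ^ 2 := by
  have e : ∀ S, wnorm (fun _ => 1) S x ≤ m ↔ ∑ n ∈ S, ‖x n‖ ^ 2 ≤ m ^ 2 := fun S => by
    rw [← sq_le_sq₀ (wnorm_nonneg _ _ _) hm, wnorm_sq]; simp
  simp only [WBound, e]
  exact ⟨fun h => hx.tsum_le_of_sum_le h, fun h S => (hx.sum_le_tsum S fun _ _ => sq_nonneg _).trans h⟩

/-- Conservation of the `ℓ²` bound. -/
theorem IsMild.wbound_one {γ K a b M m : ℝ} {c : ℝ → ℤ × ℤ → ℂ} {v : ℝ → ℤ → ℂ}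
    (hγ : 1 / 2 < γ) (hK : 0 ≤ K) (hab : a < b) (hc : IsCoeff a b c)
    (hY : YoungBound γ K a b (fun _ => 1) c) (hE : EnergyNeutral a b c) (hv : IsMild a b c v)
    (bv : HBound γ a b (fun _ => 1) M v) (h0 : WBound (fun _ => 1) m (v a)) {t : ℝ}
    (ht : t ∈ Icc a b) : WBound (fun _ => 1) m (v t) := by
  have hs : ∀ t ∈ Icc a b, Summable fun n => ‖v t n‖ ^ 2 := fun t ht => by
    simpa only [one_mul] using (bv.bdd t ht).summable
  rw [WBound_one_iff h0.nonneg (hs t ht), hv.tsum_norm_sq_eq hγ hK hab hc hY hE bv ht]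
  exact (WBound_one_iff h0.nonneg (hs a ⟨le_rfl, hab.le⟩)).1 h0

/-! ### Long times -/

theorem exists_nat_mul_rpow_le {γ T : ℝ} (hγ : 0 < γ) (X : ℝ) {ε : ℝ} (hε : 0 < ε) :
    ∃ N : ℕ, 0 < N ∧ X * (T / N) ^ γ ≤ ε := by
  have h1 : Filter.Tendsto (fun N : ℕ => X * (T / N) ^ γ) Filter.atTop (nhds (X * 0 ^ γ)) :=
    ((tendsto_const_div_atTop_nhds_zero_nat T).rpow_const (Or.inr hγ.le)).const_mul X
  rw [Real.zero_rpow hγ.ne', mul_zero] at h1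
  obtain ⟨N, hN, hN0⟩ := ((h1.eventually (gt_mem_nhds hε)).and (Filter.eventually_gt_atTop 0)).exists
  exact ⟨N, hN0, hN.le⟩

theorem HBound.restrict {γ a b a' b' M : ℝ} {ω : ℤ → ℝ} {v : ℝ → ℤ → ℂ} (hγ : 0 ≤ γ)
    (h : HBound γ a b ω M v) (ha : a ≤ a') (hab : a' < b') (hb : b' ≤ b) : HBound γ a' b' ω M v := by
  have hsub : Icc a' b' ⊆ Icc a b := Icc_subset_Icc ha hb
  refine ⟨fun t ht => h.bdd t (hsub ht), fun r hr t ht hrt =>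
    (h.holder r (hsub hr) t (hsub ht) hrt).mono ?_⟩
  have hM : 0 ≤ M := (h.bdd r (hsub hr)).nonneg
  have : 0 < b' - a' := by linarith
  have : 0 ≤ t - r := by linarith
  have : 0 ≤ (t - r) / (b - a) := div_nonneg this (by linarith)
  gcongr

/-- Uniqueness of Hölder continuous mild solutions. -/
theorem IsMild.eqOn {γ K T : ℝ} {ω : ℤ → ℝ} {c : ℝ → ℤ × ℤ → ℂ} {u v : ℝ → ℤ → ℂ} {M : ℝ}
    (hγ : 1 / 2 < γ) (hK : 0 ≤ K) (hT : 0 < T) (hω : ∀ n, 1 ≤ ω n)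
    (hc : IsCoeff 0 T c) (hY : YoungBound γ K 0 T ω c)
    (hu : IsMild 0 T c u) (hv : IsMild 0 T c v) (bu : HBound γ 0 T ω M u) (bv : HBound γ 0 T ω M v)
    (h0 : u 0 = v 0) : EqOn u v (Icc 0 T) := by
  obtain ⟨N, hN, hsmall⟩ := exists_nat_mul_rpow_le (T := T) (by linarith : 0 < γ)
    (3 * (youngConst γ * K) * M ^ 2) (ε := 1 / 2) (by norm_num)
  have hN' : (0 : ℝ) < N := Nat.cast_pos.2 hN
  set τ := T / N with hτ
  have hτ0 : 0 < τ := by positivity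
  have hNτ : N * τ = T := by rw [hτ]; field_simp
  have key : ∀ k : ℕ, k ≤ N → EqOn u v (Icc 0 (k * τ)) := by
    intro k
    induction k with
    | zero =>
      intro _ t ht
      simp only [Nat.cast_zero, zero_mul, Icc_self, mem_singleton_iff] at ht
      rw [ht, h0]
    | succ k ih =>
      intro hk
      have hk' : ((k + 1 : ℕ) : ℝ) * τ ≤ T := by
        rw [← hNτ]
        exact mul_le_mul_of_nonneg_right (Nat.cast_le.2 hk) hτ0.le
      have hk0 : (0 : ℝ) ≤ k * τ := by positivity
      have hlt : (k : ℝ) * τ < ((k + 1 : ℕ) : ℝ) * τ := by push_cast; linarith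
      have hsub := Icc_subset_Icc hk0 hk'
      have heq := ih (by omega)
      have hlen : ((k + 1 : ℕ) : ℝ) * τ - k * τ = τ := by push_cast; ring
      have := IsMild.eqOn_of_short hγ hK hlt hω (hc.mono hsub) (hY.mono hsub)
        (hu.mono hc hk0 hlt.le hk') (hv.mono hc hk0 hlt.le hk')
        (bu.restrict (by linarith) hk0 hlt hk') (bv.restrict (by linarith) hk0 hlt hk')
        (by rw [hlen]; linarith) (heq ⟨hk0, le_rfl⟩)
      intro t ht
      rcases le_total t (k * τ) with h | h
      · exact heq ⟨ht.1, h⟩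
      · exact this ⟨h, ht.2⟩
  have := key N le_rfl
  rwa [hNτ] at this

theorem WBound.add_weight {ω ω' : ℤ → ℝ} {M M' δ : ℝ} {x : ℤ → ℂ} (hδ : 0 ≤ δ) (h : WBound ω M x)
    (h' : WBound ω' M' x) : WBound (fun n => ω n + δ * ω' n) (M + δ * M') x := by
  intro S
  refine le_trans ?_ (add_le_add (h S) (mul_le_mul_of_nonneg_left (h' S) hδ))
  rw [wnorm_eq_norm, wnorm_eq_norm, wnorm_eq_norm, ← Real.norm_of_nonneg hδ, ← norm_smul]
  refine le_trans (le_of_eq ?_) (norm_add_le _ _)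
  congr 1
  ext n
  simp [abs_of_nonneg hδ]
  ring

theorem HBound.of_weight_le_mul {γ a b M C : ℝ} {ω ω' : ℤ → ℝ} {v : ℝ → ℤ → ℂ} (hω : ∀ n, 0 ≤ ω n)
    (hC : 0 ≤ C) (h : ∀ n, ω n ≤ C * ω' n) (hv : HBound γ a b ω' M v) : HBound γ a b ω (C * M) v :=
  ⟨fun t ht => (hv.bdd t ht).of_weight_le_mul hω hC h, fun r hr t ht hrt => by
    rw [mul_assoc]; exact (hv.holder r hr t ht hrt).of_weight_le_mul hω hC h⟩

/-- Increments across the junction are routed through `b`, so the two Hölder constants add up. -/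
theorem HBound.glue {γ a b d M M' : ℝ} {ω : ℤ → ℝ} {u v : ℝ → ℤ → ℂ} (hγ : 0 ≤ γ) (hab : a < b)
    (hbd : b < d) (hu : HBound γ a b ω M u) (hv : HBound γ b d ω M' v) (h : u b = v b) :
    ∃ M'', HBound γ a d ω M'' (fun t => if t ≤ b then u t else v t) := by
  have h1 : 0 < b - a := by linarith
  have h2 : 0 < d - b := by linarith
  have hb : b ∈ Icc a b := ⟨hab.le, le_rfl⟩
  have hb' : b ∈ Icc b d := ⟨le_rfl, hbd.le⟩
  have hM : 0 ≤ M := (hu.bdd b hb).nonneg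
  have hM' : 0 ≤ M' := (hv.bdd b hb').nonneg
  have hu' : ∀ r ∈ Icc a b, ∀ t ∈ Icc a b, r ≤ t → WBound ω (M / (b - a) ^ γ * (t - r) ^ γ) (u t - u r) := by
    intro r hr t ht hrt
    refine (hu.holder r hr t ht hrt).mono (le_of_eq ?_)
    rw [Real.div_rpow (by linarith) h1.le]; ring
  have hv' : ∀ r ∈ Icc b d, ∀ t ∈ Icc b d, r ≤ t → WBound ω (M' / (d - b) ^ γ * (t - r) ^ γ) (v t - v r) := by
    intro r hr t ht hrt
    refine (hv.holder r hr t ht hrt).mono (le_of_eq ?_)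
    rw [Real.div_rpow (by linarith) h2.le]; ring
  refine ⟨_, HBound.of_holder (M := max M M') (L := M / (b - a) ^ γ + M' / (d - b) ^ γ)
    (hab.trans hbd) (fun t ht => ?_) (fun r hr t ht hrt => ?_)⟩
  · by_cases htb : t ≤ b
    · simp only [htb, if_true]
      exact (hu.bdd t ⟨ht.1, htb⟩).mono (le_max_left _ _)
    · simp only [htb, if_false]
      exact (hv.bdd t ⟨(not_le.1 htb).le, ht.2⟩).mono (le_max_right _ _)
  · have htr : 0 ≤ t - r := by linarith
    by_cases htb : t ≤ b
    · simp only [htb, hrt.trans htb, if_true]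
      refine (hu' r ⟨hr.1, hrt.trans htb⟩ t ⟨ht.1, htb⟩ hrt).mono ?_
      gcongr
      exact le_add_of_nonneg_right (by positivity)
    · have htb' : b ≤ t := (not_le.1 htb).le
      by_cases hrb : r ≤ b
      · simp only [htb, hrb, if_true, if_false]
        have := (hv' b hb' t ⟨htb', ht.2⟩ htb').add (hu' r ⟨hr.1, hrb⟩ b hb hrb)
        rw [h, sub_add_sub_cancel] at this
        refine this.mono ?_
        have e1 : (t - b) ^ γ ≤ (t - r) ^ γ := Real.rpow_le_rpow (by linarith) (by linarith) hγ
        have e2 : (b - r) ^ γ ≤ (t - r) ^ γ := Real.rpow_le_rpow (by linarith) (by linarith) hγ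
        calc _ ≤ M' / (d - b) ^ γ * (t - r) ^ γ + M / (b - a) ^ γ * (t - r) ^ γ := by gcongr
          _ = _ := by ring
      · simp only [htb, hrb, if_false]
        have hrb' : b ≤ r := (not_le.1 hrb).le
        refine (hv' r ⟨hrb', hr.2⟩ t ⟨htb', ht.2⟩ hrt).mono ?_
        gcongr
        exact le_add_of_nonneg_left (by positivity)

/-! ### Admissible weights and continuation to the whole interval -/

theorem admissibleWeight_one {c₀ : ℝ} (h : 1 ≤ c₀) : AdmissibleWeight c₀ (fun _ => 1) :=
  ⟨fun _ => le_rfl, fun _ _ _ => by linarith⟩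

theorem bracket_add_le (x y : ℝ) : bracket (x + y) ≤ bracket x + bracket y := by
  have h : ∀ z : ℝ, bracket z = ‖(!₂[1, z] : EuclideanSpace ℝ (Fin 2))‖ := fun z => by
    simp [bracket, EuclideanSpace.norm_eq]
  have h1 : bracket (x + y) ≤ ‖(!₂[1, x] + !₂[1, y] : EuclideanSpace ℝ (Fin 2))‖ := by
    rw [bracket, EuclideanSpace.norm_eq]
    refine Real.sqrt_le_sqrt ?_
    simp [Fin.sum_univ_two]
    norm_num
  rw [h x, h y]
  exact h1.trans (norm_add_le _ _)

theorem bracket_neg (x : ℝ) : bracket (-x) = bracket x := by simp [bracket]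

/-- The constant 3^s is independent of δ, which is what frees the existence time from the size of
the H^s norm. -/
theorem admissibleWeight_sob {s δ : ℝ} (hs : 0 ≤ s) (hδ : 0 ≤ δ) :
    AdmissibleWeight (3 ^ s) (fun n => 1 + δ * sobWeight s n) := by
  refine ⟨fun n => le_add_of_nonneg_right (mul_nonneg hδ (sobWeight_pos s n).le), fun n j k => ?_⟩
  have h3 : (1 : ℝ) ≤ 3 ^ s := Real.one_le_rpow (by norm_num) hs
  set x := bracket ((n + j : ℤ) : ℝ)
  set y := bracket ((n + j + k : ℤ) : ℝ)
  set z := bracket ((n + k : ℤ) : ℝ)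
  have hx : 0 < x := bracket_pos _
  have hy : 0 < y := bracket_pos _
  have hz : 0 < z := bracket_pos _
  have h1 : bracket (n : ℝ) ≤ x + y + z := by
    have e : (n : ℝ) = ((n + j : ℤ) : ℝ) + -((n + j + k : ℤ) : ℝ) + ((n + k : ℤ) : ℝ) := by
      push_cast; ring
    rw [e]
    refine (bracket_add_le _ _).trans (add_le_add ((bracket_add_le _ _).trans ?_) le_rfl)
    rw [bracket_neg]
  have h2 : sobWeight s n ≤ 3 ^ s * (x ^ s + y ^ s + z ^ s) := by
    have hmax : x + y + z ≤ 3 * max x (max y z) := by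
      have := le_max_left x (max y z)
      have := (le_max_left y z).trans (le_max_right x (max y z))
      have := (le_max_right y z).trans (le_max_right x (max y z))
      linarith
    have hxs : 0 < x ^ s := by positivity
    have hys : 0 < y ^ s := by positivity
    have hzs : 0 < z ^ s := by positivity
    calc sobWeight s n ≤ (3 * max x (max y z)) ^ s :=
          Real.rpow_le_rpow (bracket_pos _).le (h1.trans hmax) hs
      _ = 3 ^ s * (max x (max y z)) ^ s := Real.mul_rpow (by norm_num) (by positivity)
      _ ≤ _ := by
        gcongr
        rcases max_choice x (max y z) with h | h
        · rw [h]; linarith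
        · rw [h]
          rcases max_choice y z with h | h <;> rw [h] <;> linarith
  have h4 : sobWeight s (n + j) = x ^ s := rfl
  have h5 : sobWeight s (n + j + k) = y ^ s := rfl
  have h6 : sobWeight s (n + k) = z ^ s := rfl
  rw [h4, h5, h6]
  nlinarith [mul_le_mul_of_nonneg_left h2 hδ]

/-- Existence of mild solutions on the whole time interval. -/
theorem exists_isMild {γ K T s : ℝ} {c : ℝ → ℤ × ℤ → ℂ} (hγ : 1 / 2 < γ) (hK : 0 ≤ K) (hT : 0 < T)
    (hs : 1 / 6 ≤ s) (hc : IsCoeff 0 T c)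
    (hY : ∀ ω, AdmissibleWeight (3 ^ s) ω → YoungBound γ K 0 T ω c) (hE : EnergyNeutral 0 T c)
    {f : ℤ → ℂ} {A : ℝ} (hf : WBound (sobWeight s) A f) :
    ∃ v M, v 0 = f ∧ IsMild 0 T c v ∧ HBound γ 0 T (sobWeight s) M v := by
  have hs0 : 0 ≤ s := by linarith
  have hγ0 : 0 ≤ γ := by linarith
  have h1w : ∀ n, (1 : ℝ) ≤ 1 * sobWeight s n := fun n => by rw [one_mul]; exact one_le_sobWeight hs0 n
  have h3 : (1 : ℝ) ≤ 3 ^ s := Real.one_le_rpow (by norm_num) hs0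
  have hY1 := hY _ (admissibleWeight_one h3)
  have hf1 : WBound (fun _ => 1) A f := by
    simpa using hf.of_weight_le_mul (fun _ => zero_le_one) zero_le_one h1w
  -- The step length T/N is fixed once and for all from the ℓ² bound `A` of the datum.
  obtain ⟨N, hN, hsmall⟩ := exists_nat_mul_rpow_le (T := T) (by linarith : 0 < γ)
    (24 * (youngConst γ * K) * (A + 1) ^ 2) (ε := 1) one_pos
  have hN' : (0 : ℝ) < N := Nat.cast_pos.2 hN
  set τ := T / N with hτ
  have hτ0 : 0 < τ := by positivity
  have hNτ : N * τ = T := by rw [hτ]; field_simp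
  have hstep : ∀ a, 0 ≤ a → a + τ ≤ T → ∀ g A', WBound (fun _ => 1) A g → WBound (sobWeight s) A' g →
      ∃ v M, v a = g ∧ IsMild a (a + τ) c v ∧ HBound γ a (a + τ) (sobWeight s) M v := by
    intro a ha haT g A' hg hg'
    have hA' := hg'.nonneg
    -- Then δA' ≤ 1, so the restarted datum has weighted norm at most A + 1 however large its H^s
    -- bound A' has become.
    set δ := (A' + 1)⁻¹ with hδ
    have hδ0 : 0 < δ := by positivity
    have hsub := Icc_subset_Icc ha haT
    have hgw : WBound (fun n => 1 + δ * sobWeight s n) (A + 1) g := by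
      refine (hg.add_weight hδ0.le hg').mono ?_
      gcongr
      rw [hδ, inv_mul_le_iff₀ (by positivity)]
      linarith
    have hadm := admissibleWeight_sob hs0 hδ0.le
    have hle : ∀ n, sobWeight s n ≤ δ⁻¹ * (1 + δ * sobWeight s n) := fun n => by
      rw [mul_add, inv_mul_cancel_left₀ hδ0.ne']
      have := inv_pos.2 hδ0
      linarith
    obtain ⟨v, hva, hvm, hvb⟩ := exists_isMild_short hγ hK (by linarith : a < a + τ) hadm.one_le
      (inv_pos.2 hδ0).le (fun n => (sobWeight_mono hs n).trans (hle n)) (hc.mono hsub)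
      ((hY _ hadm).mono hsub) hgw (by rw [add_sub_cancel_left]; linarith)
    exact ⟨v, _, hva, hvm, hvb.of_weight_le_mul (fun n => (sobWeight_pos s n).le) (inv_pos.2 hδ0).le hle⟩
  have key : ∀ k : ℕ, 1 ≤ k → k ≤ N → ∃ v M, v 0 = f ∧ IsMild 0 (k * τ) c v ∧
      HBound γ 0 (k * τ) (sobWeight s) M v := by
    intro k hk
    -- The induction starts at 1: a Hölder bound normalized by the interval length carries no
    -- information on a degenerate interval.
    induction k, hk using Nat.le_induction with
    | base =>
      intro hN1
      have hle : 0 + τ ≤ T := by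
        rw [zero_add, ← hNτ]
        exact le_mul_of_one_le_left hτ0.le (by exact_mod_cast hN1)
      have := hstep 0 le_rfl hle f A hf1 hf
      simpa using this
    | succ k hk ih =>
      intro hkN
      obtain ⟨u, M, hu0, hum, hub⟩ := ih (by omega)
      set b : ℝ := k * τ with hb
      have hb0 : 0 < b := by
        have : (1 : ℝ) ≤ k := by exact_mod_cast hk
        positivity
      have hbτ : ((k + 1 : ℕ) : ℝ) * τ = b + τ := by push_cast; ring
      have hbT : b + τ ≤ T := by
        rw [← hbτ, ← hNτ]
        exact mul_le_mul_of_nonneg_right (Nat.cast_le.2 hkN) hτ0.le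
      have hsub : Icc 0 b ⊆ Icc 0 T := Icc_subset_Icc le_rfl (by linarith)
      have hbm : b ∈ Icc 0 b := ⟨hb0.le, le_rfl⟩
      -- Conservation returns the same bound `A` at the restart time, so the next step has the same
      -- length.
      have hmass : WBound (fun _ => 1) A (u b) :=
        hum.wbound_one hγ hK hb0 (hc.mono hsub) (hY1.mono hsub)
          (fun r hr t ht => hE r (hsub hr) t (hsub ht))
          (hub.of_weight_le_mul (fun _ => zero_le_one) zero_le_one h1w) (by rw [hu0]; exact hf1) hbm
      obtain ⟨v, M', hvb, hvm, hvB⟩ := hstep b hb0.le hbT (u b) M hmass (hub.bdd b hbm)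
      obtain ⟨M'', hG⟩ := HBound.glue hγ0 hb0 (by linarith : b < b + τ) hub hvB hvb.symm
      set x : ℝ → ℤ → ℂ := fun t => if t ≤ b then u t else v t with hx
      have hx0 : x 0 = f := by simp only [hx, hb0.le, if_true, hu0]
      have hxu : ∀ t ≤ b, x t = u t := fun t ht => by simp only [hx, ht, if_true]
      have hxv : ∀ t, b ≤ t → x t = v t := fun t ht => by
        rcases ht.eq_or_lt with rfl | h
        · rw [hxu _ le_rfl, hvb]
        · simp only [hx, not_le.2 h, if_false]
      rw [hbτ]
      have hxp : HPath 0 (b + τ) x := hG.hpath (by linarith) (by linarith) zero_le_one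
        (fun n => by rw [one_mul]; exact sobWeight_mono hs n)
      have hc' : IsCoeff 0 (b + τ) c := hc.mono (Icc_subset_Icc le_rfl hbT)
      refine ⟨x, M'', hx0, ⟨hxp, fun t ht n => ?_⟩, hG⟩
      have i1 : ∀ t ≤ b, 0 ≤ t → ∫ t' in (0 : ℝ)..t, tri (c t') (x t') (x t') (x t') n =
          ∫ t' in (0 : ℝ)..t, tri (c t') (u t') (u t') (u t') n := fun t ht ht0 =>
        intervalIntegral.integral_congr fun t' ht' => by
          rw [uIcc_of_le ht0] at ht'
          simp only [hxu t' (ht'.2.trans ht)]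
      rcases le_total t b with h | h
      · rw [hx0, hxu t h, i1 t h ht.1, ← hu0]
        exact hum.eq t ⟨ht.1, h⟩ n
      · have i2 : ∫ t' in b..t, tri (c t') (x t') (x t') (x t') n =
            ∫ t' in b..t, tri (c t') (v t') (v t') (v t') n :=
          intervalIntegral.integral_congr fun t' ht' => by
            rw [uIcc_of_le h] at ht'
            simp only [hxv t' ht'.1]
        rw [← intervalIntegral.integral_add_adjacent_intervals
          (hc'.intervalIntegrable_tri hxp hxp hxp ⟨le_rfl, by linarith⟩ ⟨hb0.le, by linarith⟩ n)
          (hc'.intervalIntegrable_tri hxp hxp hxp ⟨hb0.le, by linarith⟩ ht n), i1 b le_rfl hb0.le, i2,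
          hxv t h, hvm.eq t ⟨h, ht.2⟩ n, hvb, hum.eq b hbm n, hu0, hx0]
        ring
  have := key N hN le_rfl
  rwa [hNτ] at this

/-! ### The coefficients of the modulated cubic NLS in the interaction representation -/

/-- The coefficients of the modulated cubic NLS in the interaction representation. -/
def nlsCoeff (w : ℝ → ℝ) (t : ℝ) (p : ℤ × ℤ) : ℂ :=
  -Complex.I * Complex.exp (Complex.I * ((2 * (p.1 : ℝ) * (p.2 : ℝ) : ℝ) : ℂ) * w t)

/-- The nonresonant part of the coefficients. -/
def nonresCoeff (w : ℝ → ℝ) (t : ℝ) (p : ℤ × ℤ) : ℂ :=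
  if p.1 = 0 ∨ p.2 = 0 then 0 else nlsCoeff w t p

/-- The resonant part of the coefficients. -/
def resCoeff (p : ℤ × ℤ) : ℂ := if p.1 = 0 ∨ p.2 = 0 then -Complex.I else 0

theorem norm_nlsCoeff (w : ℝ → ℝ) (t : ℝ) (p : ℤ × ℤ) : ‖nlsCoeff w t p‖ = 1 := by
  rw [nlsCoeff, norm_mul, norm_neg, Complex.norm_I, one_mul, mul_assoc, ← Complex.ofReal_mul, mul_comm,
    Complex.norm_exp_ofReal_mul_I]

theorem isCoeff_nlsCoeff {w : ℝ → ℝ} {T : ℝ} (hw : ContinuousOn w (Icc 0 T)) :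
    IsCoeff 0 T (nlsCoeff w) where
  norm_le t p := (norm_nlsCoeff w t p).le
  cont p := by
    unfold nlsCoeff
    have : ContinuousOn (fun t => (w t : ℂ)) (Icc 0 T) := Complex.continuous_ofReal.comp_continuousOn hw
    fun_prop

theorem isCoeff_nonresCoeff {w : ℝ → ℝ} {T : ℝ} (hw : ContinuousOn w (Icc 0 T)) :
    IsCoeff 0 T (nonresCoeff w) where
  norm_le t p := by
    unfold nonresCoeff
    split_ifs
    · simp
    · exact (norm_nlsCoeff w t p).le
  cont p := by
    unfold nonresCoeff
    split_ifs
    · exact continuousOn_const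
    · exact (isCoeff_nlsCoeff hw).cont p

/-- On the axes the phase 2jk w(t) vanishes, so the resonant part is the constant -i, independent of
time. -/
theorem nlsCoeff_eq_add (w : ℝ → ℝ) (t : ℝ) : nlsCoeff w t = nonresCoeff w t + resCoeff := by
  funext p
  simp only [Pi.add_apply, nonresCoeff, resCoeff]
  split_ifs with h
  · rcases h with h | h <;> simp [nlsCoeff, h]
  · simp

theorem norm_resCoeff_le (ρ : ℝ) (p : ℤ × ℤ) : ‖resCoeff p‖ ≤ 1 * resKernel ρ p := by
  have := resKernel_nonneg ρ p
  unfold resCoeff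
  split_ifs with h
  · simp [resKernel, h]
  · simpa using this

theorem coeffInt_nlsCoeff (w : ℝ → ℝ) (r t : ℝ) (p : ℤ × ℤ) :
    coeffInt (nlsCoeff w) r t p = -Complex.I * Phi w t r (2 * (p.1 : ℝ) * (p.2 : ℝ)) := by
  simp only [coeffInt, nlsCoeff, Phi]
  rw [intervalIntegral.integral_const_mul]

theorem conj_Phi (w : ℝ → ℝ) (t r a : ℝ) : (starRingEnd ℂ) (Phi w t r a) = Phi w t r (-a) := by
  simp only [Phi]
  rw [← intervalIntegral.intervalIntegral_conj]
  refine intervalIntegral.integral_congr fun x _ => ?_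
  simp [← Complex.exp_conj]

theorem bracket_rpow_neg_le {ρ : ℝ} (hρ : 0 ≤ ρ) {j k : ℤ} (hj : j ≠ 0) (hk : k ≠ 0) :
    bracket (2 * (j : ℝ) * (k : ℝ)) ^ (-ρ) ≤ (axisWeight ρ j * axisWeight ρ k) ^ 5 := by
  have hj' : 0 < |(j : ℝ)| := abs_pos.2 (Int.cast_ne_zero.2 hj)
  have hk' : 0 < |(k : ℝ)| := abs_pos.2 (Int.cast_ne_zero.2 hk)
  have e : (axisWeight ρ j * axisWeight ρ k) ^ 5 = (|(j : ℝ)| * |(k : ℝ)|) ^ (-ρ) := by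
    rw [axisWeight, axisWeight, if_neg hj, if_neg hk, ← Real.mul_rpow hj'.le hk'.le,
      ← Real.rpow_natCast, ← Real.rpow_mul (by positivity)]
    congr 1
    push_cast
    ring
  rw [e]
  refine Real.rpow_le_rpow_of_nonpos (by positivity) ?_ (by linarith)
  refine le_trans ?_ (abs_le_bracket _)
  rw [abs_mul, abs_mul, abs_two]
  nlinarith [mul_pos hj' hk']

theorem IsIrregularOn.exists_norm_Phi_le {ρ γ T : ℝ} {w : ℝ → ℝ} (hγ : 0 < γ)
    (hw : IsIrregularOn ρ γ w T) : ∃ C : ℝ, 0 ≤ C ∧ ∀ r ∈ Icc 0 T, ∀ t ∈ Icc 0 T, r ≤ t → ∀ a,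
      ‖Phi w t r a‖ ≤ C * (t - r) ^ γ * bracket a ^ (-ρ) := by
  obtain ⟨-, C, hC⟩ := hw
  refine ⟨max C 0, le_max_right _ _, fun r hr t ht hrt a => ?_⟩
  rcases hrt.eq_or_lt with rfl | hlt
  · simp [Phi, Real.zero_rpow hγ.ne']
  · have h := (hC a r t hr.1 hlt ht.2).trans (le_max_left C 0)
    have h1 : 0 < bracket a ^ ρ := Real.rpow_pos_of_pos (bracket_pos a) _
    have h2 : 0 < (t - r) ^ γ := Real.rpow_pos_of_pos (by linarith) _
    rw [abs_of_pos (by linarith : 0 < t - r), mul_div_assoc', div_le_iff₀ h2] at h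
    rw [Real.rpow_neg (bracket_pos a).le, ← div_eq_mul_inv, le_div_iff₀ h1]
    linarith

/-- The decay of the time integrals of the coefficients. -/
theorem IsIrregularOn.exists_norm_coeffInt_le {ρ γ T : ℝ} {w : ℝ → ℝ} (hρ : 0 ≤ ρ) (hγ : 0 < γ)
    (hw : IsIrregularOn ρ γ w T) : ∃ C : ℝ, 0 ≤ C ∧ ∀ r ∈ Icc 0 T, ∀ t ∈ Icc 0 T, r ≤ t → ∀ p,
      ‖coeffInt (nlsCoeff w) r t p‖ ≤ C * (t - r) ^ γ * resKernel ρ p ∧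
      ‖coeffInt (nonresCoeff w) r t p‖ ≤ C * (t - r) ^ γ * (axisWeight ρ p.1 * axisWeight ρ p.2) ^ 5 := by
  obtain ⟨C, hC, h⟩ := hw.exists_norm_Phi_le hγ
  refine ⟨C, hC, fun r hr t ht hrt p => ?_⟩
  have h0 : 0 ≤ C * (t - r) ^ γ := mul_nonneg hC (Real.rpow_nonneg (by linarith) _)
  have h1 : ‖coeffInt (nlsCoeff w) r t p‖ ≤
      C * (t - r) ^ γ * bracket (2 * (p.1 : ℝ) * (p.2 : ℝ)) ^ (-ρ) := by
    rw [coeffInt_nlsCoeff, norm_mul, norm_neg, Complex.norm_I, one_mul]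
    exact h r hr t ht hrt _
  by_cases hp : p.1 = 0 ∨ p.2 = 0
  · refine ⟨h1.trans (mul_le_mul_of_nonneg_left ?_ h0), ?_⟩
    · rw [resKernel, if_pos hp]
      exact Real.rpow_le_one_of_one_le_of_nonpos (one_le_bracket _) (by linarith)
    · have e : coeffInt (nonresCoeff w) r t p = 0 := by simp [coeffInt, nonresCoeff, hp]
      rw [e, norm_zero]
      have := axisWeight_nonneg ρ p.1
      have := axisWeight_nonneg ρ p.2
      positivity
  · have hp' := not_or.1 hp
    have h2 := h1.trans (mul_le_mul_of_nonneg_left (bracket_rpow_neg_le hρ hp'.1 hp'.2) h0)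
    refine ⟨by rwa [resKernel, if_neg hp], ?_⟩
    have e : coeffInt (nonresCoeff w) r t p = coeffInt (nlsCoeff w) r t p := by
      simp [coeffInt, nonresCoeff, hp]
    rwa [e]

theorem IsIrregularOn.exists_youngBound {ρ γ T : ℝ} {w : ℝ → ℝ} (hρ : 2 / 3 < ρ) (hγ : 0 < γ)
    (hw : IsIrregularOn ρ γ w T) {c₀ : ℝ} (hc₀ : 0 ≤ c₀) : ∃ K : ℝ, 0 ≤ K ∧
      ∀ ω, AdmissibleWeight c₀ ω → YoungBound γ K 0 T ω (nlsCoeff w) := by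
  obtain ⟨C, hC, h⟩ := hw.exists_norm_coeffInt_le (by linarith) hγ
  obtain ⟨K, hK, hY⟩ := exists_WBound_tri hρ c₀ hc₀
  refine ⟨K * C, by positivity, fun ω hω r hr t ht hrt f g k A B D hf hg hk => ?_⟩
  have := hY ω hω _ _ (fun p => (h r hr t ht hrt p).1) f g k A B D hf hg hk
  rwa [← mul_assoc K] at this

/-- Conjugation sends Φ(a) to Φ(-a), as does j ↦ -j in a = 2jk, while the prefactor -i changes sign;
this is the antisymmetry required by `hasSum_conj_mul_tri`. -/
theorem IsIrregularOn.energyNeutral {ρ γ T : ℝ} {w : ℝ → ℝ} (hρ : 2 / 3 < ρ) (hγ : 0 < γ)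
    (hw : IsIrregularOn ρ γ w T) : EnergyNeutral 0 T (nlsCoeff w) := by
  obtain ⟨C, hC, h⟩ := hw.exists_norm_coeffInt_le (by linarith) hγ
  intro r hr t ht hrt x M hx
  refine hasSum_conj_mul_tri hρ (fun p => (h r hr t ht hrt p).1) (fun j k => ?_) hx
  rw [coeffInt_nlsCoeff, coeffInt_nlsCoeff, map_mul, conj_Phi]
  simp only [map_neg, Complex.conj_I, Int.cast_neg]
  rw [show 2 * -(j : ℝ) * (k : ℝ) = -(2 * (j : ℝ) * (k : ℝ)) by ring]
  ring

/-! ### Automatic Hölder regularity and unconditional uniqueness -/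

theorem IsMild.norm_sub_le {a b M : ℝ} {c : ℝ → ℤ × ℤ → ℂ} {v : ℝ → ℤ → ℂ} (hc : IsCoeff a b c)
    (h : IsMild a b c v) (hM : ∀ t ∈ Icc a b, WBound (sobWeight (1 / 6)) M (v t)) {r t : ℝ}
    (hr : r ∈ Icc a b) (ht : t ∈ Icc a b) (hrt : r ≤ t) (n : ℤ) :
    ‖(v t - v r) n‖ ≤ triConst * M ^ 3 * (t - r) := by
  -- The H^{1/6} bound makes each coordinate of the nonlinearity bounded uniformly in n, hence each
  -- coordinate of v Lipschitz with a common constant.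
  rw [h.sub_eq hc hr ht]
  have := intervalIntegral.norm_integral_le_of_norm_le_const (a := r) (b := t)
    (f := fun t' => tri (c t') (v t') (v t') (v t') n) (C := triConst * M ^ 3) fun x hx => by
      have hx' : x ∈ Icc a b := by
        rw [uIoc_of_le hrt] at hx
        exact ⟨hr.1.trans hx.1.le, hx.2.trans ht.2⟩
      have := norm_tri_le (hM x hx') (hM x hx') (hM x hx') (hc.norm_le x) n
      refine this.trans_eq ?_
      ring
  rwa [abs_of_nonneg (by linarith)] at this

/-- Mild solutions that are merely continuous in time with values in `H^{1/6}` are Hölder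
continuous with values in `ℓ²`. -/
theorem IsMild.exists_holder {ρ γ T : ℝ} {w : ℝ → ℝ} (hρ : 2 / 3 < ρ) (hγ : 1 / 2 < γ) (hγ1 : γ < 1)
    (hT : 0 < T) (hw : IsIrregularOn ρ γ w T) {v : ℝ → ℤ → ℂ} (hv : IsMild 0 T (nlsCoeff w) v) :
    ∃ M, HBound γ 0 T (fun _ => 1) M v := by
  obtain ⟨C, hC, hcI⟩ := hw.exists_norm_coeffInt_le (by linarith) (by linarith)
  obtain ⟨K₀, hK₀, hY⟩ := exists_WBound_tri hρ 1 (by norm_num)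
  obtain ⟨K₁, hK₁, hQ⟩ := exists_WBound_tri_of_QBound hρ
  obtain ⟨M, hM, hb⟩ := hv.path.bdd
  have hadm : AdmissibleWeight 1 (fun _ => 1) := admissibleWeight_one le_rfl
  have hc := isCoeff_nlsCoeff hw.1
  have hc₁ := isCoeff_nonresCoeff hw.1
  have hb1 : ∀ t ∈ Icc 0 T, WBound (fun _ => 1) M (v t) := fun t ht =>
    (hb t ht).of_weight_le (fun _ => zero_le_one) (fun n => one_le_sobWeight (by norm_num) n)
  have hA : 0 ≤ triConst := by norm_num [triConst]
  set A := triConst * M ^ 3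
  have hA0 : 0 ≤ A := by positivity
  set D := 3 * (K₁ * C * (√(A * (2 * M)) * M * M))
  have hD : 0 ≤ D := by positivity
  set E := D / (1 - 2 ^ (1 - (γ + 1 / 2)))
  have hE : 0 ≤ E := by
    have : (2 : ℝ) ^ (1 - (γ + 1 / 2)) ≤ 1 :=
      Real.rpow_le_one_of_one_le_of_nonpos (by norm_num) (by linarith)
    exact div_nonneg hD (by linarith)
  have hres : ∀ r ∈ Icc 0 T, WBound (fun _ => 1) (K₀ * 1 * (M * M * M)) (tri resCoeff (v r) (v r) (v r)) :=
    fun r hr => hY _ hadm _ _ (norm_resCoeff_le ρ) _ _ _ _ _ _ (hb1 r hr) (hb1 r hr) (hb1 r hr)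
  have hinc : ∀ S, ∀ r ∈ Icc 0 T, ∀ q ∈ Icc 0 T, ∀ t ∈ Icc 0 T, r ≤ q → q ≤ t →
      wnorm (fun _ => 1) S (tri (coeffInt (nonresCoeff w) q t) (v q) (v q) (v q) -
        tri (coeffInt (nonresCoeff w) q t) (v r) (v r) (v r)) ≤ D * (t - r) ^ (γ + 1 / 2) := by
    intro S r hr q hq t ht hrq hqt
    rw [tri_sub (hb q hq) (hb q hq) (hb q hq) (hc₁.norm_coeffInt_le q t) (hb r hr) (hb r hr) (hb r hr)]
    have hδ : 0 ≤ A * (q - r) := mul_nonneg hA0 (by linarith)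
    -- Interpolating the ℓ^∞ Lipschitz bound with the ℓ² bound gives half a power of time in ℓ⁴;
    -- with the γ of the averaged operator the exponent exceeds 1.
    have hd : QBound (√(A * (q - r) * (M + M))) (v q - v r) :=
      QBound.of_sup hδ (hv.norm_sub_le hc hb hr hq hrq) ((hb1 q hq).sub (hb1 r hr))
    have hCt : 0 ≤ C * (t - q) ^ γ := mul_nonneg hC (Real.rpow_nonneg (by linarith) _)
    have key := fun {g h : ℤ → ℂ} (hg : WBound (fun _ => 1) M g) (hh : WBound (fun _ => 1) M h) =>
      hQ _ _ hCt (fun p => (hcI q hq t ht hqt p).2) _ g h _ M M (Real.sqrt_nonneg _) hd hg hh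
    have i1 := (key (hb1 q hq) (hb1 q hq)).1
    have i2 := (key (hb1 r hr) (hb1 q hq)).2.1
    have i3 := (key (hb1 r hr) (hb1 r hr)).2.2
    refine (((i1.add i2).add i3) S).trans ?_
    have e : √(A * (q - r) * (M + M)) = √(A * (2 * M)) * (q - r) ^ (1 / 2 : ℝ) := by
      rw [← Real.sqrt_eq_rpow, ← Real.sqrt_mul (by positivity)]
      congr 1
      ring
    rw [e]
    have hqr : 0 ≤ q - r := by linarith
    have htq : 0 ≤ t - q := by linarith
    have htr : 0 ≤ t - r := by linarith
    calc _ = D * ((t - q) ^ γ * (q - r) ^ (1 / 2 : ℝ)) := by ring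
      _ ≤ D * ((t - r) ^ γ * (t - r) ^ (1 / 2 : ℝ)) := by gcongr
      _ = _ := by rw [Real.rpow_add_of_nonneg (by linarith) (by linarith) (by norm_num)]
  refine ⟨_, HBound.of_holder (L := E * T ^ (1 / 2 : ℝ) + K₀ * 1 * (M * M * M) * T ^ (1 - γ) +
    K₀ * C * (M * M * M)) hT hb1 fun r hr t ht hrt S => ?_⟩
  have hg := hY _ hadm _ _ (fun p => ((hcI r hr t ht hrt p).2.trans (mul_le_mul_of_nonneg_left
    (b := (axisWeight ρ p.1 * axisWeight ρ p.2) ^ 5) (c := resKernel ρ p) (by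
      unfold resKernel
      split_ifs with hp
      · rcases hp with hp | hp <;> simp [axisWeight, hp]
      · exact le_rfl) (mul_nonneg hC (Real.rpow_nonneg (by linarith) γ)))))
    _ _ _ _ _ _ (hb1 r hr) (hb1 r hr) (hb1 r hr) S
  -- The germ uses only the nonresonant coefficients, where an ℓ⁴ increment is admissible; the
  -- resonant ones enter as the part without cancellation.
  have hs := wnorm_integral_tri_sub_le hc hc₁
    -- With exponent 0 the kernel `resKernel` is identically 1.
    (fun p => (norm_resCoeff_le 0 p).trans (by
      unfold resKernel
      split_ifs with hp
      · simp
      · obtain ⟨h1, h2⟩ := not_or.1 hp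
        simp [axisWeight, h1, h2]))
    (nlsCoeff_eq_add w) hv.path hv.path hv.path (ω := fun _ => 1) (fun _ => zero_le_one) S hD
    (θ := γ + 1 / 2) (by linarith) (fun r hr => hres r hr S) (hinc S) hr ht hrt
  rw [hv.sub_eq hc hr ht]
  have htr : 0 ≤ t - r := by linarith
  have htT : t - r ≤ T := by linarith [hr.1, ht.2]
  have e1 : (t - r) ^ (γ + 1 / 2) ≤ T ^ (1 / 2 : ℝ) * (t - r) ^ γ := by
    rw [Real.rpow_add_of_nonneg htr (by linarith) (by norm_num), mul_comm]
    gcongr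
  have e2 : t - r ≤ T ^ (1 - γ) * (t - r) ^ γ := by
    calc t - r = (t - r) ^ (1 - γ) * (t - r) ^ γ := by
          rw [← Real.rpow_add_of_nonneg htr (by linarith) (by linarith), sub_add_cancel, Real.rpow_one]
      _ ≤ _ := by
          have : 0 ≤ 1 - γ := by linarith
          gcongr
  have := wnorm_add_le (fun _ => 1) S ((fun n => ∫ t' in r..t, tri (nlsCoeff w t') (v t') (v t') (v t') n) -
      tri (coeffInt (nonresCoeff w) r t) (v r) (v r) (v r)) (tri (coeffInt (nonresCoeff w) r t) (v r) (v r) (v r))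
  rw [sub_add_cancel] at this
  have hKM : 0 ≤ K₀ * 1 * (M * M * M) := by positivity
  calc _ ≤ _ := this
    _ ≤ _ := add_le_add hs hg
    _ ≤ (E * (T ^ (1 / 2 : ℝ) * (t - r) ^ γ) + K₀ * 1 * (M * M * M) * (T ^ (1 - γ) * (t - r) ^ γ)) +
        K₀ * (C * (t - r) ^ γ) * (M * M * M) := by gcongr
    _ = _ := by ring

/-- Unconditional uniqueness of mild solutions. -/
theorem IsMild.eqOn_of_isIrregularOn {ρ γ T : ℝ} {w : ℝ → ℝ} (hρ : 2 / 3 < ρ) (hγ : 1 / 2 < γ)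
    (hγ1 : γ < 1) (hT : 0 < T) (hw : IsIrregularOn ρ γ w T) {u v : ℝ → ℤ → ℂ}
    (hu : IsMild 0 T (nlsCoeff w) u) (hv : IsMild 0 T (nlsCoeff w) v) (h0 : u 0 = v 0) :
    EqOn u v (Icc 0 T) := by
  obtain ⟨M, bu⟩ := hu.exists_holder hρ hγ hγ1 hT hw
  obtain ⟨M', bv⟩ := hv.exists_holder hρ hγ hγ1 hT hw
  obtain ⟨K, hK, hY⟩ := hw.exists_youngBound hρ (by linarith) zero_le_one
  exact IsMild.eqOn hγ hK hT (fun _ => le_rfl) (isCoeff_nlsCoeff hw.1)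
    (hY _ (admissibleWeight_one le_rfl)) hu hv (bu.mono (le_max_left M M'))
    (bv.mono (le_max_right M M')) h0

/-- Existence of mild solutions. -/
theorem IsIrregularOn.exists_isMild {ρ γ T s : ℝ} {w : ℝ → ℝ} (hρ : 2 / 3 < ρ) (hγ : 1 / 2 < γ)
    (hT : 0 < T) (hw : IsIrregularOn ρ γ w T) (hs : 1 / 6 ≤ s) {f : ℤ → ℂ} {A : ℝ}
    (hf : WBound (sobWeight s) A f) :
    ∃ v M, v 0 = f ∧ IsMild 0 T (nlsCoeff w) v ∧ HBound γ 0 T (sobWeight s) M v := by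
  obtain ⟨K, hK, hY⟩ := hw.exists_youngBound hρ (by linarith) (c₀ := 3 ^ s) (by positivity)
  exact ModulatedNLS.exists_isMild hγ hK hT hs (isCoeff_nlsCoeff hw.1) hY
    (hw.energyNeutral hρ (by linarith)) hf

/-! ### Sobolev spaces as weighted sequence spaces -/

namespace SobolevSpace

variable {s : ℝ}

theorem coeff_sub (f g : SobolevSpace s) : (f - g).coeff = f.coeff - g.coeff := by
  funext n
  simp only [coeff, ← fourierBasis_repr, map_sub, lp.coeFn_sub, Pi.sub_apply]

theorem coeff_injective : Function.Injective (coeff (s := s)) := by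
  intro f g h
  refine toLp_injective (Subtype.ext (funext fun n => ?_))
  exact congrArg (((bracket (n : ℝ) ^ s : ℝ) : ℂ) * ·) (congrFun h n)

theorem norm_toLp_apply (f : SobolevSpace s) (n : ℤ) :
    ‖(toLp f : ℤ → ℂ) n‖ = sobWeight s n * ‖f.coeff n‖ := by
  change ‖((bracket (n : ℝ) ^ s : ℝ) : ℂ) * fourierCoeff (toL2 f) n‖ = _
  rw [norm_mul, Complex.norm_real]
  exact congrArg (· * _) (Real.norm_of_nonneg (sobWeight_pos s n).le)

theorem norm_le_iff (f : SobolevSpace s) {M : ℝ} (hM : 0 ≤ M) :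
    ‖f‖ ≤ M ↔ WBound (sobWeight s) M f.coeff := by
  change ‖toLp f‖ ≤ M ↔ _
  have e : ∀ S : Finset ℤ, ∑ n ∈ S, ‖(toLp f : ℤ → ℂ) n‖ ^ (2 : ℝ≥0∞).toReal =
      wnorm (sobWeight s) S f.coeff ^ 2 := fun S => by
    rw [wnorm_sq]
    refine Finset.sum_congr rfl fun n _ => ?_
    rw [norm_toLp_apply]
    norm_num
  constructor
  · intro h S
    have h1 := lp.sum_rpow_le_norm_rpow (p := 2) (by norm_num) (toLp f) S
    rw [e] at h1
    refine le_trans ((sq_le_sq₀ (wnorm_nonneg _ _ _) (norm_nonneg _)).1 ?_) h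
    simpa using h1
  · intro h
    refine lp.norm_le_of_forall_sum_le (p := 2) (by norm_num) hM fun S => ?_
    rw [e]
    simpa using pow_le_pow_left₀ (wnorm_nonneg _ _ _) (h S) 2

theorem wbound (f : SobolevSpace s) : WBound (sobWeight s) ‖f‖ f.coeff :=
  (f.norm_le_iff (norm_nonneg f)).1 le_rfl

theorem wbound_of_le {s' : ℝ} (h : s' ≤ s) (f : SobolevSpace s) : WBound (sobWeight s') ‖f‖ f.coeff :=
  f.wbound.of_weight_le (fun n => (sobWeight_pos s' n).le) (sobWeight_mono h)

theorem exists_coeff_eq (hs : 0 ≤ s) {M : ℝ} {x : ℤ → ℂ} (hx : WBound (sobWeight s) M x) :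
    ∃ f : SobolevSpace s, f.coeff = x := by
  have h2 : Memℓp x 2 := by
    refine memℓp_gen ?_
    have := (hx.of_weight_le (fun _ => zero_le_one) (one_le_sobWeight hs)).summable
    simpa using this
  set F : L2 := (fourierBasis (T := 2 * Real.pi)).repr.symm ⟨x, h2⟩
  have hF : ∀ n, fourierCoeff F n = x n := fun n => by
    rw [← fourierBasis_repr]
    simp [F]
  have hm : Memℓp (weightedCoeff s F) 2 := by
    refine memℓp_gen ?_
    have := hx.summable
    refine this.congr fun n => ?_
    rw [weightedCoeff, hF, norm_mul, Complex.norm_real, ← sobWeight,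
      Real.norm_of_nonneg (sobWeight_pos s n).le]
    simp
  exact ⟨(⟨F, hm⟩ : sobolevSubmodule s), funext hF⟩

theorem cubicCoeff_eq_tri (hs : 1 / 6 ≤ s) (f : SobolevSpace s) (n : ℤ) :
    f.cubicCoeff n = tri (fun _ => 1) f.coeff f.coeff f.coeff n :=
  fourierCoeff_cubic_eq_tri (toL2 f) (by positivity : 0 < ‖f‖ + 1)
    ((f.wbound_of_le hs).mono (by linarith)) n

/-- Multiplication of the Fourier coefficients by unimodular factors. -/
theorem exists_mul_coeff (hs : 0 ≤ s) {e : ℤ → ℂ} (he : ∀ n, ‖e n‖ = 1) (f : SobolevSpace s) :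
    ∃ g : SobolevSpace s, g.coeff = fun n => e n * f.coeff n :=
  exists_coeff_eq hs (f.wbound.of_le (fun n => (sobWeight_pos s n).le) fun n => by
    rw [norm_mul, he, one_mul])

/-- The multipliers are continuous in time for each frequency but not uniformly in frequency. A tail
of u(t₀) is discarded, where unimodularity costs at most a factor 2, and the finitely many remaining
frequencies are treated directly. -/
theorem continuousOn_of_mul_coeff {J : Set ℝ} {e : ℝ → ℤ → ℂ} (he : ∀ t n, ‖e t n‖ = 1)
    (hc : ∀ n, ContinuousOn (fun t => e t n) J) {u v : ℝ → SobolevSpace s} (hu : ContinuousOn u J)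
    (h : ∀ t ∈ J, (v t).coeff = fun n => e t n * (u t).coeff n) : ContinuousOn v J := by
  intro t₀ ht₀
  rw [ContinuousWithinAt, Metric.tendsto_nhds]
  intro ε hε
  set η := ε / (2 * (‖u t₀‖ + 4))
  have hη : 0 < η := by positivity
  obtain ⟨S, hS⟩ := (u t₀).wbound.exists_tail hη
  have hS := hS S subset_rfl
  have h1 : ∀ᶠ t in nhdsWithin t₀ J, dist (u t) (u t₀) < η := Metric.tendsto_nhds.1 (hu t₀ ht₀) η hη
  have h2 : ∀ᶠ t in nhdsWithin t₀ J, ∀ n ∈ S, dist (e t n) (e t₀ n) < η :=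
    (Filter.eventually_all_finset S).2 fun n _ => Metric.tendsto_nhds.1 (hc n t₀ ht₀) η hη
  filter_upwards [h1, h2, self_mem_nhdsWithin] with t h1 h2 ht
  have hω := fun n => (sobWeight_pos s n).le
  rw [dist_eq_norm] at h1
  have b1 : WBound (sobWeight s) η (fun n => e t n * (u t - u t₀).coeff n) :=
    ((u t - u t₀).wbound.mono h1.le).of_le hω fun n => by rw [norm_mul, he, one_mul]
  have b2 : WBound (sobWeight s) (|2| * η)
      (fun n => (e t n - e t₀ n) * ((u t₀).coeff - (S : Set ℤ).indicator (u t₀).coeff) n) :=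
    (hS.smul 2).of_le hω fun n => by
      rw [norm_mul, norm_mul]
      refine mul_le_mul_of_nonneg_left (mul_le_mul_of_nonneg_right ?_ (norm_nonneg _)) (hω n)
      refine (norm_sub_le _ _).trans ?_
      rw [he, he]
      norm_num
  have b3 : WBound (sobWeight s) (|η| * ‖u t₀‖)
      (fun n => (e t n - e t₀ n) * (S : Set ℤ).indicator (u t₀).coeff n) :=
    ((u t₀).wbound.smul η).of_le hω fun n => by
      refine mul_le_mul_of_nonneg_left ?_ (hω n)
      by_cases hn : n ∈ S
      · rw [indicator_of_mem (by exact hn), norm_mul, norm_mul, Complex.norm_real,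
          Real.norm_of_nonneg hη.le, ← dist_eq_norm]
        exact mul_le_mul_of_nonneg_right (h2 n hn).le (norm_nonneg _)
      · rw [indicator_of_notMem (by exact hn), mul_zero, norm_zero]
        exact norm_nonneg _
  rw [dist_eq_norm]
  refine lt_of_le_of_lt (((v t - v t₀).norm_le_iff (M := η + |2| * η + |η| * ‖u t₀‖)
    (by positivity)).2 ?_) ?_
  · convert (b1.add b2).add b3 using 1
    funext n
    rw [coeff_sub, h t ht, h t₀ ht₀, coeff_sub]
    simp only [Pi.sub_apply, Pi.add_apply]
    ring
  · rw [abs_of_pos hη, abs_two]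
    have : ε = η * (2 * (‖u t₀‖ + 4)) := by
      simp only [η]; field_simp
    nlinarith [norm_nonneg (u t₀), mul_pos hη hη, mul_nonneg hη.le (norm_nonneg (u t₀))]

theorem hpath {T : ℝ} (hs : 1 / 6 ≤ s) {u : ℝ → SobolevSpace s} (hu : ContinuousOn u (Icc 0 T)) :
    HPath 0 T (fun t => (u t).coeff) := by
  constructor
  · obtain ⟨M, hM⟩ := isCompact_Icc.exists_bound_of_continuousOn hu
    exact ⟨max M 1, by positivity, fun t ht =>
      ((u t).wbound_of_le hs).mono ((hM t ht).trans (le_max_left _ _))⟩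
  · intro ε hε
    obtain ⟨δ, hδ, h⟩ := Metric.uniformContinuousOn_iff.1
      (isCompact_Icc.uniformContinuousOn_of_continuous hu) ε hε
    refine ⟨δ / 2, by positivity, fun r hr t ht hrt => ?_⟩
    have := h t ht r hr (by rw [Real.dist_eq]; linarith)
    rw [dist_eq_norm] at this
    rw [← coeff_sub]
    exact ((u t - u r).wbound_of_le hs).mono this.le

theorem continuousOn_of_HBound {γ T M : ℝ} (hγ : 0 < γ) (hT : 0 < T) {u : ℝ → SobolevSpace s}
    {v : ℝ → ℤ → ℂ} (hv : HBound γ 0 T (sobWeight s) M v) (h : ∀ t ∈ Icc 0 T, (u t).coeff = v t) :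
    ContinuousOn u (Icc 0 T) := by
  have hM : 0 ≤ M := (hv.bdd 0 ⟨le_rfl, hT.le⟩).nonneg
  have key : ∀ r ∈ Icc 0 T, ∀ t ∈ Icc 0 T, r ≤ t → dist (u t) (u r) ≤ M * (|t - r| / T) ^ γ := by
    intro r hr t ht hrt
    rw [dist_eq_norm, norm_le_iff _ (by positivity), coeff_sub, h r hr, h t ht,
      abs_of_nonneg (by linarith)]
    simpa using hv.holder r hr t ht hrt
  intro t₀ ht₀
  rw [ContinuousWithinAt, tendsto_iff_dist_tendsto_zero]
  have hlim : Filter.Tendsto (fun t => M * (|t - t₀| / T) ^ γ) (nhdsWithin t₀ (Icc 0 T)) (nhds 0) := by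
    have hcont : Continuous fun t : ℝ => M * (|t - t₀| / T) ^ γ :=
      continuous_const.mul (((continuous_id.sub continuous_const).abs.div_const T).rpow_const
        fun _ => Or.inr hγ.le)
    have := (hcont.tendsto t₀).mono_left (nhdsWithin_le_nhds (s := Icc 0 T))
    simpa [Real.zero_rpow hγ.ne'] using this
  refine squeeze_zero' (Filter.Eventually.of_forall fun _ => dist_nonneg) ?_ hlim
  filter_upwards [self_mem_nhdsWithin] with t ht
  rcases le_total t₀ t with hle | hle
  · exact key t₀ ht₀ t ht hle
  · rw [dist_comm, abs_sub_comm]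
    exact key t ht t₀ ht₀ hle

end SobolevSpace

/-! ### The interaction representation -/

/-- The multiplier `e^{i w(t) n²}` of the inverse of the modulated linear flow. -/
def phase (w : ℝ → ℝ) (t : ℝ) (n : ℤ) : ℂ := Complex.exp (Complex.I * w t * (n : ℂ) ^ 2)

theorem phase_eq (w : ℝ → ℝ) (t : ℝ) (n : ℤ) :
    phase w t n = Complex.exp (((w t * (n : ℝ) ^ 2 : ℝ) : ℂ) * Complex.I) := by
  rw [phase]
  congr 1
  push_cast
  ring

theorem norm_phase (w : ℝ → ℝ) (t : ℝ) (n : ℤ) : ‖phase w t n‖ = 1 := by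
  rw [phase_eq, Complex.norm_exp_ofReal_mul_I]

theorem conj_phase (w : ℝ → ℝ) (t : ℝ) (n : ℤ) :
    (starRingEnd ℂ) (phase w t n) = Complex.exp (-(Complex.I * w t * (n : ℂ) ^ 2)) := by
  rw [phase, ← Complex.exp_conj]
  simp

theorem phase_mul_conj (w : ℝ → ℝ) (t : ℝ) (n : ℤ) :
    phase w t n * (starRingEnd ℂ) (phase w t n) = 1 := by
  rw [conj_phase, phase, ← Complex.exp_add, add_neg_cancel, Complex.exp_zero]

theorem phase_mul_propagator (w : ℝ → ℝ) (t r : ℝ) (n : ℤ) :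
    phase w t n * propagator w t r n = phase w r n := by
  rw [phase, phase, propagator, ← Complex.exp_add]
  congr 1
  push_cast
  ring

theorem continuousOn_phase {w : ℝ → ℝ} {J : Set ℝ} (hw : ContinuousOn w J) (n : ℤ) :
    ContinuousOn (fun t => phase w t n) J := by
  unfold phase
  have : ContinuousOn (fun t => (w t : ℂ)) J := Complex.continuous_ofReal.comp_continuousOn hw
  fun_prop

/-- The resonance identity (n+j)² - (n+j+k)² + (n+k)² = n² - 2jk combines all phases into the one at
n. -/
theorem tri_nlsCoeff_phase (w : ℝ → ℝ) (t : ℝ) (x : ℤ → ℂ) (n : ℤ) :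
    tri (nlsCoeff w t) (fun n => phase w t n * x n) (fun n => phase w t n * x n)
      (fun n => phase w t n * x n) n = -Complex.I * (phase w t n * tri (fun _ => 1) x x x n) := by
  unfold tri
  rw [← tsum_mul_left, ← tsum_mul_left]
  refine tsum_congr fun p => ?_
  have e : Complex.exp (Complex.I * ((2 * (p.1 : ℝ) * (p.2 : ℝ) : ℝ) : ℂ) * w t) *
      phase w t (n + p.1) * (starRingEnd ℂ) (phase w t (n + p.1 + p.2)) * phase w t (n + p.2) =
      phase w t n := by
    rw [conj_phase, phase, phase, phase, ← Complex.exp_add, ← Complex.exp_add, ← Complex.exp_add]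
    congr 1
    push_cast
    ring
  rw [← e, nlsCoeff, map_mul]
  ring

section Translation

variable {w : ℝ → ℝ} {s T : ℝ} {u₀ : SobolevSpace s}

theorem tri_nlsCoeff_coeff (hs : 1 / 6 ≤ s) (f : SobolevSpace s) (t : ℝ) (n : ℤ) :
    tri (nlsCoeff w t) (fun n => phase w t n * f.coeff n) (fun n => phase w t n * f.coeff n)
      (fun n => phase w t n * f.coeff n) n = -Complex.I * (phase w t n * f.cubicCoeff n) := by
  rw [tri_nlsCoeff_phase, f.cubicCoeff_eq_tri hs]

/-- The Duhamel formula in the interaction representation. -/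
theorem duhamel_iff (u : ℝ → SobolevSpace s) (t : ℝ) (n : ℤ) :
    (u t).coeff n = propagator w t 0 n * u₀.coeff n
      - Complex.I * ∫ r in (0 : ℝ)..t, propagator w t r n * (u r).cubicCoeff n ↔
    phase w t n * (u t).coeff n = phase w 0 n * u₀.coeff n
      + ∫ r in (0 : ℝ)..t, -Complex.I * (phase w r n * (u r).cubicCoeff n) := by
  have hne : phase w t n ≠ 0 := Complex.exp_ne_zero _
  rw [← mul_right_inj' hne, mul_sub, ← mul_assoc, phase_mul_propagator, mul_left_comm,
    ← intervalIntegral.integral_const_mul (phase w t n),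
    intervalIntegral.integral_const_mul (-Complex.I), neg_mul, ← sub_eq_add_neg]
  simp only [← mul_assoc, phase_mul_propagator]

theorem IsSolution.isMild (hs : 1 / 6 ≤ s) (hw : ContinuousOn w (Icc 0 T))
    {u : ℝ → SobolevSpace s} (hu : IsSolution w u₀ (Icc 0 T) u) (hT : 0 < T) :
    IsMild 0 T (nlsCoeff w) (fun t n => phase w t n * (u t).coeff n) ∧
      ∀ n, phase w 0 n * (u 0).coeff n = phase w 0 n * u₀.coeff n := by
  have h0 : ∀ n, phase w 0 n * (u 0).coeff n = phase w 0 n * u₀.coeff n := fun n => by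
    have := (duhamel_iff u 0 n).1 (hu.duhamel 0 ⟨le_rfl, hT.le⟩ n)
    simpa using this
  choose V hV using fun t => SobolevSpace.exists_mul_coeff (by linarith) (norm_phase w t) (u t)
  have hc := SobolevSpace.continuousOn_of_mul_coeff (norm_phase w) (continuousOn_phase hw)
    hu.continuousOn (v := V) fun t _ => hV t
  refine ⟨⟨?_, fun t ht n => ?_⟩, h0⟩
  · simpa only [hV] using SobolevSpace.hpath hs hc
  · rw [h0]
    simp only [tri_nlsCoeff_coeff hs]
    exact (duhamel_iff u t n).1 (hu.duhamel t ht n)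

theorem IsMild.isSolution (hs : 1 / 6 ≤ s) {u : ℝ → SobolevSpace s} (hu : ContinuousOn u (Icc 0 T))
    {v : ℝ → ℤ → ℂ} (hv : IsMild 0 T (nlsCoeff w) v)
    (huv : ∀ t ∈ Icc 0 T, v t = fun n => phase w t n * (u t).coeff n)
    (h0 : v 0 = fun n => phase w 0 n * u₀.coeff n) : IsSolution w u₀ (Icc 0 T) u := by
  refine ⟨hu, fun t ht n => (duhamel_iff u t n).2 ?_⟩
  rw [← congrFun h0 n, ← congrFun (huv t ht) n, hv.eq t ht n]
  congr 1
  refine intervalIntegral.integral_congr fun r hr => ?_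
  rw [uIcc_of_le ht.1] at hr
  rw [← tri_nlsCoeff_coeff hs, huv r ⟨hr.1, hr.2.trans ht.2⟩]

end Translation

/-! ### Well-posedness in the Sobolev space -/

theorem IsSolution.mono {w : ℝ → ℝ} {s : ℝ} {u₀ : SobolevSpace s} {J J' : Set ℝ}
    {u : ℝ → SobolevSpace s} (h : IsSolution w u₀ J u) (hJ : J' ⊆ J) : IsSolution w u₀ J' u :=
  ⟨h.continuousOn.mono hJ, fun t ht => h.duhamel t (hJ ht)⟩

theorem IsIrregularOn.mono {ρ γ T T' : ℝ} {w : ℝ → ℝ} (h : IsIrregularOn ρ γ w T) (hT : T' ≤ T) :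
    IsIrregularOn ρ γ w T' := by
  obtain ⟨hw, C, hC⟩ := h
  exact ⟨hw.mono (Icc_subset_Icc_right hT), C, fun a r t hr hrt ht => hC a r t hr hrt (ht.trans hT)⟩

/-- Unconditional well-posedness on the interval on which the modulation is irregular. -/
theorem IsIrregularOn.existsUniqueSolution {ρ γ T s : ℝ} {w : ℝ → ℝ} (hρ : 2 / 3 < ρ)
    (hγ : 1 / 2 < γ) (hγ1 : γ < 1) (hT : 0 < T) (hw : IsIrregularOn ρ γ w T) (hs : 1 / 6 ≤ s)
    (u₀ : SobolevSpace s) : ExistsUniqueSolution w u₀ (Icc 0 T) := by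
  have hs0 : 0 ≤ s := by linarith
  obtain ⟨f₀, hf₀⟩ := SobolevSpace.exists_mul_coeff hs0 (norm_phase w 0) u₀
  obtain ⟨v, M, hv0, hv, hb⟩ := hw.exists_isMild hρ hγ hT hs (hf₀ ▸ f₀.wbound)
  have hex : ∀ t, ∃ V : SobolevSpace s, t ∈ Icc 0 T → V.coeff = v t := fun t => by
    by_cases ht : t ∈ Icc 0 T
    · obtain ⟨V, hV⟩ := SobolevSpace.exists_coeff_eq hs0 (hb.bdd t ht)
      exact ⟨V, fun _ => hV⟩
    · exact ⟨0, fun h => absurd h ht⟩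
  choose V hV using hex
  have hVc := SobolevSpace.continuousOn_of_HBound (by linarith) hT hb hV
  have hn : ∀ t n, ‖(starRingEnd ℂ) (phase w t n)‖ = 1 := fun t n => by
    rw [RCLike.norm_conj, norm_phase]
  choose u hu using fun t => SobolevSpace.exists_mul_coeff hs0 (hn t) (V t)
  have huc := SobolevSpace.continuousOn_of_mul_coeff hn
    (fun n => Complex.continuous_conj.comp_continuousOn (continuousOn_phase hw.1 n)) hVc fun t _ => hu t
  have huv : ∀ t ∈ Icc 0 T, v t = fun n => phase w t n * (u t).coeff n := fun t ht => by
    funext n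
    rw [hu, ← mul_assoc, phase_mul_conj, one_mul, hV t ht]
  have hsol : IsSolution w u₀ (Icc 0 T) u := hv.isSolution hs huc huv hv0
  refine ⟨u, hsol, fun u' hu' t ht => SobolevSpace.coeff_injective (funext fun n => ?_)⟩
  obtain ⟨m, m0⟩ := hsol.isMild hs hw.1 hT
  obtain ⟨m', m0'⟩ := hu'.isMild hs hw.1 hT
  -- Any competing solution becomes a mild one with the same initial value; no regularity beyond
  -- continuity in H^s is asked of it.
  have := congrFun (m.eqOn_of_isIrregularOn hρ hγ hγ1 hT hw m'
    (funext fun n => (m0 n).trans (m0' n).symm) ht) n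
  exact mul_left_cancel₀ (Complex.exp_ne_zero _) this.symm

/-- Solutions on all bounded intervals are restrictions of a global solution. -/
theorem existsUniqueSolution_Ici {w : ℝ → ℝ} {s : ℝ} {u₀ : SobolevSpace s}
    (h : ∀ τ : ℝ, 0 < τ → ExistsUniqueSolution w u₀ (Icc 0 τ)) :
    ExistsUniqueSolution w u₀ (Ici 0) := by
  have huniq : ∀ τ : ℝ, 0 < τ → ∀ u v, IsSolution w u₀ (Icc 0 τ) u → IsSolution w u₀ (Icc 0 τ) v →
      EqOn u v (Icc 0 τ) := fun τ hτ u v hu hv => by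
    obtain ⟨z, -, hz⟩ := h τ hτ
    exact fun t ht => (hz u hu ht).trans (hz v hv ht).symm
  choose U hU _ using fun k : ℕ => h (k + 1) k.cast_add_one_pos
  -- `U k` solves on [0,k+1], so t lies strictly before the right end of the interval chosen for it;
  -- this margin yields continuity at t relative to [0,∞).
  set u : ℝ → SobolevSpace s := fun t => U ⌈t⌉₊ t with hu
  have heq : ∀ k : ℕ, EqOn u (U k) (Icc 0 (k + 1)) := by
    intro k t ht
    have h1 : t ≤ ⌈t⌉₊ + 1 := (Nat.le_ceil t).trans (by linarith)
    have hpos : (0 : ℝ) < min (⌈t⌉₊ + 1 : ℝ) (k + 1) := lt_min (by positivity) (by positivity)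
    exact huniq _ hpos _ _ ((hU _).mono (Icc_subset_Icc_right (min_le_left _ _)))
      ((hU k).mono (Icc_subset_Icc_right (min_le_right _ _))) ⟨ht.1, le_min h1 ht.2⟩
  have hsol : IsSolution w u₀ (Ici 0) u := by
    constructor
    · intro t ht
      have hlt : t < ⌈t⌉₊ + 1 := (Nat.le_ceil t).trans_lt (by linarith)
      have hc := ((hU ⌈t⌉₊).continuousOn.congr (heq _)) t ⟨ht, hlt.le⟩
      refine hc.mono_of_mem_nhdsWithin ?_
      filter_upwards [self_mem_nhdsWithin, mem_nhdsWithin_of_mem_nhds (Iio_mem_nhds hlt)] with r h1 h2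
      exact ⟨h1, le_of_lt h2⟩
    · intro t ht n
      have hlt : t ≤ ⌈t⌉₊ + 1 := (Nat.le_ceil t).trans (by linarith)
      refine ((hU ⌈t⌉₊).duhamel t ⟨ht, hlt⟩ n).trans ?_
      congr 2
      refine intervalIntegral.integral_congr fun r hr => ?_
      rw [uIcc_of_le ht] at hr
      simp only [heq ⌈t⌉₊ ⟨hr.1, hr.2.trans hlt⟩]
  refine ⟨u, hsol, fun v hv t ht => ?_⟩
  have ht' : 0 ≤ t := ht
  exact huniq (t + 1) (by linarith) _ _ (hv.mono Icc_subset_Ici_self) (hsol.mono Icc_subset_Ici_self)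
    ⟨ht', by linarith⟩

end ModulatedNLS

end

theorem theoremA1 (ρ γ T : ℝ) (hρ : 2 / 3 < ρ) (hγ₀ : 1 / 2 < γ) (hγ₁ : γ < 1) (hT : 0 < T)
    (w : ℝ → ℝ) (hw : ModulatedNLS.IsIrregularOn ρ γ w T) (s : ℝ) (hs : 1 / 6 ≤ s) :
    ModulatedNLS.UnconditionallyLocallyWellPosed w T s ∧
      (ModulatedNLS.IsIrregular ρ γ w → ModulatedNLS.UnconditionallyGloballyWellPosed w s) := by
  -- By mass conservation the local existence time can be taken to be all of T.
  refine ⟨fun u₀ => ⟨T, hT, le_rfl, fun τ hτ hτT =>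
    (hw.mono hτT).existsUniqueSolution hρ hγ₀ hγ₁ hτ hs u₀⟩, fun hw' u₀ => ?_⟩
  have h := fun τ (hτ : 0 < τ) => (hw' τ hτ).existsUniqueSolution hρ hγ₀ hγ₁ hτ hs u₀
  exact ⟨ModulatedNLS.existsUniqueSolution_Ici h, h⟩
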